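/- Let $d\ge 1$, $\mathcal X=[0,1]^d$, and let $f\sim\mathcal{GP}(0,\kappa)$ be a Gaussian process on $\mathcal X$ with continuous sample paths, with $\kappa(x,x')\le 1$ for all $x,x'\in\mathcal X$. Assume that almost surely all first-order partial derivatives of $f$ exist on $\mathcal X$ (one-sided at the boundary), and that there are constants $a,b>0$ with $$\mathbb P\Big(\sup_{x\in\mathcal X}\Big|\frac{\partial f(x)}{\partial x_i}\Big|>J\Big)\le a\,e^{-(J/b)^2}\qquad\text{for all } J>0,\ i=1,\dots,d.$$ Evaluating $f$ at $x_j$ yields $y_j=f(x_j)+\epsilon_j$, where $\epsilon_1,\epsilon_2,\dots$ are i.i.d. $\mathcal N(0,\eta^2)$ with $\eta>0$, independent of $f$. For data $D=\{(x_i,y_i)\}_{i=1}^{m}$ put $K=(\kappa(x_i,x_k))_{i,k}$, $k(x)=(\kappa(x,x_i))_i$, $Y=(y_i)_i$, and $$\mu_D(x)=k(x)^\top(K+\eta^2I)^{-1}Y,\qquad \kappa_D(x,x')=\kappa(x,x')-k(x)^\top(K+\eta^2I)^{-1}k(x').$$ Sequential Thompson sampling proceeds as follows: at step $j=1,2,\dots$,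 with $D_j=\{(x_i,y_i)\}_{i<j}$, it draws, with fresh randomness, a function $g_j\sim\mathcal{GP}(\mu_{D_j},\kappa_{D_j})$ with continuous sample paths, and evaluates $f$ at a maximiser $x_j\in\arg\max_{x\in\mathcal X} g_j(x)$ (ties being broken measurably, using only $g_j$ and $D_j$). Let $\gamma_n=\sup\{I(f_A;y_A): A\subset\mathcal X,\ |A|=n\}$ be the maximum information gain, where $I$ is Shannon mutual information (natural logarithms), $f_A=(f(x))_{x\in A}$ and $y_A=f_A+\epsilon_A$ with $\epsilon_A\sim\mathcal N(0,\eta^2 I)$ independent of $f$, and let $$\beta_n=4(d+1)\log n+2d\log(dab\sqrt\pi),\qquad C_1=\frac{\pi^2}{6}+\frac{\sqrt{2\pi}}{12},\qquad C_2=\frac{2}{\log(1+\eta^{-2})}.$$ Then for every $n\ge1$, $\gamma_n$ is finite, the simple regret $\max_{x\in\mathcal X}f(x)-\max_{1\le j\le n}f(x_j)$ is integrable, and the Bayes simple regret satisfies $$\mathrm{BSR}(n)=\mathbb E\Big[\max_{x\in\mathcal X}f(x)-\max_{1\le j\le n}f(x_j)\Big]\le\frac{C_1}{n}+\sqrt{\frac{C_2\,\beta_n\,\gamma_n}{n}},$$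 where the expectation is over $f$, the noise and the algorithm's randomness, and the square root is read as $0$ when $\beta_n<0$. -/

import Mathlib

open MeasureTheory ProbabilityTheory Set
open scoped ENNReal NNReal Matrix

/-- The domain `[0,1]^d`. -/
abbrev Cube (d : ℕ) : Type := Fin d → unitInterval

section Setting

variable {Ω : Type*} [MeasurableSpace Ω] {d : ℕ}

/-- The restriction of `h` to the line through `p` in the `i`-th coordinate direction,
as a function of the `i`-th coordinate `t ∈ [0,1]` (extended by constants outside `[0,1]`). -/
noncomputable def coordLine (h : Cube d → ℝ) (i : Fin d) (p : Cube d) : ℝ → ℝ :=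
  IccExtend (zero_le_one (α := ℝ)) fun t => h (Function.update p i t)

/-- The partial derivative of `h` in the `i`-th coordinate at `p` (one-sided on the boundary). -/
noncomputable def partialDeriv (h : Cube d → ℝ) (i : Fin d) (p : Cube d) : ℝ :=
  derivWithin (coordLine h i p) (Icc 0 1) (p i)

/-- All first order partial derivatives of `h` exist on the whole cube. -/
def HasPartialDerivs (h : Cube d → ℝ) : Prop :=
  ∀ (i : Fin d) (p : Cube d), DifferentiableWithinAt ℝ (coordLine h i p) (Icc 0 1) (p i)

/-- The random continuous function `f` is a sample from the centred Gaussian process with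
covariance `κ`. -/
structure IsCenteredGP (P : Measure Ω) (κ : Cube d → Cube d → ℝ) (f : Ω → C(Cube d, ℝ)) :
    Prop where
  measurable_eval : ∀ p, Measurable fun ω => f ω p
  gaussian : IsGaussianProcess (fun (p : Cube d) ω => f ω p) P
  mean_zero : ∀ p, ∫ ω, f ω p ∂P = 0
  cov_eq : ∀ p q, cov[fun ω => f ω p, fun ω => f ω q; P] = κ p q

/-- The partial derivatives of the sample paths exist and satisfy
`P (sup_p |∂f(p)/∂p_i| > J) ≤ a * exp (-(J/b)^2)` for all `J > 0` and all `i`. -/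
structure GradientTail (P : Measure Ω) (f : Ω → C(Cube d, ℝ)) (a b : ℝ) : Prop where
  exists_partial : ∀ᵐ ω ∂P, HasPartialDerivs (f ω)
  tail : ∀ (i : Fin d) (J : ℝ), 0 < J →
    P {ω | ∃ p, J < |partialDeriv (f ω) i p|} ≤ ENNReal.ofReal (a * Real.exp (-(J / b) ^ 2))

/-- The noise variables are i.i.d. `N(0, η²)` and independent of the random function `f`. -/
structure IsGaussianNoise (P : Measure Ω) (η : ℝ) (f : Ω → C(Cube d, ℝ)) (ε : ℕ → Ω → ℝ) :
    Prop where
  measurable : ∀ j, Measurable (ε j)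
  law : ∀ j, P.map (ε j) = gaussianReal 0 (Real.toNNReal (η ^ 2))
  indep : iIndepFun ε P
  indep_prior : IndepFun (fun ω (p : Cube d) => f ω p) (fun ω (j : ℕ) => ε j ω) P

/-- The noisy observation `y_j = f(x_j) + ε_j`. -/
def observation (f : Ω → C(Cube d, ℝ)) (ε : ℕ → Ω → ℝ) (x : ℕ → Ω → Cube d) (j : ℕ) (ω : Ω) : ℝ :=
  f ω (x j ω) + ε j ω

/-- The matrix `K + η² I` of the query points `xs`, with `K = (κ (x_i, x_k))_{i,k}`. -/
def noisyGram (κ : Cube d → Cube d → ℝ) (η : ℝ) {j : ℕ} (xs : Fin j → Cube d) :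
    Matrix (Fin j) (Fin j) ℝ :=
  (Matrix.of fun i k => κ (xs i) (xs k)) + (η ^ 2) • (1 : Matrix (Fin j) (Fin j) ℝ)

/-- Posterior mean `k(p)ᵀ (K + η² I)⁻¹ Y` of the Gaussian process given the data `(xs, ys)`. -/
noncomputable def posteriorMean (κ : Cube d → Cube d → ℝ) (η : ℝ) {j : ℕ}
    (xs : Fin j → Cube d) (ys : Fin j → ℝ) (p : Cube d) : ℝ :=
  (fun i => κ p (xs i)) ⬝ᵥ ((noisyGram κ η xs)⁻¹ *ᵥ ys)

/-- Posterior covariance `κ(p,q) - k(p)ᵀ (K + η² I)⁻¹ k(q)` of the Gaussian process given queries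
at the points `xs`. -/
noncomputable def posteriorCov (κ : Cube d → Cube d → ℝ) (η : ℝ) {j : ℕ}
    (xs : Fin j → Cube d) (p q : Cube d) : ℝ :=
  κ p q - (fun i => κ p (xs i)) ⬝ᵥ ((noisyGram κ η xs)⁻¹ *ᵥ fun i => κ q (xs i))

/-- The σ-algebra generated by all values of a random function. -/
@[reducible] def pathSigma (g : Ω → C(Cube d, ℝ)) : MeasurableSpace Ω :=
  ⨆ p : Cube d, MeasurableSpace.comap (fun ω => g ω p) inferInstance

/-- The σ-algebra generated by the data `(x_i, y_i)`, `i < j`. -/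
@[reducible] def dataSigma (x : ℕ → Ω → Cube d) (y : ℕ → Ω → ℝ) (j : ℕ) : MeasurableSpace Ω :=
  ⨆ i : Fin j, (MeasurableSpace.comap (x i) inferInstance ⊔
    MeasurableSpace.comap (y i) inferInstance)

/-- The σ-algebra of everything that exists before the posterior sample of step `j` is drawn:
the unknown function, the noise, and the samples and queries of the steps `i < j`. -/
@[reducible] def worldSigma (f : Ω → C(Cube d, ℝ)) (ε : ℕ → Ω → ℝ) (g : ℕ → Ω → C(Cube d, ℝ))
    (x : ℕ → Ω → Cube d) (j : ℕ) : MeasurableSpace Ω :=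
  pathSigma f ⊔ (⨆ k : ℕ, MeasurableSpace.comap (ε k) inferInstance) ⊔
    ⨆ i : Fin j, (pathSigma (g i) ⊔ MeasurableSpace.comap (x i) inferInstance)

/-- Sequential Thompson sampling. At step `j` (counted from `0`), with data
`D_j = {(x_i, y_i) : i < j}`, a function `g_j` is drawn from the posterior `GP(μ_{D_j}, κ_{D_j})`
with fresh randomness, and `f` is queried at a maximiser `x_j` of `g_j`.

`sample_law` says that, conditionally on everything that happened before (including the unknown
`f` and the noise), every finite linear combination `∑ c_k g_j(t_k)` is normal with the posterior
mean and variance, i.e. `g_j` is Gaussian with the posterior mean and covariance functions.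
`query_measurable` says that ties between maximisers are broken using only `g_j` and `D_j`. -/
structure IsSeqThompsonSampling (P : Measure Ω) (κ : Cube d → Cube d → ℝ) (η : ℝ)
    (f : Ω → C(Cube d, ℝ)) (ε : ℕ → Ω → ℝ) (g : ℕ → Ω → C(Cube d, ℝ)) (x : ℕ → Ω → Cube d) :
    Prop where
  sample_measurable : ∀ j p, Measurable fun ω => g j ω p
  sample_law : ∀ (j m : ℕ) (t : Fin m → Cube d) (c : Fin m → ℝ) (S : Set Ω) (B : Set ℝ),
    MeasurableSet[worldSigma f ε g x j] S → MeasurableSet B →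
    P (S ∩ {ω | ∑ k, c k * g j ω (t k) ∈ B}) =
      ∫⁻ ω in S, gaussianReal
        (∑ k, c k * posteriorMean κ η (fun i : Fin j => x i ω)
          (fun i : Fin j => observation f ε x i ω) (t k))
        (Real.toNNReal (∑ k, ∑ l, c k * c l *
          posteriorCov κ η (fun i : Fin j => x i ω) (t k) (t l))) B ∂P
  query_measurable : ∀ j,
    Measurable[dataSigma x (observation f ε x) j ⊔ pathSigma (g j)] (x j)
  query_argmax : ∀ j ω p, g j ω p ≤ g j ω (x j ω)

/-- The simple regret `max f - max_{j ≤ n} f(x_j)` after `n ≥ 1` evaluations. -/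
noncomputable def simpleRegret (f : Ω → C(Cube d, ℝ)) (x : ℕ → Ω → Cube d) (n : ℕ) (ω : Ω) : ℝ :=
  (⨆ p : Cube d, f ω p) - ⨆ j : Fin n, f ω (x j ω)

/-- Shannon mutual information (in nats) of two random variables. -/
noncomputable def mutualInfo {α β : Type*} [MeasurableSpace α] [MeasurableSpace β]
    (P : Measure Ω) (X : Ω → α) (Y : Ω → β) : ℝ≥0∞ :=
  InformationTheory.klDiv (P.map fun ω => (X ω, Y ω)) ((P.map X).prod (P.map Y))

/-- The maximum information gain: the supremum, over all sets `A` of `n` distinct points of the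
cube, of the mutual information between the function values `f_A` and the noisy observations
`y_A = f_A + ε_A`. A set of `n` points is given by an enumeration without repetition. -/
noncomputable def maxInfoGain (P : Measure Ω) (f : Ω → C(Cube d, ℝ)) (ε : ℕ → Ω → ℝ) (n : ℕ) :
    ℝ≥0∞ :=
  ⨆ A : Fin n ↪ Cube d,
    mutualInfo P (fun ω (i : Fin n) => f ω (A i)) (fun ω (i : Fin n) => f ω (A i) + ε i ω)

end Setting

/-- `β_n = 4 (d + 1) log n + 2 d log (d a b √π)`. -/
noncomputable def betaCoeff (d : ℕ) (a b : ℝ) (n : ℕ) : ℝ :=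
  4 * ((d : ℝ) + 1) * Real.log n + 2 * d * Real.log (d * a * b * √Real.pi)

/-! Write `μ_j` and `σ_j` for the posterior mean and standard deviation given `D_j`, and `M = d a b
√π`. The core is the Thompson sampling identity: given `D_j`, the sample `g_j` and the unknown `f`
are independent with the same law. Hence `E max f = E max g_j = E g_j(x_j)`, while `E f(x_j) = E
μ_j(x_j)`, so the expected regret of step `j` is `E[g_j(x_j) - μ_j(x_j)]`. It is at most `s E
σ_j(x_j)` plus the mean excess of `g_j` over the upper confidence bound `μ_j + s σ_j` at `x_j`.

The excess (`lintegral_excess_le`) is controlled on a grid of `N ^ d` cells, each represented by a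
point of least posterior variance. Moving from `x_j` to the representative costs a Lipschitz
constant over `N`, once for the sample and once for the posterior mean, and can only decrease `σ_j`.
At the representatives a union bound over Gaussian mean excesses gives `N ^ d exp(-s ^ 2 / 2) /
√(2π)`. The gradient tail integrates to an expected total Lipschitz constant of at most `M / 2`, so
the move costs `M / N`. With `s ^ 2 = β_n` and `N = ⌊n ^ 2 M⌋`, both errors are of order `n⁻²`.

The sum of the `σ_j(x_j)` is bounded pathwise (`sum_sqrt_posteriorCov_le`): the predictive variances
multiply up to `det (K + η² I)`, whose normalised logarithm is twice a mutual information and so at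
most `2 γ_n`; Cauchy–Schwarz does the rest. The simple regret is at most the average of the step
regrets.

Most of the work is the measure theory behind the first paragraph, because the design is random and
adaptive. The posterior is defined by Bayes' formula as a kernel on `C(Cube d, ℝ)`, so that it is a
law on continuous functions measurable in the data. For a fixed design, Gaussian regression
identifies it with the explicit `μ_D` and `κ_D` for every value of the data, not merely almost every
one (`map_posteriorKernel`). For the adaptive design, an induction shows that the joint law of `f`,
the data and the future noise has the likelihood as its density (`exists_data_measure`), since each
query depends on `f` only through the data. -/

set_option linter.unusedSectionVars false

/-! ### The Borel σ-algebra of the space of continuous functions -/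

instance continuousMapMeasurableSpace {X : Type*} [TopologicalSpace X] :
    MeasurableSpace C(X, ℝ) := borel _

instance continuousMapBorelSpace {X : Type*} [TopologicalSpace X] : BorelSpace C(X, ℝ) := ⟨rfl⟩

section ContinuousMapMeasurable

variable {X : Type*} [TopologicalSpace X]

theorem ContinuousMap.measurable_eval_const (p : X) : Measurable fun h : C(X, ℝ) => h p :=
  (continuous_eval_const p).measurable

theorem isTopologicalBasis_metric_ball (E : Type*) [PseudoMetricSpace E] :
    TopologicalSpace.IsTopologicalBasis {s : Set E | ∃ x r, s = Metric.ball x r} := by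
  refine TopologicalSpace.isTopologicalBasis_of_isOpen_of_nhds ?_ ?_
  · rintro _ ⟨x, r, rfl⟩
    exact Metric.isOpen_ball
  · intro x u hx hu
    obtain ⟨r, hr, hru⟩ := Metric.isOpen_iff.1 hu x hx
    exact ⟨_, ⟨x, r, rfl⟩, Metric.mem_ball_self hr, hru⟩

variable [CompactSpace X] [T2Space X] [SecondCountableTopology X]

/-- A map into the continuous functions is measurable as soon as all its evaluations are. -/
theorem ContinuousMap.measurable_of_eval {α : Type*} [MeasurableSpace α]
    {F : α → C(X, ℝ)} (hF : ∀ p, Measurable fun a => F a p) : Measurable F := by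
  -- Balls form a basis and the space is second countable, so it suffices to measure distances to a
  -- fixed function; these are suprema over a countable dense set of points.
  have hdist : ∀ h₀ : C(X, ℝ), Measurable fun a => dist (F a) h₀ := by
    intro h₀
    rcases isEmpty_or_nonempty X with hX | hX
    · have : (fun a => dist (F a) h₀) = fun _ => 0 := by
        ext a
        rw [dist_eq_zero]
        ext p
        exact isEmptyElim p
      rw [this]
      exact measurable_const
    refine measurable_of_Iic fun r => ?_
    obtain ⟨Q, hQc, hQd⟩ := TopologicalSpace.exists_countable_dense X
    have : (fun a => dist (F a) h₀) ⁻¹' Iic r = ⋂ p ∈ Q, {a | dist (F a p) (h₀ p) ≤ r} := by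
      ext a
      simp only [mem_preimage, mem_Iic, mem_iInter, mem_ofPred_eq]
      rw [ContinuousMap.dist_le_iff_of_nonempty]
      refine ⟨fun h p _ => h p, fun h p => ?_⟩
      have hcl : IsClosed {p | dist (F a p) (h₀ p) ≤ r} :=
        isClosed_le (by fun_prop) continuous_const
      have := hcl.closure_subset_iff.2 (fun p hp => h p hp : Q ⊆ _)
      rw [hQd.closure_eq] at this
      exact this (mem_univ p)
    rw [this]
    exact MeasurableSet.biInter hQc fun p _ =>
      measurableSet_le ((hF p).dist measurable_const) measurable_const
  have hb : (continuousMapMeasurableSpace : MeasurableSpace C(X, ℝ)) = _ :=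
    (isTopologicalBasis_metric_ball C(X, ℝ)).borel_eq_generateFrom
  rw [hb]
  refine measurable_generateFrom ?_
  rintro _ ⟨h₀, r, rfl⟩
  exact hdist h₀ measurableSet_Iio

/-- Translates hypotheses phrased through evaluations, such as independence of prior and noise, into
statements about `f` as a random element of `C(X, ℝ)`. -/
theorem ContinuousMap.measurableSpace_eq_comap_pi :
    (continuousMapMeasurableSpace : MeasurableSpace C(X, ℝ)) =
      MeasurableSpace.comap (fun h (p : X) => h p) MeasurableSpace.pi := by
  refine le_antisymm ?_ ?_
  · have : @Measurable _ _ (MeasurableSpace.comap (fun (h : C(X, ℝ)) (p : X) => h p)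
        MeasurableSpace.pi) continuousMapMeasurableSpace (id : C(X, ℝ) → C(X, ℝ)) := by
      refine @ContinuousMap.measurable_of_eval X _ _ _ _ _ (MeasurableSpace.comap _ _) _ fun p => ?_
      exact (measurable_pi_apply p).comp (comap_measurable _)
    exact fun s hs => this hs
  · rw [← measurable_iff_comap_le]
    exact measurable_pi_iff.2 fun p => ContinuousMap.measurable_eval_const p

end ContinuousMapMeasurable

theorem ContinuousMap.measurable_uncurry_eval {X : Type*} [TopologicalSpace X] [CompactSpace X]
    [SecondCountableTopology X] [MeasurableSpace X] [BorelSpace X] :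
    Measurable fun z : C(X, ℝ) × X => z.1 z.2 :=
  (continuous_eval : Continuous fun z : C(X, ℝ) × X => z.1 z.2).measurable

/-! ### Measures determined by linear functionals -/

/-- Finite measures on `ℝ^ι` that have the same image under all linear forms are equal. -/
theorem Measure.ext_of_map_sum_mul {ι : Type*} [Fintype ι] {μ ν : Measure (ι → ℝ)}
    [IsFiniteMeasure μ] [IsFiniteMeasure ν]
    (h : ∀ c : ι → ℝ, μ.map (fun u => ∑ i, c i * u i) = ν.map (fun u => ∑ i, c i * u i)) :
    μ = ν := by
  classical
  refine Measure.ext_of_charFunDual ?_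
  ext L
  rw [charFunDual_eq_charFun_map_one, charFunDual_eq_charFun_map_one]
  have hL : (L : (ι → ℝ) → ℝ) = fun u => ∑ i, L (Pi.single i 1) * u i := by
    ext u
    conv_lhs => rw [← Finset.univ_sum_single u]
    rw [map_sum]
    refine Finset.sum_congr rfl fun i _ => ?_
    have : (Pi.single i (u i) : ι → ℝ) = u i • Pi.single i 1 := by
      rw [← Pi.single_smul]; simp
    rw [this, map_smul, smul_eq_mul, mul_comm]
  rw [hL, h]

/-- Finite measures on the space of continuous functions that agree on all finite linear
combinations of evaluations are equal. -/
theorem ContinuousMap.measure_ext_of_map_sum {X : Type*} [TopologicalSpace X] [CompactSpace X] [T2Space X]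
    [SecondCountableTopology X] {μ ν : Measure C(X, ℝ)} [IsFiniteMeasure μ] [IsFiniteMeasure ν]
    (h : ∀ (m : ℕ) (t : Fin m → X) (c : Fin m → ℝ),
      μ.map (fun u => ∑ i, c i * u (t i)) = ν.map (fun u => ∑ i, c i * u (t i))) :
    μ = ν := by
  have hm : Measurable fun (u : C(X, ℝ)) (p : X) => u p :=
    measurable_pi_iff.2 fun p => ContinuousMap.measurable_eval_const p
  -- On the product space a finite measure is determined by its finite marginals, and each marginal
  -- by its linear forms (Cramér–Wold).
  have key : μ.map (fun u (p : X) => u p) = ν.map (fun u (p : X) => u p) := by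
    refine IsProjectiveLimit.unique (P := fun I : Finset X =>
      (ν.map (fun u (p : X) => u p)).map I.restrict) (fun I => ?_) (fun I => rfl)
    refine Measure.ext_of_map_sum_mul fun c => ?_
    have hI : Measurable (I.restrict : (X → ℝ) → I → ℝ) := Finset.measurable_restrict I
    have hc : Measurable fun u : I → ℝ => ∑ i, c i * u i := by fun_prop
    beta_reduce
    rw [Measure.map_map hI hm, Measure.map_map hI hm, Measure.map_map hc (hI.comp hm),
      Measure.map_map hc (hI.comp hm)]
    have := h (Fintype.card I) (fun k => ((Fintype.equivFin I).symm k : X))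
      (fun k => c ((Fintype.equivFin I).symm k))
    convert this using 2 <;>
    · ext u
      simp only [Function.comp_apply, Finset.restrict]
      exact ((Fintype.equivFin I).symm.sum_comp (fun i => c i * u i)).symm
  ext s hs
  rw [ContinuousMap.measurableSpace_eq_comap_pi] at hs
  obtain ⟨S, hS, rfl⟩ := hs
  rw [← Measure.map_apply hm hS, key, Measure.map_apply hm hS]

/-! ### Gaussian noise vectors -/

theorem lintegral_fin_prod_eq_prod {n : ℕ} {φ : Fin n → ℝ → ℝ≥0∞} (hφ : ∀ i, Measurable (φ i)) :
    ∫⁻ x : Fin n → ℝ, ∏ i, φ i (x i) = ∏ i, ∫⁻ t, φ i t := by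
  induction n with
  | zero => simp [volume_pi]
  | succ n ih =>
    have hmp := (volume_preserving_piFinSuccAbove (fun _ : Fin (n + 1) => ℝ) 0).symm
    have hm : ∀ m (ψ : Fin m → ℝ → ℝ≥0∞), (∀ i, Measurable (ψ i)) →
        Measurable fun x : Fin m → ℝ => ∏ i, ψ i (x i) := fun m ψ hψ =>
      Finset.measurable_prod _ fun i _ => (hψ i).comp (measurable_pi_apply i)
    rw [← hmp.lintegral_comp (hm _ _ hφ)]
    have : ∀ z : ℝ × (Fin n → ℝ), ∏ i, φ i ((MeasurableEquiv.piFinSuccAbove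
        (fun _ : Fin (n + 1) => ℝ) 0).symm z i) = φ 0 z.1 * ∏ i : Fin n, φ i.succ (z.2 i) := by
      intro z
      rw [Fin.prod_univ_succ]
      simp [MeasurableEquiv.piFinSuccAbove]
    simp_rw [this]
    rw [Measure.volume_eq_prod, lintegral_prod_mul (hφ 0).aemeasurable
      (hm _ (fun i => φ i.succ) fun i => hφ i.succ).aemeasurable,
      ih fun i => hφ i.succ, Fin.prod_univ_succ]

/-- The density at `y` of a vector of independent Gaussians with means `u` and variance `η²`. -/
@[irreducible] noncomputable def noiseDensity (η : ℝ) {j : ℕ} (u y : Fin j → ℝ) : ℝ :=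
  ∏ i, gaussianPDFReal 0 (Real.toNNReal (η ^ 2)) (y i - u i)

section NoiseDensity

variable {η : ℝ} {j : ℕ}

theorem toNNReal_sq_ne_zero (hη : 0 < η) : Real.toNNReal (η ^ 2) ≠ 0 := by
  simp only [ne_eq, Real.toNNReal_eq_zero, not_le]
  positivity

theorem continuous_gaussianPDFReal (m : ℝ) (v : ℝ≥0) : Continuous (gaussianPDFReal m v) := by
  rw [gaussianPDFReal_def]
  fun_prop

theorem continuous_noiseDensity :
    Continuous fun z : (Fin j → ℝ) × (Fin j → ℝ) => noiseDensity η z.1 z.2 := by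
  unfold noiseDensity
  have := continuous_gaussianPDFReal 0 (Real.toNNReal (η ^ 2))
  fun_prop

theorem measurable_noiseDensity :
    Measurable fun z : (Fin j → ℝ) × (Fin j → ℝ) => noiseDensity η z.1 z.2 :=
  continuous_noiseDensity.measurable

theorem noiseDensity_nonneg (u y : Fin j → ℝ) : 0 ≤ noiseDensity η u y := by
  rw [noiseDensity]
  exact Finset.prod_nonneg fun _ _ => gaussianPDFReal_nonneg _ _ _

theorem noiseDensity_pos (hη : 0 < η) (u y : Fin j → ℝ) : 0 < noiseDensity η u y := by
  rw [noiseDensity]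
  exact Finset.prod_pos fun _ _ => gaussianPDFReal_pos _ _ _ (toNNReal_sq_ne_zero hη)

theorem gaussianPDFReal_le (m : ℝ) (v : ℝ≥0) (t : ℝ) :
    gaussianPDFReal m v t ≤ (√(2 * Real.pi * v))⁻¹ := by
  rw [gaussianPDFReal_def]
  refine mul_le_of_le_one_right (by positivity) ?_
  rw [Real.exp_le_one_iff]
  have : 0 ≤ (t - m) ^ 2 / (2 * v) := by positivity
  rw [neg_div]
  linarith

theorem noiseDensity_le (u y : Fin j → ℝ) :
    noiseDensity η u y ≤ (√(2 * Real.pi * Real.toNNReal (η ^ 2)))⁻¹ ^ j := by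
  calc noiseDensity η u y ≤ ∏ _i : Fin j, (√(2 * Real.pi * Real.toNNReal (η ^ 2)))⁻¹ := by
        rw [noiseDensity]
        exact Finset.prod_le_prod (fun _ _ => gaussianPDFReal_nonneg _ _ _)
          fun _ _ => gaussianPDFReal_le _ _ _
    _ = _ := by simp

theorem ofReal_noiseDensity (u y : Fin j → ℝ) : ENNReal.ofReal (noiseDensity η u y) =
    ∏ i, gaussianPDF 0 (Real.toNNReal (η ^ 2)) (y i - u i) := by
  rw [noiseDensity, ENNReal.ofReal_prod_of_nonneg fun _ _ => gaussianPDFReal_nonneg _ _ _]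
  rfl

theorem pi_gaussianReal_eq_withDensity (hη : 0 < η) :
    Measure.pi (fun _ : Fin j => gaussianReal 0 (Real.toNNReal (η ^ 2))) =
      volume.withDensity fun e => ENNReal.ofReal (noiseDensity η 0 e) := by
  refine Measure.pi_eq fun s hsm => ?_
  rw [withDensity_apply _ (MeasurableSet.univ_pi hsm),
    ← lintegral_indicator (MeasurableSet.univ_pi hsm)]
  have hφ := measurable_gaussianPDF 0 (Real.toNNReal (η ^ 2))
  have : ∀ e : Fin j → ℝ, (univ.pi s).indicator
      (fun e => ENNReal.ofReal (noiseDensity η 0 e)) e =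
      ∏ i, (s i).indicator (gaussianPDF 0 (Real.toNNReal (η ^ 2))) (e i) := by
    intro e
    by_cases he : e ∈ univ.pi s
    · rw [indicator_of_mem he, ofReal_noiseDensity]
      refine Finset.prod_congr rfl fun i _ => ?_
      rw [indicator_of_mem (he i (mem_univ i))]
      simp
    · rw [indicator_of_notMem he]
      simp only [mem_univ_pi, not_forall] at he
      obtain ⟨i, hi⟩ := he
      exact (Finset.prod_eq_zero (Finset.mem_univ i) (indicator_of_notMem hi _)).symm
  simp_rw [this]
  rw [lintegral_fin_prod_eq_prod fun i => hφ.indicator (hsm i)]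
  refine Finset.prod_congr rfl fun i _ => ?_
  rw [lintegral_indicator (hsm i), gaussianReal_apply _ (toNNReal_sq_ne_zero hη)]

end NoiseDensity

/-! ### Noisy observations at fixed points -/

section FixedDesign

variable {Ω : Type*} [MeasurableSpace Ω] {P : Measure Ω} {d : ℕ} {κ : Cube d → Cube d → ℝ}
  {η : ℝ} {f : Ω → C(Cube d, ℝ)} {ε : ℕ → Ω → ℝ}

theorem IsCenteredGP.measurable (hf : IsCenteredGP P κ f) : Measurable f :=
  ContinuousMap.measurable_of_eval hf.measurable_eval

theorem IsGaussianNoise.indepFun (hε : IsGaussianNoise P η f ε) :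
    IndepFun f (fun ω (j : ℕ) => ε j ω) P := by
  have h := hε.indep_prior
  rw [IndepFun_iff_Indep] at h ⊢
  rw [ContinuousMap.measurableSpace_eq_comap_pi, MeasurableSpace.comap_comp]
  exact h

variable [IsProbabilityMeasure P]

theorem IsGaussianNoise.map_vector (hη : 0 < η) (hε : IsGaussianNoise P η f ε) (j : ℕ) :
    P.map (fun ω (i : Fin j) => ε i ω) =
      volume.withDensity fun e => ENNReal.ofReal (noiseDensity η 0 e) := by
  rw [← pi_gaussianReal_eq_withDensity hη]
  have h : iIndepFun (fun i : Fin j => ε i) P :=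
    hε.indep.precomp (g := fun i : Fin j => (i : ℕ)) Fin.val_injective
  rw [(iIndepFun_iff_map_fun_eq_pi_map fun i : Fin j => (hε.measurable i).aemeasurable).1 h]
  simp_rw [hε.law]

/-- The joint law of the random function and noisy observations at fixed points. -/
theorem lintegral_noisy_eval (hη : 0 < η) (hf : IsCenteredGP P κ f) (hε : IsGaussianNoise P η f ε)
    {j : ℕ} (xs : Fin j → Cube d) {Φ : C(Cube d, ℝ) × (Fin j → ℝ) → ℝ≥0∞} (hΦ : Measurable Φ) :
    ∫⁻ ω, Φ (f ω, fun i => f ω (xs i) + ε i ω) ∂P =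
      ∫⁻ y, ∫⁻ ω, Φ (f ω, y) * ENNReal.ofReal (noiseDensity η (fun i => f ω (xs i)) y) ∂P := by
  have hfm := hf.measurable
  have hem : Measurable fun ω (i : Fin j) => ε i ω :=
    measurable_pi_iff.2 fun i => hε.measurable i
  have hind : IndepFun f (fun ω (i : Fin j) => ε i ω) P :=
    hε.indepFun.comp (φ := id) (ψ := fun (e : ℕ → ℝ) (i : Fin j) => e i) measurable_id
      (measurable_pi_iff.2 fun i => measurable_pi_apply _)
  have hev : Measurable fun (h : C(Cube d, ℝ)) (i : Fin j) => h (xs i) :=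
    measurable_pi_iff.2 fun i => ContinuousMap.measurable_eval_const _
  have hadd : Measurable fun z : C(Cube d, ℝ) × (Fin j → ℝ) =>
      (z.1, (fun i => z.1 (xs i)) + z.2) :=
    measurable_fst.prodMk ((hev.comp measurable_fst).add measurable_snd)
  have hG : Measurable fun z : C(Cube d, ℝ) × (Fin j → ℝ) =>
      Φ (z.1, (fun i => z.1 (xs i)) + z.2) := hΦ.comp hadd
  have h1 : ∫⁻ ω, Φ (f ω, fun i => f ω (xs i) + ε i ω) ∂P =
      ∫⁻ z, Φ (z.1, (fun i => z.1 (xs i)) + z.2)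
        ∂(P.map fun ω => (f ω, fun i : Fin j => ε i ω)) := by
    rw [lintegral_map hG (hfm.prodMk hem)]
    rfl
  have hd : Measurable fun e : Fin j → ℝ => ENNReal.ofReal (noiseDensity η 0 e) :=
    (measurable_noiseDensity.comp (measurable_const.prodMk measurable_id)).ennreal_ofReal
  rw [h1, (indepFun_iff_map_prod_eq_prod_map_map hfm.aemeasurable hem.aemeasurable).1 hind,
    hε.map_vector hη j, lintegral_prod _ hG.aemeasurable,
    lintegral_map hG.lintegral_prod_right' hfm]
  have hL : Measurable fun z : C(Cube d, ℝ) × (Fin j → ℝ) =>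
      ENNReal.ofReal (noiseDensity η (fun i => z.1 (xs i)) z.2) :=
    (measurable_noiseDensity.comp ((hev.comp measurable_fst).prodMk measurable_snd)).ennreal_ofReal
  conv_rhs => rw [lintegral_lintegral_swap (by
    exact (((hΦ.mul hL).comp ((hfm.comp measurable_snd).prodMk measurable_fst))).aemeasurable)]
  refine lintegral_congr fun ω => ?_
  rw [lintegral_withDensity_eq_lintegral_mul _ hd
    (by exact hΦ.comp (hadd.comp (measurable_const.prodMk measurable_id)))]
  -- Translation invariance turns the noise variable into the observation `y = f(xs) + e`, and the
  -- noise density at `e` into the likelihood of `y`.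
  rw [← lintegral_sub_right_eq_self _ (fun i => f ω (xs i))]
  refine lintegral_congr fun y => ?_
  simp only [Pi.mul_apply, add_sub_cancel]
  rw [mul_comm]
  congr 2
  simp [noiseDensity]

end FixedDesign

/-! ### Gaussian regression: the residual of the posterior mean -/

section Covariance

variable {Ω : Type*} [MeasurableSpace Ω] {P : Measure Ω} {d : ℕ} {κ : Cube d → Cube d → ℝ}
  {η : ℝ} {f : Ω → C(Cube d, ℝ)} {ε : ℕ → Ω → ℝ}

theorem IsCenteredGP.memLp_two (hf : IsCenteredGP P κ f) (p : Cube d) :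
    MemLp (fun ω => f ω p) 2 P :=
  (hf.gaussian.hasGaussianLaw_eval p).memLp_two

theorem IsCenteredGP.symm (hf : IsCenteredGP P κ f) (p q : Cube d) : κ p q = κ q p := by
  rw [← hf.cov_eq, ← hf.cov_eq, covariance_comm]

theorem IsCenteredGP.hasGaussianLaw_vector (hf : IsCenteredGP P κ f) {ι : Type*} [Fintype ι]
    (s : ι → Cube d) : HasGaussianLaw (fun ω i => f ω (s i)) P := by
  have h := (hf.gaussian.comp_right s).hasGaussianLaw Finset.univ
  let L : (↥(Finset.univ : Finset ι) → ℝ) →L[ℝ] (ι → ℝ) :=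
    { toFun := fun u i => u ⟨i, Finset.mem_univ i⟩
      map_add' := fun _ _ => rfl
      map_smul' := fun _ _ => rfl }
  exact h.map L

theorem IsGaussianNoise.hasGaussianLaw (hε : IsGaussianNoise P η f ε) (i : ℕ) :
    HasGaussianLaw (ε i) P :=
  ⟨by rw [hε.law]; infer_instance⟩

theorem IsGaussianNoise.memLp_two (hε : IsGaussianNoise P η f ε) (i : ℕ) : MemLp (ε i) 2 P :=
  (hε.hasGaussianLaw i).memLp_two

theorem IsGaussianNoise.integral_eq_zero (hε : IsGaussianNoise P η f ε) (i : ℕ) :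
    ∫ ω, ε i ω ∂P = 0 := by
  have := integral_map (μ := P) (hε.measurable i).aemeasurable (f := fun x : ℝ => x)
    aestronglyMeasurable_id
  rw [← this, hε.law, integral_id_gaussianReal]

theorem IsGaussianNoise.indepFun_eval (hε : IsGaussianNoise P η f ε) (p : Cube d) (i : ℕ) :
    IndepFun (fun ω => f ω p) (ε i) P :=
  hε.indepFun.comp (φ := fun h : C(Cube d, ℝ) => h p) (ψ := fun e : ℕ → ℝ => e i)
    (ContinuousMap.measurable_eval_const p) (measurable_pi_apply i)

theorem IsGaussianNoise.cov_eval (hf : IsCenteredGP P κ f) (hε : IsGaussianNoise P η f ε)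
    (p : Cube d) (i : ℕ) : cov[fun ω => f ω p, ε i; P] = 0 :=
  (hε.indepFun_eval p i).covariance_eq_zero (hf.memLp_two p) (hε.memLp_two i)

theorem IsGaussianNoise.cov_eq (hε : IsGaussianNoise P η f ε) (i k : ℕ) :
    cov[ε i, ε k; P] = if i = k then η ^ 2 else 0 := by
  split_ifs with h
  · subst h
    rw [covariance_self (hε.measurable i).aemeasurable,
      ← variance_id_map (hε.measurable i).aemeasurable, hε.law, variance_id_gaussianReal,
      Real.coe_toNNReal _ (sq_nonneg η)]
  · exact (hε.indep.indepFun h).covariance_eq_zero (hε.memLp_two i) (hε.memLp_two k)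

variable [IsProbabilityMeasure P]

theorem memLp_two_noisy_eval (hf : IsCenteredGP P κ f) (hε : IsGaussianNoise P η f ε) (p : Cube d)
    (i : ℕ) : MemLp (fun ω => f ω p + ε i ω) 2 P :=
  (hf.memLp_two p).add (hε.memLp_two i)

theorem cov_eval_noisy_eval (hf : IsCenteredGP P κ f) (hε : IsGaussianNoise P η f ε)
    (p q : Cube d) (i : ℕ) : cov[fun ω => f ω p, fun ω => f ω q + ε i ω; P] = κ p q := by
  have := covariance_add_right (hf.memLp_two p) (hf.memLp_two q) (hε.memLp_two i)
  rw [hf.cov_eq, hε.cov_eval hf, add_zero] at this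
  exact this

theorem cov_noisy_eval (hf : IsCenteredGP P κ f) (hε : IsGaussianNoise P η f ε)
    {j : ℕ} (xs : Fin j → Cube d) (i k : Fin j) :
    cov[fun ω => f ω (xs i) + ε i ω, fun ω => f ω (xs k) + ε k ω; P] = noisyGram κ η xs i k := by
  have h1 := covariance_add_left (hf.memLp_two (xs i)) (hε.memLp_two i)
    (memLp_two_noisy_eval hf hε (xs k) k)
  have h2 := covariance_add_right (hε.memLp_two i) (hf.memLp_two (xs k)) (hε.memLp_two k)
  rw [covariance_comm (ε i) (fun ω => f ω (xs k)), hε.cov_eval hf, hε.cov_eq, zero_add] at h2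
  refine h1.trans ?_
  rw [cov_eval_noisy_eval hf hε]
  refine (congrArg _ h2).trans ?_
  simp [noisyGram, Matrix.one_apply, Fin.ext_iff]

theorem noisyGram_posDef (hη : 0 < η) (hf : IsCenteredGP P κ f) {j : ℕ} (xs : Fin j → Cube d) :
    (noisyGram κ η xs).PosDef := by
  have h1 : (Matrix.of fun i k => κ (xs i) (xs k)).PosSemidef := by
    refine Matrix.PosSemidef.of_dotProduct_mulVec_nonneg ?_ fun u => ?_
    · ext i k
      simp [hf.symm (xs k)]
    -- The quadratic form of the Gram matrix at `u` is this variance.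
    · have hv : 0 ≤ Var[fun ω => ∑ i, u i * f ω (xs i); P] := variance_nonneg _ _
      have hm : ∀ i, MemLp (fun ω => u i * f ω (xs i)) 2 P := fun i =>
        (hf.memLp_two (xs i)).const_mul _
      rw [← covariance_self (Finset.aemeasurable_fun_sum _ fun i _ => (hm i).aemeasurable),
        covariance_fun_sum_fun_sum hm hm] at hv
      simp_rw [covariance_const_mul_left, covariance_const_mul_right, hf.cov_eq] at hv
      simp only [star_trivial, dotProduct, Matrix.mulVec, Matrix.of_apply, Finset.mul_sum]
      refine hv.trans_eq ?_
      refine Finset.sum_congr rfl fun i _ => Finset.sum_congr rfl fun k _ => ?_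
      ring
  exact Matrix.PosDef.posSemidef_add h1 (Matrix.PosDef.one.smul (by positivity))

theorem noisyGram_det_pos (hη : 0 < η) (hf : IsCenteredGP P κ f) {j : ℕ} (xs : Fin j → Cube d) :
    0 < (noisyGram κ η xs).det :=
  (noisyGram_posDef hη hf xs).det_pos

theorem noisyGram_inv_isSymm (hη : 0 < η) (hf : IsCenteredGP P κ f) {j : ℕ} (xs : Fin j → Cube d) :
    ((noisyGram κ η xs)⁻¹)ᵀ = (noisyGram κ η xs)⁻¹ := by
  have := (noisyGram_posDef hη hf xs).inv.isHermitian.eq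
  rwa [Matrix.conjTranspose_eq_transpose_of_trivial] at this

theorem noisyGram_isSymm (hf : IsCenteredGP P κ f) {j : ℕ} (xs : Fin j → Cube d) (i k : Fin j) :
    noisyGram κ η xs i k = noisyGram κ η xs k i := by
  simp [noisyGram, hf.symm (xs i), Matrix.one_apply, eq_comm]

/-- The weights of the posterior mean at `p`. -/
noncomputable def posteriorWeight (κ : Cube d → Cube d → ℝ) (η : ℝ) {j : ℕ} (xs : Fin j → Cube d)
    (p : Cube d) : Fin j → ℝ :=
  (noisyGram κ η xs)⁻¹ *ᵥ fun i => κ p (xs i)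

theorem posteriorMean_eq_sum (hη : 0 < η) (hf : IsCenteredGP P κ f) {j : ℕ} (xs : Fin j → Cube d)
    (ys : Fin j → ℝ) (p : Cube d) :
    posteriorMean κ η xs ys p = ∑ i, posteriorWeight κ η xs p i * ys i := by
  rw [posteriorMean, Matrix.dotProduct_mulVec, ← Matrix.mulVec_transpose,
    noisyGram_inv_isSymm hη hf]
  rfl

theorem posteriorCov_eq_sum {j : ℕ} (xs : Fin j → Cube d) (p q : Cube d) :
    posteriorCov κ η xs p q = κ p q - ∑ i, posteriorWeight κ η xs q i * κ p (xs i) := by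
  simp_rw [mul_comm]
  rfl

theorem posteriorCov_comm (hη : 0 < η) (hf : IsCenteredGP P κ f) {j : ℕ} (xs : Fin j → Cube d)
    (p q : Cube d) : posteriorCov κ η xs p q = posteriorCov κ η xs q p := by
  rw [posteriorCov, posteriorCov, hf.symm p q, Matrix.dotProduct_mulVec, ← Matrix.mulVec_transpose,
    noisyGram_inv_isSymm hη hf, dotProduct_comm]

/-- These are the normal equations for regressing `f p` on the noisy observations; they make the
residual orthogonal to the data. -/
theorem sum_posteriorWeight_mul_noisyGram (hη : 0 < η) (hf : IsCenteredGP P κ f) {j : ℕ}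
    (xs : Fin j → Cube d) (p : Cube d) (l : Fin j) :
    ∑ i, posteriorWeight κ η xs p i * noisyGram κ η xs i l = κ p (xs l) := by
  have h : noisyGram κ η xs *ᵥ posteriorWeight κ η xs p = fun i => κ p (xs i) := by
    rw [posteriorWeight, Matrix.mulVec_mulVec, Matrix.mul_nonsing_inv _
      (noisyGram_det_pos hη hf xs).ne'.isUnit, Matrix.one_mulVec]
  have h2 := congrFun h l
  rw [← h2]
  refine Finset.sum_congr rfl fun i _ => ?_
  rw [noisyGram_isSymm hf, mul_comm]

/-- The error of the posterior mean at `p` for noisy observations at fixed points. -/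
noncomputable def posteriorResidual (κ : Cube d → Cube d → ℝ) (η : ℝ) (f : Ω → C(Cube d, ℝ))
    (ε : ℕ → Ω → ℝ) {j : ℕ} (xs : Fin j → Cube d) (p : Cube d) (ω : Ω) : ℝ :=
  f ω p - ∑ i, posteriorWeight κ η xs p i * (f ω (xs i) + ε i ω)

theorem memLp_two_weighted_obs (hf : IsCenteredGP P κ f) (hε : IsGaussianNoise P η f ε)
    {j : ℕ} (xs : Fin j → Cube d) (w : Fin j → ℝ) (i : Fin j) :
    MemLp (fun ω => w i * (f ω (xs i) + ε i ω)) 2 P :=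
  (memLp_two_noisy_eval hf hε (xs i) i).const_mul _

theorem memLp_two_posteriorResidual (hf : IsCenteredGP P κ f) (hε : IsGaussianNoise P η f ε)
    {j : ℕ} (xs : Fin j → Cube d) (p : Cube d) :
    MemLp (posteriorResidual κ η f ε xs p) 2 P :=
  (hf.memLp_two p).sub (memLp_finsetSum _ fun i _ => memLp_two_weighted_obs hf hε xs _ i)

theorem cov_posteriorResidual_noisy_eval (hη : 0 < η) (hf : IsCenteredGP P κ f)
    (hε : IsGaussianNoise P η f ε) {j : ℕ} (xs : Fin j → Cube d) (p : Cube d) (l : Fin j) :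
    cov[posteriorResidual κ η f ε xs p, fun ω => f ω (xs l) + ε l ω; P] = 0 := by
  have hw := memLp_two_weighted_obs hf hε xs (posteriorWeight κ η xs p)
  have := covariance_fun_sub_left (hf.memLp_two p) (memLp_finsetSum Finset.univ fun i _ => hw i)
    (memLp_two_noisy_eval hf hε (xs l) l)
  refine this.trans ?_
  rw [cov_eval_noisy_eval hf hε, covariance_fun_sum_left hw (memLp_two_noisy_eval hf hε (xs l) l)]
  simp_rw [covariance_const_mul_left, cov_noisy_eval hf hε]
  rw [sum_posteriorWeight_mul_noisyGram hη hf, sub_self]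

/-- Orthogonality to the observations removes the regression part of the second residual, so only
the covariance of the first residual with `f q` remains. -/
theorem cov_posteriorResidual (hη : 0 < η) (hf : IsCenteredGP P κ f)
    (hε : IsGaussianNoise P η f ε) {j : ℕ} (xs : Fin j → Cube d) (p q : Cube d) :
    cov[posteriorResidual κ η f ε xs p, posteriorResidual κ η f ε xs q; P] =
      posteriorCov κ η xs p q := by
  have hw := fun p => memLp_two_weighted_obs hf hε xs (posteriorWeight κ η xs p)
  have hr := memLp_two_posteriorResidual hf hε xs p
  have h1 := covariance_fun_sub_right hr (hf.memLp_two q)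
    (memLp_finsetSum Finset.univ fun i _ => hw q i)
  refine h1.trans ?_
  rw [covariance_fun_sum_right (hw q) hr]
  simp_rw [covariance_const_mul_right, cov_posteriorResidual_noisy_eval hη hf hε, mul_zero,
    Finset.sum_const_zero, sub_zero]
  have h2 := covariance_fun_sub_left (hf.memLp_two p)
    (memLp_finsetSum Finset.univ fun i _ => hw p i) (hf.memLp_two q)
  refine h2.trans ?_
  rw [hf.cov_eq, covariance_fun_sum_left (hw p) (hf.memLp_two q), posteriorCov_comm hη hf,
    posteriorCov_eq_sum, hf.symm p q]
  congr 1
  refine Finset.sum_congr rfl fun i _ => ?_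
  rw [covariance_const_mul_left, covariance_comm, cov_eval_noisy_eval hf hε]

theorem integral_posteriorResidual (hf : IsCenteredGP P κ f)
    (hε : IsGaussianNoise P η f ε) {j : ℕ} (xs : Fin j → Cube d) (p : Cube d) :
    ∫ ω, posteriorResidual κ η f ε xs p ω ∂P = 0 := by
  have hw := memLp_two_weighted_obs hf hε xs (posteriorWeight κ η xs p)
  unfold posteriorResidual
  rw [integral_sub ((hf.memLp_two p).integrable one_le_two)
    (integrable_finsetSum _ fun i _ => (hw i).integrable one_le_two),
    integral_finsetSum _ fun i _ => (hw i).integrable one_le_two, hf.mean_zero]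
  have : ∀ i : Fin j, ∫ ω, posteriorWeight κ η xs p i * (f ω (xs i) + ε i ω) ∂P = 0 := fun i => by
    rw [integral_const_mul, integral_add ((hf.memLp_two _).integrable one_le_two)
      ((hε.memLp_two i).integrable one_le_two), hf.mean_zero, hε.integral_eq_zero]
    simp
  simp [this]

/-- Joint normality is what upgrades zero covariance to independence. The pair is a linear image of
two independent Gaussian vectors: `f` at all points of `t` and `xs`, and the noise. -/
theorem hasGaussianLaw_residual_obs (hf : IsCenteredGP P κ f)
    (hε : IsGaussianNoise P η f ε) {j : ℕ} (xs : Fin j → Cube d) {m : ℕ} (t : Fin m → Cube d) :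
    HasGaussianLaw (fun ω => (fun k => posteriorResidual κ η f ε xs (t k) ω,
      fun i : Fin j => f ω (xs i) + ε i ω)) P := by
  have h1 := hf.hasGaussianLaw_vector (Sum.elim t xs)
  have h2 : HasGaussianLaw (fun ω (i : Fin j) => ε i ω) P :=
    iIndepFun.hasGaussianLaw (fun i : Fin j => hε.hasGaussianLaw i)
      (hε.indep.precomp (g := fun i : Fin j => (i : ℕ)) Fin.val_injective)
  have h3 : IndepFun (fun ω i => f ω (Sum.elim t xs i)) (fun ω (i : Fin j) => ε i ω) P :=
    hε.indepFun.comp (φ := fun (h : C(Cube d, ℝ)) i => h (Sum.elim t xs i))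
      (ψ := fun (e : ℕ → ℝ) (i : Fin j) => e i)
      (measurable_pi_iff.2 fun i => ContinuousMap.measurable_eval_const _)
      (measurable_pi_iff.2 fun i => measurable_pi_apply _)
  let L : ((Fin m ⊕ Fin j → ℝ) × (Fin j → ℝ)) →ₗ[ℝ] (Fin m → ℝ) × (Fin j → ℝ) :=
    { toFun := fun z => (fun k => z.1 (Sum.inl k) -
          ∑ i, posteriorWeight κ η xs (t k) i * (z.1 (Sum.inr i) + z.2 i),
        fun i => z.1 (Sum.inr i) + z.2 i)
      map_add' := fun z z' => by
        ext k
        · simp only [Prod.fst_add, Prod.snd_add, Pi.add_apply]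
          rw [sub_add_sub_comm, ← Finset.sum_add_distrib]
          congr 1
          exact Finset.sum_congr rfl fun i _ => by ring
        · simp only [Prod.fst_add, Prod.snd_add, Pi.add_apply]
          ring
      map_smul' := fun c z => by
        ext k
        · simp only [Prod.smul_fst, Prod.smul_snd, Pi.smul_apply, smul_eq_mul, RingHom.id_apply,
            mul_sub, Finset.mul_sum]
          congr 1
          exact Finset.sum_congr rfl fun i _ => by ring
        · simp only [Prod.smul_fst, Prod.smul_snd, Pi.smul_apply, smul_eq_mul, RingHom.id_apply]
          ring }
  exact (h3.hasGaussianLaw h1 h2).map (LinearMap.toContinuousLinearMap L)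

theorem indepFun_residual_obs (hη : 0 < η) (hf : IsCenteredGP P κ f)
    (hε : IsGaussianNoise P η f ε) {j : ℕ} (xs : Fin j → Cube d) {m : ℕ} (t : Fin m → Cube d) :
    IndepFun (fun ω k => posteriorResidual κ η f ε xs (t k) ω)
      (fun ω (i : Fin j) => f ω (xs i) + ε i ω) P :=
  HasGaussianLaw.indepFun_of_covariance_eval
    (X := fun k => posteriorResidual κ η f ε xs (t k))
    (Y := fun (i : Fin j) ω => f ω (xs i) + ε i ω) (hasGaussianLaw_residual_obs hf hε xs t)
    fun k l => cov_posteriorResidual_noisy_eval hη hf hε xs (t k) l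

theorem variance_sum_residual (hη : 0 < η) (hf : IsCenteredGP P κ f)
    (hε : IsGaussianNoise P η f ε) {j : ℕ} (xs : Fin j → Cube d) {m : ℕ} (t : Fin m → Cube d)
    (c : Fin m → ℝ) :
    Var[fun ω => ∑ k, c k * posteriorResidual κ η f ε xs (t k) ω; P] =
      ∑ k, ∑ l, c k * c l * posteriorCov κ η xs (t k) (t l) := by
  have hm : ∀ k, MemLp (fun ω => c k * posteriorResidual κ η f ε xs (t k) ω) 2 P := fun k =>
    (memLp_two_posteriorResidual hf hε xs (t k)).const_mul _
  rw [← covariance_self (Finset.aemeasurable_fun_sum _ fun i _ => (hm i).aemeasurable),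
    covariance_fun_sum_fun_sum hm hm]
  simp_rw [covariance_const_mul_left, covariance_const_mul_right,
    cov_posteriorResidual hη hf hε, mul_assoc]

theorem map_sum_residual (hη : 0 < η) (hf : IsCenteredGP P κ f)
    (hε : IsGaussianNoise P η f ε) {j : ℕ} (xs : Fin j → Cube d) {m : ℕ} (t : Fin m → Cube d)
    (c : Fin m → ℝ) :
    P.map (fun ω => ∑ k, c k * posteriorResidual κ η f ε xs (t k) ω) =
      gaussianReal 0 (Real.toNNReal
        (∑ k, ∑ l, c k * c l * posteriorCov κ η xs (t k) (t l))) := by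
  have h := (hasGaussianLaw_residual_obs hf hε xs t).fst
  let L : (Fin m → ℝ) →L[ℝ] ℝ := ∑ k, c k • ContinuousLinearMap.proj (R := ℝ) k
  have hL : (L ∘ fun ω k => posteriorResidual κ η f ε xs (t k) ω) =
      fun ω => ∑ k, c k * posteriorResidual κ η f ε xs (t k) ω := by
    ext ω
    simp [L]
  have h2 := (h.map L).map_eq_gaussianReal
  rw [hL, variance_sum_residual hη hf hε] at h2
  rw [h2]
  congr 1
  rw [integral_finsetSum _ fun k _ =>
    ((memLp_two_posteriorResidual hf hε xs (t k)).integrable one_le_two).const_mul _]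
  simp [integral_const_mul, integral_posteriorResidual hf hε]

end Covariance

/-! ### Bayes' formula for every value of the observations -/

theorem continuous_lintegral_of_le {α Y : Type*} [MeasurableSpace α] {Q : Measure α}
    [IsFiniteMeasure Q] [TopologicalSpace Y] [FirstCountableTopology Y] {G : Y → α → ℝ≥0∞}
    {C : ℝ≥0∞} (hC : C ≠ ∞) (hle : ∀ y a, G y a ≤ C) (hm : ∀ y, Measurable (G y))
    (hc : ∀ a, Continuous fun y => G y a) : Continuous fun y => ∫⁻ a, G y a ∂Q := by
  rw [continuous_iff_continuousAt]
  intro y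
  refine tendsto_lintegral_filter_of_dominated_convergence (fun _ => C)
    (Filter.Eventually.of_forall hm) (Filter.Eventually.of_forall fun y => ae_of_all _ (hle y)) ?_
    (ae_of_all _ fun a => (hc a).tendsto y)
  rw [lintegral_const]
  exact ENNReal.mul_ne_top hC (measure_ne_top _ _)

theorem IndepFun.lintegral_comp_prodMk {Ω α β : Type*} [MeasurableSpace Ω] [MeasurableSpace α]
    [MeasurableSpace β] {P : Measure Ω} [IsProbabilityMeasure P] {Y : Ω → α} {R : Ω → β}
    (hind : IndepFun Y R P) (hY : Measurable Y) (hR : Measurable R) {G : α × β → ℝ≥0∞}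
    (hG : Measurable G) :
    ∫⁻ ω, G (Y ω, R ω) ∂P = ∫⁻ ω, ∫⁻ r, G (Y ω, r) ∂(P.map R) ∂P := by
  have := Measure.isProbabilityMeasure_map (μ := P) hR.aemeasurable
  calc ∫⁻ ω, G (Y ω, R ω) ∂P = ∫⁻ z, G z ∂(P.map fun ω => (Y ω, R ω)) := by
        rw [lintegral_map hG (hY.prodMk hR)]
    _ = ∫⁻ y, ∫⁻ r, G (y, r) ∂(P.map R) ∂(P.map Y) := by
        rw [(indepFun_iff_map_prod_eq_prod_map_map hY.aemeasurable hR.aemeasurable).1 hind,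
          lintegral_prod _ hG.aemeasurable]
    _ = _ := by rw [lintegral_map hG.lintegral_prod_right' hY]

/-- Upgrade of an identity between two continuous families of measures from almost all parameters
to all parameters. -/
theorem map_withDensity_eq_smul_of_setLIntegral {Ω Y : Type*} [MeasurableSpace Ω] {P : Measure Ω}
    [IsProbabilityMeasure P] [TopologicalSpace Y] [FirstCountableTopology Y] [MeasureSpace Y]
    [OpensMeasurableSpace Y] [(volume : Measure Y).IsOpenPosMeasure] [SigmaFinite (volume : Measure Y)]
    {F : Ω → ℝ} (hF : Measurable F) {L : Y → Ω → ℝ} {C : ℝ} (hLC : ∀ y ω, L y ω ≤ C)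
    (hLm : ∀ y, Measurable (L y)) (hLc : ∀ ω, Continuous fun y => L y ω)
    {M : Y → ℝ} (hM : Continuous M) {N : Measure ℝ} [IsProbabilityMeasure N]
    (h : ∀ (ψ : ℝ → ℝ≥0∞) (T : Set Y), Measurable ψ → MeasurableSet T →
      ∫⁻ y in T, ∫⁻ ω, ψ (F ω) * ENNReal.ofReal (L y ω) ∂P =
        ∫⁻ y in T, ∫⁻ ω, (∫⁻ r, ψ (M y + r) ∂N) * ENNReal.ofReal (L y ω) ∂P) (y : Y) :
    (P.withDensity fun ω => ENNReal.ofReal (L y ω)).map F =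
      (∫⁻ ω, ENNReal.ofReal (L y ω) ∂P) • N.map (M y + ·) := by
  have hLm' : ∀ y, Measurable fun ω => ENNReal.ofReal (L y ω) := fun y => (hLm y).ennreal_ofReal
  have hLC' : ∀ y ω, ENNReal.ofReal (L y ω) ≤ ENNReal.ofReal C := fun y ω =>
    ENNReal.ofReal_le_ofReal (hLC y ω)
  have hZ : ∀ y, ∫⁻ ω, ENNReal.ofReal (L y ω) ∂P ≠ ∞ := fun y =>
    ne_top_of_le_ne_top (b := ∫⁻ _, ENNReal.ofReal C ∂P) (by simp)
      (lintegral_mono fun ω => hLC' _ _)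
  have hfin : IsFiniteMeasure (P.withDensity fun ω => ENNReal.ofReal (L y ω)) :=
    isFiniteMeasure_withDensity (hZ y)
  have hfin2 : IsFiniteMeasure ((∫⁻ ω, ENNReal.ofReal (L y ω) ∂P) • N.map (M y + ·)) :=
    ⟨by
      rw [Measure.smul_apply, smul_eq_mul]
      exact ENNReal.mul_lt_top (hZ y).lt_top (measure_lt_top _ _)⟩
  refine ext_of_forall_lintegral_eq_of_IsFiniteMeasure fun ψ => ?_
  have hψm : Measurable fun r => (ψ r : ℝ≥0∞) := ψ.continuous.measurable.coe_nnreal_ennreal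
  obtain ⟨B, hB⟩ : ∃ B : ℝ≥0, ∀ r, ψ r ≤ B := ⟨_, fun r => ψ.apply_le_nndist_zero r⟩
  rw [lintegral_map hψm hF, lintegral_withDensity_eq_lintegral_mul _ (hLm' y) (g := fun ω => (ψ (F ω) : ℝ≥0∞)) (hψm.comp hF),
    lintegral_smul_measure, lintegral_map hψm (measurable_const_add _), smul_eq_mul]
  simp only [Pi.mul_apply]
  have hCne : (B : ℝ≥0∞) * ENNReal.ofReal C ≠ ∞ :=
    ENNReal.mul_ne_top ENNReal.coe_ne_top ENNReal.ofReal_ne_top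
  have hcoe : ∀ (r l : ℝ), (ψ r : ℝ≥0∞) * ENNReal.ofReal l =
      ((ψ r * l.toNNReal : ℝ≥0) : ℝ≥0∞) := fun r l => by
    rw [ENNReal.coe_mul]; rfl
  -- For a bounded continuous test function `ψ`, both sides are continuous in `y` by dominated
  -- convergence. Equal integrals over all measurable sets give equality almost everywhere, hence
  -- everywhere, because `volume` charges nonempty open sets.
  have hc1 : Continuous fun y => ∫⁻ ω, ψ (F ω) * ENNReal.ofReal (L y ω) ∂P := by
    refine continuous_lintegral_of_le hCne (fun y ω => ?_) (fun y => ?_) fun ω => ?_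
    · exact mul_le_mul' (ENNReal.coe_le_coe.2 (hB _)) (hLC' _ _)
    · exact (hψm.comp hF).mul (hLm' y)
    · simp_rw [hcoe]
      exact ENNReal.continuous_coe.comp
        (continuous_const.mul (continuous_real_toNNReal.comp (hLc _)))
  have hc2 : Continuous fun y => ∫⁻ z : Ω × ℝ, ψ (M y + z.2) *
      ENNReal.ofReal (L y z.1) ∂(P.prod N) := by
    refine continuous_lintegral_of_le hCne (fun y ω => ?_) (fun y => ?_) fun ω => ?_
    · exact mul_le_mul' (ENNReal.coe_le_coe.2 (hB _)) (hLC' _ _)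
    · exact (hψm.comp (measurable_const.add measurable_snd)).mul ((hLm' y).comp measurable_fst)
    · simp_rw [hcoe]
      exact ENNReal.continuous_coe.comp ((ψ.continuous.comp (hM.add continuous_const)).mul
        (continuous_real_toNNReal.comp (hLc _)))
  have hprod : ∀ y, ∫⁻ z : Ω × ℝ, ψ (M y + z.2) * ENNReal.ofReal (L y z.1) ∂(P.prod N) =
      ∫⁻ ω, (∫⁻ r, ψ (M y + r) ∂N) * ENNReal.ofReal (L y ω) ∂P := by
    intro y
    have hm : Measurable fun z : Ω × ℝ => (ψ (M y + z.2) : ℝ≥0∞) * ENNReal.ofReal (L y z.1) :=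
      (hψm.comp (measurable_snd.const_add (M y))).mul ((hLm' y).comp measurable_fst)
    rw [lintegral_prod _ hm.aemeasurable]
    refine lintegral_congr fun ω => ?_
    have hm' : Measurable fun r : ℝ => (ψ (M y + r) : ℝ≥0∞) :=
      hψm.comp (measurable_id.const_add (M y))
    exact lintegral_mul_const (ENNReal.ofReal (L y ω)) hm'
  have hae : (fun y => ∫⁻ ω, ψ (F ω) * ENNReal.ofReal (L y ω) ∂P) =ᵐ[volume]
      fun y => ∫⁻ z : Ω × ℝ, ψ (M y + z.2) * ENNReal.ofReal (L y z.1) ∂(P.prod N) := by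
    refine ae_eq_of_forall_setLIntegral_eq_of_sigmaFinite hc1.measurable hc2.measurable
      fun T hT _ => ?_
    simp_rw [hprod]
    exact h _ T hψm hT
  have heq := congrFun ((hc1.ae_eq_iff_eq volume hc2).1 hae) y
  simp only [hprod] at heq
  rw [lintegral_const_mul _ (hLm' y)] at heq
  simp_rw [mul_comm (ENNReal.ofReal _)]
  rw [heq, mul_comm]

/-- Both sides equal `E[1_T(Z) ψ(F(X))]`: the left directly through the density `l`, the right after
splitting `F(X) = M(Z) + R` and integrating out the independent residual `R`. -/
theorem setLIntegral_eq_of_indepFun_residual {Ω E Y : Type*} [MeasurableSpace Ω]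
    [MeasurableSpace E] {P : Measure Ω} [IsProbabilityMeasure P] [MeasureSpace Y] {X : Ω → E}
    {Z : Ω → Y} {R : Ω → ℝ} (hZ : Measurable Z) (hR : Measurable R) (hind : IndepFun Z R P)
    {F : E → ℝ} (hF : Measurable F) {M : Y → ℝ} (hM : Measurable M)
    (hsplit : ∀ ω, F (X ω) = M (Z ω) + R ω) {l : E → Y → ℝ≥0∞}
    (hlaw : ∀ Φ : E × Y → ℝ≥0∞, Measurable Φ →
      ∫⁻ ω, Φ (X ω, Z ω) ∂P = ∫⁻ y, ∫⁻ ω, Φ (X ω, y) * l (X ω) y ∂P)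
    {ψ : ℝ → ℝ≥0∞} (hψ : Measurable ψ) {T : Set Y} (hT : MeasurableSet T) :
    ∫⁻ y in T, ∫⁻ ω, ψ (F (X ω)) * l (X ω) y ∂P =
      ∫⁻ y in T, ∫⁻ ω, (∫⁻ r, ψ (M y + r) ∂(P.map R)) * l (X ω) y ∂P := by
  have := Measure.isProbabilityMeasure_map (μ := P) hR.aemeasurable
  have hMr : Measurable fun z : Y × ℝ => ψ (M z.1 + z.2) :=
    hψ.comp ((hM.comp measurable_fst).add measurable_snd)
  have hg : Measurable fun y => ∫⁻ r, ψ (M y + r) ∂(P.map R) := hMr.lintegral_prod_right'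
  have hone : Measurable (T.indicator (fun _ => (1 : ℝ≥0∞))) := measurable_const.indicator hT
  have e1 := hlaw (fun z => T.indicator (fun _ => 1) z.2 * ψ (F z.1))
    ((hone.comp measurable_snd).mul (hψ.comp (hF.comp measurable_fst)))
  have e2 := hlaw (fun z => T.indicator (fun _ => 1) z.2 * ∫⁻ r, ψ (M z.2 + r) ∂(P.map R))
    ((hone.comp measurable_snd).mul (hg.comp measurable_snd))
  have e3 : ∫⁻ ω, T.indicator (fun _ => 1) (Z ω) * ψ (F (X ω)) ∂P =
      ∫⁻ ω, T.indicator (fun _ => 1) (Z ω) * ∫⁻ r, ψ (M (Z ω) + r) ∂(P.map R) ∂P := by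
    simp_rw [hsplit]
    rw [IndepFun.lintegral_comp_prodMk hind hZ hR
      (G := fun z => T.indicator (fun _ => 1) z.1 * ψ (M z.1 + z.2))
      ((hone.comp measurable_fst).mul hMr)]
    refine lintegral_congr fun ω => ?_
    have hm : Measurable fun r : ℝ => ψ (M (Z ω) + r) :=
      hψ.comp (measurable_id.const_add (M (Z ω)))
    exact lintegral_const_mul (T.indicator (fun _ => (1 : ℝ≥0∞)) (Z ω)) hm
  have hind2 : ∀ G : Y → Ω → ℝ≥0∞,
      ∫⁻ y, ∫⁻ ω, T.indicator (fun _ => 1) y * G y ω * l (X ω) y ∂P =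
      ∫⁻ y in T, ∫⁻ ω, G y ω * l (X ω) y ∂P := by
    intro G
    rw [← lintegral_indicator hT]
    refine lintegral_congr fun y => ?_
    by_cases hy : y ∈ T <;> simp [hy]
  rw [← hind2, ← hind2]
  exact e1.symm.trans (e3.trans e2)

section Bayes

variable {Ω : Type*} [MeasurableSpace Ω] {P : Measure Ω} [IsProbabilityMeasure P] {d : ℕ}
  {κ : Cube d → Cube d → ℝ} {η : ℝ} {f : Ω → C(Cube d, ℝ)} {ε : ℕ → Ω → ℝ}

theorem measurable_linear_eval {m : ℕ} (t : Fin m → Cube d) (c : Fin m → ℝ) :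
    Measurable fun h : C(Cube d, ℝ) => ∑ k, c k * h (t k) :=
  Finset.measurable_sum _ fun k _ => (ContinuousMap.measurable_eval_const (t k)).const_mul (c k)

theorem sum_mul_posteriorMean (hη : 0 < η) (hf : IsCenteredGP P κ f) {j : ℕ} (xs : Fin j → Cube d)
    {m : ℕ} (t : Fin m → Cube d) (c : Fin m → ℝ) (ω : Ω) :
    ∑ k, c k * f ω (t k) =
      ∑ k, c k * posteriorMean κ η xs (fun i => f ω (xs i) + ε i ω) (t k) +
        ∑ k, c k * posteriorResidual κ η f ε xs (t k) ω := by
  rw [← Finset.sum_add_distrib]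
  refine Finset.sum_congr rfl fun k _ => ?_
  rw [posteriorMean_eq_sum hη hf, posteriorResidual]
  ring

theorem continuous_posteriorMean_obs {j : ℕ} (xs : Fin j → Cube d) (p : Cube d) :
    Continuous fun ys : Fin j → ℝ => posteriorMean κ η xs ys p := by
  unfold posteriorMean dotProduct Matrix.mulVec dotProduct
  fun_prop

theorem setLIntegral_noisy_eval_eq (hη : 0 < η) (hf : IsCenteredGP P κ f)
    (hε : IsGaussianNoise P η f ε) {j : ℕ} (xs : Fin j → Cube d) {m : ℕ} (t : Fin m → Cube d)
    (c : Fin m → ℝ) {ψ : ℝ → ℝ≥0∞} (hψ : Measurable ψ) {T : Set (Fin j → ℝ)}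
    (hT : MeasurableSet T) :
    ∫⁻ y in T, ∫⁻ ω, ψ (∑ k, c k * f ω (t k)) *
        ENNReal.ofReal (noiseDensity η (fun i => f ω (xs i)) y) ∂P =
      ∫⁻ y in T, ∫⁻ ω, (∫⁻ r, ψ (∑ k, c k * posteriorMean κ η xs y (t k) + r)
        ∂gaussianReal 0 (Real.toNNReal (∑ k, ∑ l, c k * c l * posteriorCov κ η xs (t k) (t l)))) *
        ENNReal.ofReal (noiseDensity η (fun i => f ω (xs i)) y) ∂P := by
  rw [← map_sum_residual hη hf hε xs t c]
  have hF := measurable_linear_eval t c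
  have hYm : Measurable fun ω (i : Fin j) => f ω (xs i) + ε i ω := measurable_pi_iff.2 fun i =>
    (hf.measurable_eval (xs i)).add (hε.measurable i)
  have hrm : ∀ p, Measurable (posteriorResidual κ η f ε xs p) := fun p => by
    unfold posteriorResidual
    exact (hf.measurable_eval p).sub (Finset.measurable_sum _ fun i _ =>
      ((hf.measurable_eval (xs i)).add (hε.measurable i)).const_mul _)
  have hRm : Measurable fun ω => ∑ k, c k * posteriorResidual κ η f ε xs (t k) ω :=
    Finset.measurable_sum _ fun k _ => (hrm (t k)).const_mul _
  have hsplit := sum_mul_posteriorMean (ε := ε) hη hf xs t c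
  have hM : Measurable fun y => ∑ k, c k * posteriorMean κ η xs y (t k) :=
    Finset.measurable_sum _ fun k _ =>
      (continuous_posteriorMean_obs xs (t k)).measurable.const_mul (c k)
  have hind : IndepFun (fun ω (i : Fin j) => f ω (xs i) + ε i ω)
      (fun ω => ∑ k, c k * posteriorResidual κ η f ε xs (t k) ω) P := by
    refine ((indepFun_residual_obs hη hf hε xs t).comp
      (φ := fun u : Fin m → ℝ => ∑ k, c k * u k) (ψ := id) ?_ measurable_id).symm
    fun_prop
  exact setLIntegral_eq_of_indepFun_residual
    (l := fun h y => ENNReal.ofReal (noiseDensity η (fun i => h (xs i)) y))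
    hYm hRm hind hF hM hsplit (fun Φ hΦ => lintegral_noisy_eval hη hf hε xs hΦ) hψ hT

/-- Bayes' formula: for every value `y` of the noisy observations, reweighting the prior by the
likelihood gives the Gaussian posterior. -/
theorem map_withDensity_noiseDensity (hη : 0 < η) (hf : IsCenteredGP P κ f)
    (hε : IsGaussianNoise P η f ε) {j : ℕ} (xs : Fin j → Cube d) (y : Fin j → ℝ) {m : ℕ}
    (t : Fin m → Cube d) (c : Fin m → ℝ) :
    (P.withDensity fun ω => ENNReal.ofReal (noiseDensity η (fun i => f ω (xs i)) y)).map
        (fun ω => ∑ k, c k * f ω (t k)) =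
      (∫⁻ ω, ENNReal.ofReal (noiseDensity η (fun i => f ω (xs i)) y) ∂P) •
        gaussianReal (∑ k, c k * posteriorMean κ η xs y (t k))
          (Real.toNNReal (∑ k, ∑ l, c k * c l * posteriorCov κ η xs (t k) (t l))) := by
  have hgm : gaussianReal (∑ k, c k * posteriorMean κ η xs y (t k))
      (Real.toNNReal (∑ k, ∑ l, c k * c l * posteriorCov κ η xs (t k) (t l))) =
      (gaussianReal 0 (Real.toNNReal
        (∑ k, ∑ l, c k * c l * posteriorCov κ η xs (t k) (t l)))).map
        ((∑ k, c k * posteriorMean κ η xs y (t k)) + ·) := by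
    rw [gaussianReal_map_const_add, zero_add]
  rw [hgm]
  have hLm : ∀ y, Measurable fun ω => noiseDensity η (fun i => f ω (xs i)) y := fun y => by
    have h1 : Measurable fun ω => ((fun i => f ω (xs i)), y) :=
      (measurable_pi_iff.2 fun i => hf.measurable_eval (xs i)).prodMk measurable_const
    exact (measurable_noiseDensity (η := η)).comp h1
  have hLc : ∀ u : Fin j → ℝ, Continuous fun y => noiseDensity η u y := fun u =>
    continuous_noiseDensity.comp (Continuous.prodMk_right u)
  have hFm : Measurable fun ω => ∑ k, c k * f ω (t k) :=
    (measurable_linear_eval t c).comp hf.measurable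
  have hMc : Continuous fun y => ∑ k, c k * posteriorMean κ η xs y (t k) :=
    continuous_finsetSum _ fun k _ => (continuous_posteriorMean_obs xs (t k)).const_mul (c k)
  exact map_withDensity_eq_smul_of_setLIntegral
    (L := fun y ω => noiseDensity η (fun i => f ω (xs i)) y)
    (M := fun y => ∑ k, c k * posteriorMean κ η xs y (t k))
    hFm (fun y ω => noiseDensity_le (fun i => f ω (xs i)) y) hLm (fun ω => hLc _) hMc
    (fun ψ T hψ hT => setLIntegral_noisy_eval_eq hη hf hε xs t c hψ hT) y

end Bayes

/-- Data: query points together with observations. -/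
abbrev Data (d j : ℕ) : Type := Fin j → Cube d × ℝ

/-! ### The posterior as a Markov kernel on continuous functions -/

section PosteriorKernel

variable {d j : ℕ} {η : ℝ}

/-- The likelihood of the data `D` given the function `h`. -/
noncomputable def likelihood (η : ℝ) (h : C(Cube d, ℝ)) (D : Data d j) : ℝ≥0∞ :=
  ENNReal.ofReal (noiseDensity η (fun i => h (D i).1) fun i => (D i).2)

theorem measurable_likelihood :
    Measurable fun z : Data d j × C(Cube d, ℝ) => likelihood η z.2 z.1 := by
  have h1 : Measurable fun z : Data d j × C(Cube d, ℝ) => fun i => z.2 (z.1 i).1 :=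
    measurable_pi_iff.2 fun i => ContinuousMap.measurable_uncurry_eval.comp
      (measurable_snd.prodMk (((measurable_pi_apply i).comp measurable_fst).fst))
  have h2 : Measurable fun z : Data d j × C(Cube d, ℝ) => fun i => (z.1 i).2 :=
    measurable_pi_iff.2 fun i => ((measurable_pi_apply i).comp measurable_fst).snd
  exact ((measurable_noiseDensity (η := η)).comp (h1.prodMk h2)).ennreal_ofReal

theorem measurable_likelihood_left (D : Data d j) :
    Measurable fun h : C(Cube d, ℝ) => likelihood η h D :=
  measurable_likelihood.comp (measurable_const.prodMk measurable_id)

theorem likelihood_pos (hη : 0 < η) (h : C(Cube d, ℝ)) (D : Data d j) : 0 < likelihood η h D :=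
  ENNReal.ofReal_pos.2 (noiseDensity_pos hη _ _)

/-- The total mass of the likelihood under the prior `ν`. -/
noncomputable def evidence (η : ℝ) (ν : Measure C(Cube d, ℝ)) (D : Data d j) : ℝ≥0∞ :=
  ∫⁻ h, likelihood η h D ∂ν

variable {ν : Measure C(Cube d, ℝ)} [IsProbabilityMeasure ν]

theorem measurable_evidence : Measurable fun D : Data d j => evidence η ν D :=
  measurable_likelihood.lintegral_prod_right'

theorem evidence_ne_top (D : Data d j) : evidence η ν D ≠ ∞ := by
  refine ne_top_of_le_ne_top (b := ∫⁻ _, ENNReal.ofReal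
    ((√(2 * Real.pi * Real.toNNReal (η ^ 2)))⁻¹ ^ j) ∂ν) (by simp) (lintegral_mono fun h => ?_)
  exact ENNReal.ofReal_le_ofReal (noiseDensity_le _ _)

theorem evidence_ne_zero (hη : 0 < η) (D : Data d j) : evidence η ν D ≠ 0 := by
  rw [evidence, Ne, lintegral_eq_zero_iff (measurable_likelihood_left D)]
  intro h
  have h2 : ∀ᵐ _ ∂ν, False := by
    filter_upwards [h] with u hu using (likelihood_pos hη u D).ne' hu
  simp only [Filter.eventually_false_iff_eq_bot, ae_eq_bot] at h2
  exact IsProbabilityMeasure.ne_zero ν h2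

/-- The posterior distribution given the data, by Bayes' formula. -/
noncomputable def posteriorKernel (η : ℝ) (ν : Measure C(Cube d, ℝ)) [SFinite ν] (j : ℕ) :
    Kernel (Data d j) C(Cube d, ℝ) :=
  Kernel.withDensity (Kernel.const _ ν) fun D h => (evidence η ν D)⁻¹ * likelihood η h D

theorem measurable_posteriorDensity :
    Measurable (Function.uncurry fun (D : Data d j) (h : C(Cube d, ℝ)) =>
      (evidence η ν D)⁻¹ * likelihood η h D) :=
  (measurable_evidence.inv.comp measurable_fst).mul measurable_likelihood

theorem posteriorKernel_apply (D : Data d j) : posteriorKernel η ν j D =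
    (evidence η ν D)⁻¹ • ν.withDensity fun h => likelihood η h D := by
  rw [posteriorKernel, Kernel.withDensity_apply _ measurable_posteriorDensity, Kernel.const_apply]
  exact withDensity_smul _ (measurable_likelihood_left D)

theorem lintegral_posteriorKernel (D : Data d j) {Φ : C(Cube d, ℝ) → ℝ≥0∞} (hΦ : Measurable Φ) :
    ∫⁻ h, Φ h ∂(posteriorKernel η ν j D) =
      (evidence η ν D)⁻¹ * ∫⁻ h, Φ h * likelihood η h D ∂ν := by
  rw [posteriorKernel_apply, lintegral_smul_measure, smul_eq_mul,
    lintegral_withDensity_eq_lintegral_mul _ (measurable_likelihood_left D) hΦ]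
  simp_rw [Pi.mul_apply, mul_comm]

theorem isMarkovKernel_posteriorKernel (hη : 0 < η) : IsMarkovKernel (posteriorKernel η ν j) := by
  refine ⟨fun D => ⟨?_⟩⟩
  have := lintegral_posteriorKernel (η := η) (ν := ν) D (Φ := fun _ => 1) measurable_const
  rw [lintegral_one] at this
  rw [this]
  simp_rw [one_mul]
  exact ENNReal.inv_mul_cancel (evidence_ne_zero hη D) (evidence_ne_top D)

end PosteriorKernel

/-! ### Gaussian marginals of the posterior kernel -/

section Marginals

variable {Ω : Type*} [MeasurableSpace Ω] {P : Measure Ω} [IsProbabilityMeasure P] {d : ℕ}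
  {κ : Cube d → Cube d → ℝ} {η : ℝ} {f : Ω → C(Cube d, ℝ)} {ε : ℕ → Ω → ℝ}

/-- The posterior mean as a function of the data. -/
noncomputable def dataMean (κ : Cube d → Cube d → ℝ) (η : ℝ) {j : ℕ} (D : Data d j) (p : Cube d) :
    ℝ :=
  posteriorMean κ η (fun i => (D i).1) (fun i => (D i).2) p

/-- The posterior covariance as a function of the data. -/
noncomputable def dataCov (κ : Cube d → Cube d → ℝ) (η : ℝ) {j : ℕ} (D : Data d j) (p q : Cube d) :
    ℝ :=
  posteriorCov κ η (fun i => (D i).1) p q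

/-- The bridge between the kernel defined by Bayes' formula and the explicit posterior mean and
covariance. It holds for every `D`, so it may be evaluated at random, adaptively collected data. -/
theorem map_posteriorKernel (hη : 0 < η) (hf : IsCenteredGP P κ f) (hε : IsGaussianNoise P η f ε)
    {j : ℕ} (D : Data d j) {m : ℕ} (t : Fin m → Cube d) (c : Fin m → ℝ) :
    (posteriorKernel η (P.map f) j D).map (fun h => ∑ k, c k * h (t k)) =
      gaussianReal (∑ k, c k * dataMean κ η D (t k))
        (Real.toNNReal (∑ k, ∑ l, c k * c l * dataCov κ η D (t k) (t l))) := by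
  have hP := Measure.isProbabilityMeasure_map (μ := P) hf.measurable.aemeasurable
  have key := map_withDensity_noiseDensity hη hf hε (fun i => (D i).1) (fun i => (D i).2) t c
  have hl := measurable_linear_eval t c
  have hl' : Measurable fun ω => ∑ k, c k * f ω (t k) := hl.comp hf.measurable
  have h1 : ((P.map f).withDensity fun h => likelihood η h D).map (fun h => ∑ k, c k * h (t k)) =
      (P.withDensity fun ω => likelihood η (f ω) D).map (fun ω => ∑ k, c k * f ω (t k)) := by
    ext B hB
    rw [Measure.map_apply hl hB, Measure.map_apply hl' hB,
      withDensity_apply _ (hl hB), withDensity_apply _ (hl' hB),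
      setLIntegral_map (hl hB) (measurable_likelihood_left D) hf.measurable]
    rfl
  have h2 : evidence η (P.map f) D = ∫⁻ ω, likelihood η (f ω) D ∂P :=
    lintegral_map (measurable_likelihood_left D) hf.measurable
  rw [posteriorKernel_apply, Measure.map_smul, h1]
  refine (congrArg _ key).trans ?_
  change (evidence η (P.map f) D)⁻¹ • (∫⁻ ω, likelihood η (f ω) D ∂P) • _ = _
  rw [← h2, smul_smul, ENNReal.inv_mul_cancel (evidence_ne_zero hη D) (evidence_ne_top D), one_smul]
  rfl

theorem map_posteriorKernel_eval (hη : 0 < η) (hf : IsCenteredGP P κ f)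
    (hε : IsGaussianNoise P η f ε) {j : ℕ} (D : Data d j) (p : Cube d) :
    (posteriorKernel η (P.map f) j D).map (fun h => h p) =
      gaussianReal (dataMean κ η D p) (Real.toNNReal (dataCov κ η D p p)) := by
  have := map_posteriorKernel hη hf hε D (m := 1) (fun _ => p) (fun _ => 1)
  simpa using this

theorem posteriorCov_self_nonneg (hη : 0 < η) (hf : IsCenteredGP P κ f)
    (hε : IsGaussianNoise P η f ε) {j : ℕ} (xs : Fin j → Cube d) (p : Cube d) :
    0 ≤ posteriorCov κ η xs p p := by
  rw [← cov_posteriorResidual hη hf hε,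
    covariance_self (memLp_two_posteriorResidual hf hε xs p).aemeasurable]
  exact variance_nonneg _ _

/-- Conditioning subtracts a quadratic form of the positive definite inverse Gram matrix. -/
theorem posteriorCov_self_le (hη : 0 < η) (hf : IsCenteredGP P κ f) {j : ℕ}
    (xs : Fin j → Cube d) (p : Cube d) : posteriorCov κ η xs p p ≤ κ p p := by
  have := (noisyGram_posDef hη hf xs).inv.posSemidef.dotProduct_mulVec_nonneg
    (fun i => κ p (xs i))
  simp only [star_trivial] at this
  rw [posteriorCov]
  linarith

end Marginals

/-- Interchange of the integrals in one step of a sequential sampling scheme. -/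
theorem lintegral_sampling_step {E X H : Type*} [MeasurableSpace E] [MeasurableSpace X]
    [MeasurableSpace H] {ν : Measure E} {ρ : Measure H} [SFinite ν] [SFinite ρ] {ξ : H → X}
    (hξ : Measurable ξ) {ev : E → X → ℝ} (hev : Measurable (Function.uncurry ev)) {l : E → ℝ≥0∞}
    (hl : Measurable l) {pdf : ℝ → ℝ≥0∞} (hpdf : Measurable pdf) {N N' : Measure (ℕ → ℝ)}
    [SFinite N] [SFinite N']
    (hN : ∀ Ψ : ℝ × (ℕ → ℝ) → ℝ≥0∞, Measurable Ψ →
      ∫⁻ e, Ψ (e 0, fun k => e (k + 1)) ∂N = ∫⁻ s, ∫⁻ e, Ψ (s, e) * pdf s ∂N')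
    {Φ : E × X × ℝ × (ℕ → ℝ) → ℝ≥0∞} (hΦ : Measurable Φ) :
    ∫⁻ h, ∫⁻ e, (∫⁻ h', Φ (h, ξ h', ev h (ξ h') + e 0, fun k => e (k + 1)) ∂ρ) * l h ∂N ∂ν =
      ∫⁻ h', ∫⁻ y, ∫⁻ h, ∫⁻ e, Φ (h, ξ h', y, e) * (l h * pdf (y - ev h (ξ h'))) ∂N' ∂ν ∂volume ∂ρ := by
  have hshift : Measurable fun e : ℕ → ℝ => fun k => e (k + 1) :=
    measurable_pi_iff.2 fun k => measurable_pi_apply _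
  have hev' : Measurable fun z : E × H => ev z.1 (ξ z.2) :=
    hev.comp (measurable_fst.prodMk (hξ.comp measurable_snd))
  have m1 : Measurable fun z : E × H × (ℕ → ℝ) =>
      Φ (z.1, ξ z.2.1, ev z.1 (ξ z.2.1) + z.2.2 0, fun k => z.2.2 (k + 1)) := by
    refine hΦ.comp (measurable_fst.prodMk ((hξ.comp measurable_snd.fst).prodMk
      (Measurable.prodMk ?_ (hshift.comp measurable_snd.snd))))
    exact (hev'.comp (measurable_fst.prodMk measurable_snd.fst)).add
      ((measurable_pi_apply 0).comp measurable_snd.snd)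
  have m2 : Measurable fun z : E × H × (ℕ → ℝ) =>
      Φ (z.1, ξ z.2.1, ev z.1 (ξ z.2.1) + z.2.2 0, fun k => z.2.2 (k + 1)) * l z.1 :=
    m1.mul (hl.comp measurable_fst)
  have s1 : ∀ h, ∫⁻ e, (∫⁻ h', Φ (h, ξ h', ev h (ξ h') + e 0, fun k => e (k + 1)) ∂ρ) * l h ∂N =
      ∫⁻ h', ∫⁻ e, Φ (h, ξ h', ev h (ξ h') + e 0, fun k => e (k + 1)) * l h ∂N ∂ρ := by
    intro h
    have m3 : Measurable fun z : (ℕ → ℝ) × H =>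
        Φ (h, ξ z.2, ev h (ξ z.2) + z.1 0, fun k => z.1 (k + 1)) :=
      m1.comp (measurable_const.prodMk (measurable_snd.prodMk measurable_fst))
    have m4 : Measurable fun z : (ℕ → ℝ) × H =>
        Φ (h, ξ z.2, ev h (ξ z.2) + z.1 0, fun k => z.1 (k + 1)) * l h := m3.mul_const _
    rw [← lintegral_lintegral_swap (by exact m4.aemeasurable)]
    refine lintegral_congr fun e => ?_
    have m5 : Measurable fun h' =>
        Φ (h, ξ h', ev h (ξ h') + e 0, fun k => e (k + 1)) :=
      m3.comp (measurable_const.prodMk measurable_id)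
    exact (lintegral_mul_const (l h) m5).symm
  simp_rw [s1]
  have m6 : Measurable fun z : E × H =>
      ∫⁻ e, Φ (z.1, ξ z.2, ev z.1 (ξ z.2) + e 0, fun k => e (k + 1)) * l z.1 ∂N := by
    have : Measurable fun w : (E × H) × (ℕ → ℝ) =>
        Φ (w.1.1, ξ w.1.2, ev w.1.1 (ξ w.1.2) + w.2 0, fun k => w.2 (k + 1)) * l w.1.1 :=
      m2.comp (measurable_fst.fst.prodMk (measurable_fst.snd.prodMk measurable_snd))
    exact this.lintegral_prod_right'
  rw [lintegral_lintegral_swap (by exact m6.aemeasurable)]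
  refine lintegral_congr fun h' => ?_
  have m7 : Measurable fun w : (E × ℝ) × (ℕ → ℝ) =>
      Φ (w.1.1, ξ h', w.1.2, w.2) * (l w.1.1 * pdf (w.1.2 - ev w.1.1 (ξ h'))) := by
    have a1 : Measurable fun w : (E × ℝ) × (ℕ → ℝ) => Φ (w.1.1, ξ h', w.1.2, w.2) :=
      hΦ.comp (measurable_fst.fst.prodMk
        (measurable_const.prodMk (measurable_fst.snd.prodMk measurable_snd)))
    have a2 : Measurable fun w : (E × ℝ) × (ℕ → ℝ) => ev w.1.1 (ξ h') :=
      hev.comp (measurable_fst.fst.prodMk measurable_const)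
    exact a1.mul ((hl.comp measurable_fst.fst).mul (hpdf.comp (measurable_fst.snd.sub a2)))
  rw [lintegral_lintegral_swap (f := fun y h => ∫⁻ e, Φ (h, ξ h', y, e) *
    (l h * pdf (y - ev h (ξ h'))) ∂N')
    (by exact (m7.lintegral_prod_right'.comp measurable_swap).aemeasurable)]
  refine lintegral_congr fun h => ?_
  have m8 : Measurable fun z : ℝ × (ℕ → ℝ) => Φ (h, ξ h', ev h (ξ h') + z.1, z.2) * l h := by
    have : Measurable fun z : ℝ × (ℕ → ℝ) => Φ (h, ξ h', ev h (ξ h') + z.1, z.2) :=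
      hΦ.comp (measurable_const.prodMk (measurable_const.prodMk
        ((measurable_fst.const_add _).prodMk measurable_snd)))
    exact this.mul_const _
  refine (hN _ m8).trans ?_
  -- Substitute `y = ev h (ξ h') + s`: the fresh noise density becomes the likelihood factor of the
  -- new observation.
  rw [← lintegral_sub_right_eq_self _ (ev h (ξ h'))]
  refine lintegral_congr fun y => lintegral_congr fun e => ?_
  simp only [add_sub_cancel]
  rw [mul_assoc]

/-! ### Measurability and conditional law of the posterior samples -/

section ThompsonSampling

variable {Ω : Type*} [mΩ : MeasurableSpace Ω] {P : Measure Ω} [IsProbabilityMeasure P] {d : ℕ}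
  {κ : Cube d → Cube d → ℝ} {η : ℝ} {f : Ω → C(Cube d, ℝ)} {ε : ℕ → Ω → ℝ}
  {g : ℕ → Ω → C(Cube d, ℝ)} {x : ℕ → Ω → Cube d}

/-- The data available at step `j`. -/
def dataAt (f : Ω → C(Cube d, ℝ)) (ε : ℕ → Ω → ℝ) (x : ℕ → Ω → Cube d) (j : ℕ) (ω : Ω) :
    Data d j :=
  fun i => (x i ω, observation f ε x i ω)

theorem measurable_apply_random {m : MeasurableSpace Ω} {F : Ω → C(Cube d, ℝ)} {p : Ω → Cube d}
    (hF : Measurable[m] F) (hp : Measurable[m] p) : Measurable[m] fun ω => F ω (p ω) :=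
  ContinuousMap.measurable_uncurry_eval.comp (hF.prodMk hp)

theorem pathSigma_le {m : MeasurableSpace Ω} {F : Ω → C(Cube d, ℝ)}
    (hF : ∀ p, Measurable[m] fun ω => F ω p) : pathSigma F ≤ m :=
  iSup_le fun p => (hF p).comap_le

theorem dataSigma_le {m : MeasurableSpace Ω} {y : ℕ → Ω → ℝ} {j : ℕ}
    (hx : ∀ i < j, Measurable[m] (x i)) (hy : ∀ i < j, Measurable[m] (y i)) :
    dataSigma x y j ≤ m :=
  iSup_le fun i => sup_le (hx i i.2).comap_le (hy i i.2).comap_le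

theorem measurable_observation_of {m : MeasurableSpace Ω} (hf : Measurable[m] f) {i : ℕ}
    (hε : Measurable[m] (ε i)) (hx : Measurable[m] (x i)) : Measurable[m] (observation f ε x i) :=
  (measurable_apply_random hf hx).add hε

theorem measurable_dataAt_of {m : MeasurableSpace Ω} {j : ℕ} (hf : Measurable[m] f)
    (hε : ∀ i, Measurable[m] (ε i)) (hx : ∀ i < j, Measurable[m] (x i)) :
    Measurable[m] (dataAt f ε x j) :=
  measurable_pi_iff.2 fun i => (hx i i.2).prodMk (measurable_observation_of hf (hε i) (hx i i.2))

theorem measurable_query (hf : IsCenteredGP P κ f) (hε : IsGaussianNoise P η f ε)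
    (hTS : IsSeqThompsonSampling P κ η f ε g x) (j : ℕ) : Measurable (x j) := by
  induction j using Nat.strong_induction_on with
  | _ j ih =>
    refine (hTS.query_measurable j).mono (sup_le (dataSigma_le ih fun i hi => ?_)
      (pathSigma_le (hTS.sample_measurable j))) le_rfl
    exact measurable_observation_of hf.measurable (hε.measurable i) (ih i hi)

theorem measurable_sample (hTS : IsSeqThompsonSampling P κ η f ε g x) (j : ℕ) :
    Measurable (g j) :=
  ContinuousMap.measurable_of_eval (hTS.sample_measurable j)

theorem measurable_dataAt (hf : IsCenteredGP P κ f) (hε : IsGaussianNoise P η f ε)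
    (hTS : IsSeqThompsonSampling P κ η f ε g x) (j : ℕ) : Measurable (dataAt f ε x j) :=
  measurable_dataAt_of hf.measurable hε.measurable fun i _ => measurable_query hf hε hTS i

theorem worldSigma_le (hf : IsCenteredGP P κ f) (hε : IsGaussianNoise P η f ε)
    (hTS : IsSeqThompsonSampling P κ η f ε g x) (j : ℕ) : worldSigma f ε g x j ≤ mΩ :=
  sup_le (sup_le (pathSigma_le hf.measurable_eval) (iSup_le fun k => (hε.measurable k).comap_le))
    (iSup_le fun i => sup_le (pathSigma_le (hTS.sample_measurable i))
      (measurable_query hf hε hTS i).comap_le)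

theorem measurable_worldSigma_prior (f : Ω → C(Cube d, ℝ)) (ε : ℕ → Ω → ℝ)
    (g : ℕ → Ω → C(Cube d, ℝ)) (x : ℕ → Ω → Cube d) (j : ℕ) :
    Measurable[worldSigma f ε g x j] f := by
  refine @ContinuousMap.measurable_of_eval _ _ _ _ _ _ (worldSigma f ε g x j) _ fun p => ?_
  refine Measurable.mono (comap_measurable _) ?_ le_rfl
  exact (le_iSup (fun p : Cube d => MeasurableSpace.comap (fun ω => f ω p) inferInstance) p).trans
    (le_sup_left.trans le_sup_left)

theorem measurable_worldSigma_noise (f : Ω → C(Cube d, ℝ)) (ε : ℕ → Ω → ℝ)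
    (g : ℕ → Ω → C(Cube d, ℝ)) (x : ℕ → Ω → Cube d) (j k : ℕ) :
    Measurable[worldSigma f ε g x j] (ε k) := by
  refine Measurable.mono (comap_measurable _) ?_ le_rfl
  exact (le_iSup (fun k : ℕ => MeasurableSpace.comap (ε k) inferInstance) k).trans
    (le_sup_right.trans le_sup_left)

theorem measurable_worldSigma_query (f : Ω → C(Cube d, ℝ)) (ε : ℕ → Ω → ℝ)
    (g : ℕ → Ω → C(Cube d, ℝ)) (x : ℕ → Ω → Cube d) {i j : ℕ} (hi : i < j) :
    Measurable[worldSigma f ε g x j] (x i) := by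
  refine Measurable.mono (comap_measurable _) ?_ le_rfl
  exact le_sup_right.trans ((le_iSup (fun i : Fin j =>
    pathSigma (g i) ⊔ MeasurableSpace.comap (x i) inferInstance) ⟨i, hi⟩).trans le_sup_right)

theorem measurable_worldSigma_dataAt (f : Ω → C(Cube d, ℝ)) (ε : ℕ → Ω → ℝ)
    (g : ℕ → Ω → C(Cube d, ℝ)) (x : ℕ → Ω → Cube d) (j : ℕ) :
    Measurable[worldSigma f ε g x j] (dataAt f ε x j) :=
  measurable_dataAt_of (measurable_worldSigma_prior f ε g x j)
    (measurable_worldSigma_noise f ε g x j) fun _ hi => measurable_worldSigma_query f ε g x hi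

/-- The query point is a measurable function of the data and the posterior sample. -/
theorem exists_query_eq (hTS : IsSeqThompsonSampling P κ η f ε g x) (j : ℕ) :
    ∃ ξ : Data d j × C(Cube d, ℝ) → Cube d, Measurable ξ ∧
      ∀ ω, x j ω = ξ (dataAt f ε x j ω, g j ω) := by
  have hle : dataSigma x (observation f ε x) j ⊔ pathSigma (g j) ≤
      MeasurableSpace.comap (fun ω => (dataAt f ε x j ω, g j ω)) inferInstance := by
    have hD : Measurable[MeasurableSpace.comap (fun ω => (dataAt f ε x j ω, g j ω)) inferInstance]
        fun ω => (dataAt f ε x j ω, g j ω) := comap_measurable _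
    have hD1 (i : Fin j) : Measurable[MeasurableSpace.comap
        (fun ω => (dataAt f ε x j ω, g j ω)) inferInstance] fun ω => dataAt f ε x j ω i :=
      (measurable_pi_apply i).comp (measurable_fst.comp hD)
    have hg : Measurable[MeasurableSpace.comap
        (fun ω => (dataAt f ε x j ω, g j ω)) inferInstance] (g j) := measurable_snd.comp hD
    exact sup_le (dataSigma_le (fun i hi => measurable_fst.comp (hD1 ⟨i, hi⟩)) fun i hi =>
        measurable_snd.comp (hD1 ⟨i, hi⟩))
      (pathSigma_le fun p => (ContinuousMap.measurable_eval_const p).comp hg)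
  obtain ⟨ξ, hξ, h⟩ := ((hTS.query_measurable j).mono hle le_rfl).exists_eq_measurable_comp
  exact ⟨ξ, hξ, fun ω => congrFun h ω⟩

/-- `sample_law` prescribes only linear combinations of values; these determine a finite measure on
`C(Cube d, ℝ)`. Restricting to arbitrary past events `S` expresses conditioning on the past. -/
theorem restrict_map_sample (hη : 0 < η) (hf : IsCenteredGP P κ f) (hε : IsGaussianNoise P η f ε)
    (hTS : IsSeqThompsonSampling P κ η f ε g x) (j : ℕ) {S : Set Ω}
    (hS : MeasurableSet[worldSigma f ε g x j] S) :
    (P.restrict S).map (g j) =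
      (P.restrict S).bind fun ω => posteriorKernel η (P.map f) j (dataAt f ε x j ω) := by
  have hP := Measure.isProbabilityMeasure_map (μ := P) hf.measurable.aemeasurable
  have := isMarkovKernel_posteriorKernel (ν := P.map f) (j := j) hη
  have hg := measurable_sample hTS j
  have hD := measurable_dataAt hf hε hTS j
  have hK : Measurable fun ω => posteriorKernel η (P.map f) j (dataAt f ε x j ω) :=
    (Kernel.measurable _).comp hD
  have hfin : IsFiniteMeasure ((P.restrict S).bind fun ω =>
      posteriorKernel η (P.map f) j (dataAt f ε x j ω)) := by
    refine ⟨?_⟩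
    rw [Measure.bind_apply MeasurableSet.univ hK.aemeasurable]
    simp
  refine ContinuousMap.measure_ext_of_map_sum fun m t c => ?_
  have hl := measurable_linear_eval t c
  ext B hB
  rw [Measure.map_apply hl hB, Measure.map_apply hg (hl hB), Measure.map_apply hl hB,
    Measure.bind_apply (hl hB) hK.aemeasurable, Measure.restrict_apply (hg (hl hB)), inter_comm]
  refine (hTS.sample_law j m t c S B hS hB).trans ?_
  refine lintegral_congr fun ω => ?_
  rw [← Measure.map_apply hl hB, map_posteriorKernel hη hf hε]
  rfl

/-- Conditionally on everything that happened before, the sample `g j` has the posterior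
distribution. -/
theorem lintegral_sample (hη : 0 < η) (hf : IsCenteredGP P κ f) (hε : IsGaussianNoise P η f ε)
    (hTS : IsSeqThompsonSampling P κ η f ε g x) (j : ℕ) {𝓦 : Type*} [MeasurableSpace 𝓦]
    {W : Ω → 𝓦} (hW : Measurable[worldSigma f ε g x j] W) {Φ : 𝓦 × C(Cube d, ℝ) → ℝ≥0∞}
    (hΦ : Measurable Φ) :
    ∫⁻ ω, Φ (W ω, g j ω) ∂P =
      ∫⁻ ω, ∫⁻ h, Φ (W ω, h) ∂(posteriorKernel η (P.map f) j (dataAt f ε x j ω)) ∂P := by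
  have hP := Measure.isProbabilityMeasure_map (μ := P) hf.measurable.aemeasurable
  have := isMarkovKernel_posteriorKernel (ν := P.map f) (j := j) hη
  have hg := measurable_sample hTS j
  have hD := measurable_dataAt hf hε hTS j
  have hW' : Measurable W := hW.mono (worldSigma_le hf hε hTS j) le_rfl
  have hK : Measurable fun ω => posteriorKernel η (P.map f) j (dataAt f ε x j ω) :=
    (Kernel.measurable _).comp hD
  set K : Kernel Ω C(Cube d, ℝ) := (posteriorKernel η (P.map f) j).comap _ hD
  have hWs : Measurable fun z : Ω × C(Cube d, ℝ) => (W z.1, z.2) :=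
    (hW'.comp measurable_fst).prodMk measurable_snd
  have := Measure.isProbabilityMeasure_map (μ := P) (hW'.prodMk hg).aemeasurable
  have key : P.map (fun ω => (W ω, g j ω)) = (P ⊗ₘ K).map fun z => (W z.1, z.2) := by
    refine Measure.ext_prod fun {A} {G} hA hG => ?_
    rw [Measure.map_apply (hW'.prodMk hg) (hA.prod hG), Measure.map_apply hWs (hA.prod hG)]
    have e1 : (fun z : Ω × C(Cube d, ℝ) => (W z.1, z.2)) ⁻¹' A ×ˢ G = (W ⁻¹' A) ×ˢ G := rfl
    have e2 : (fun ω => (W ω, g j ω)) ⁻¹' A ×ˢ G = (g j) ⁻¹' G ∩ W ⁻¹' A := inter_comm _ _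
    rw [e1, e2, Measure.compProd_apply_prod (hW' hA) hG, ← Measure.restrict_apply (hg hG),
      ← Measure.map_apply hg hG, restrict_map_sample hη hf hε hTS j (hW hA),
      Measure.bind_apply hG hK.aemeasurable]
    rfl
  have hΦW : Measurable fun z : Ω × C(Cube d, ℝ) => Φ (W z.1, z.2) := hΦ.comp hWs
  rw [← lintegral_map hΦ (hW'.prodMk hg), key, lintegral_map hΦ hWs,
    Measure.lintegral_compProd hΦW]
  rfl

theorem measurable_snoc {α : Type*} [MeasurableSpace α] {j : ℕ} :
    Measurable fun z : (Fin j → α) × α => (Fin.snoc z.1 z.2 : Fin (j + 1) → α) := by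
  refine measurable_pi_iff.2 fun i => ?_
  refine Fin.lastCases ?_ (fun i => ?_) i
  · simpa using measurable_snd
  · simp only [Fin.snoc_castSucc]
    exact (measurable_pi_apply i).comp measurable_fst

theorem likelihood_snoc {j : ℕ} (h : C(Cube d, ℝ)) (D : Data d j) (p : Cube d) (y : ℝ) :
    likelihood η h (Fin.snoc D (p, y) : Data d (j + 1)) =
      likelihood η h D * gaussianPDF 0 (Real.toNNReal (η ^ 2)) (y - h p) := by
  simp only [likelihood, ofReal_noiseDensity]
  rw [Fin.prod_univ_castSucc]
  simp

/-- The current noise variable is independent of the later ones, so it can be split off with its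
Gaussian density; this is the input on the noise for one sampling step. -/
theorem lintegral_noise_succ (hη : 0 < η) (hε : IsGaussianNoise P η f ε) (j : ℕ)
    (Ψ : ℝ × (ℕ → ℝ) → ℝ≥0∞) (hΨ : Measurable Ψ) :
    ∫⁻ e, Ψ (e 0, fun k => e (k + 1)) ∂(P.map fun ω k => ε (j + k) ω) =
      ∫⁻ s, ∫⁻ e, Ψ (s, e) * gaussianPDF 0 (Real.toNNReal (η ^ 2)) s
        ∂(P.map fun ω k => ε (j + 1 + k) ω) := by
  have hm : ∀ i, Measurable fun ω k => ε (i + k) ω := fun i =>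
    measurable_pi_iff.2 fun k => hε.measurable _
  have hs : Measurable fun e : ℕ → ℝ => (e 0, fun k => e (k + 1)) :=
    (measurable_pi_apply 0).prodMk (measurable_pi_iff.2 fun k => measurable_pi_apply _)
  have hind : IndepFun (ε j) (fun ω k => ε (j + 1 + k) ω) P := by
    have h := indep_iSup_of_disjoint (fun i => (hε.measurable i).comap_le)
      (hε.indep.iIndep) (S := {j}) (T := Ioi j) (by simp)
    rw [IndepFun_iff_Indep]
    refine indep_of_indep_of_le_left (indep_of_indep_of_le_right h ?_) ?_
    · simp only [MeasurableSpace.pi, MeasurableSpace.comap_iSup, MeasurableSpace.comap_comp]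
      refine iSup_le fun k => ?_
      exact le_iSup₂_of_le (j + 1 + k) (by simp only [mem_Ioi]; omega) le_rfl
    · exact le_iSup₂_of_le j rfl le_rfl
  have := Measure.isProbabilityMeasure_map (μ := P) (hm (j + 1)).aemeasurable
  have hG : Measurable fun e : ℕ → ℝ => Ψ (e 0, fun k => e (k + 1)) := hΨ.comp hs
  rw [lintegral_map hG (hm j)]
  have e1 : ∀ ω, Ψ ((fun k => ε (j + k) ω) 0, fun k => (fun k => ε (j + k) ω) (k + 1)) =
      Ψ (ε j ω, fun k => ε (j + 1 + k) ω) := fun ω => by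
    congr 2
    funext k
    change ε (j + (k + 1)) ω = _
    rw [show j + (k + 1) = j + 1 + k by ring]
  refine (lintegral_congr e1).trans ?_
  rw [IndepFun.lintegral_comp_prodMk hind (hε.measurable j) (hm (j + 1)) hΨ,
    ← lintegral_map (f := fun s => ∫⁻ e, Ψ (s, e) ∂(P.map fun ω k => ε (j + 1 + k) ω))
      hΨ.lintegral_prod_right' (hε.measurable j), hε.law,
    gaussianReal_of_var_ne_zero _ (toNNReal_sq_ne_zero hη),
    lintegral_withDensity_eq_lintegral_mul _ (measurable_gaussianPDF _ _)
      hΨ.lintegral_prod_right']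
  refine lintegral_congr fun s => ?_
  rw [Pi.mul_apply, mul_comm]
  have hs' : Measurable fun e => Ψ (s, e) := hΨ.comp (measurable_const.prodMk measurable_id)
  exact (lintegral_mul_const _ hs').symm

end ThompsonSampling

/-! ### Posterior law of the unknown function under adaptive queries -/

section Filtering

variable {Ω : Type*} [mΩ : MeasurableSpace Ω] {P : Measure Ω} [IsProbabilityMeasure P] {d : ℕ}
  {κ : Cube d → Cube d → ℝ} {η : ℝ} {f : Ω → C(Cube d, ℝ)} {ε : ℕ → Ω → ℝ}
  {g : ℕ → Ω → C(Cube d, ℝ)} {x : ℕ → Ω → Cube d}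

/-- The joint law of the unknown function, the data and the future noise has a density given by
the likelihood, with respect to a product with first factor the prior. -/
theorem exists_data_measure (hη : 0 < η) (hf : IsCenteredGP P κ f) (hε : IsGaussianNoise P η f ε)
    (hTS : IsSeqThompsonSampling P κ η f ε g x) (j : ℕ) :
    ∃ τ : Measure (Data d j), SFinite τ ∧ ∀ Φ : C(Cube d, ℝ) × Data d j × (ℕ → ℝ) → ℝ≥0∞,
      Measurable Φ → ∫⁻ ω, Φ (f ω, dataAt f ε x j ω, fun k => ε (j + k) ω) ∂P =
        ∫⁻ D, ∫⁻ h, ∫⁻ e, Φ (h, D, e) * likelihood η h D ∂(P.map fun ω k => ε (j + k) ω)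
          ∂(P.map f) ∂τ := by
  have hP := Measure.isProbabilityMeasure_map (μ := P) hf.measurable.aemeasurable
  have hm : ∀ i, Measurable fun ω k => ε (i + k) ω := fun i =>
    measurable_pi_iff.2 fun k => hε.measurable _
  induction j with
  | zero =>
    -- With no data the likelihood is `1`, and the claim is the independence of `f` and the noise.
    -- Carrying the future noise through the induction is what later makes `ε j` independent of both
    -- `f` and `D_j`.
    refine ⟨Measure.dirac default, inferInstance, fun Φ hΦ => ?_⟩
    have hE : IsProbabilityMeasure (P.map fun ω k => ε (0 + k) ω) :=
      Measure.isProbabilityMeasure_map (hm 0).aemeasurable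
    have hl : ∀ (h : C(Cube d, ℝ)) (D : Data d 0), likelihood η h D = 1 := fun h D => by
      simp [likelihood, ofReal_noiseDensity]
    have hΦ0 : Measurable fun z : C(Cube d, ℝ) × (ℕ → ℝ) => Φ (z.1, default, z.2) :=
      hΦ.comp (measurable_fst.prodMk (measurable_const.prodMk measurable_snd))
    have hind : IndepFun f (fun ω k => ε (0 + k) ω) P := by
      simpa using hε.indepFun
    simp_rw [hl, mul_one]
    have hD : ∀ ω, dataAt f ε x 0 ω = default := fun ω => Subsingleton.elim _ _
    simp_rw [hD]
    rw [lintegral_dirac]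
    rw [lintegral_map hΦ0.lintegral_prod_right' hf.measurable]
    exact IndepFun.lintegral_comp_prodMk hind hf.measurable (hm 0) hΦ0
  | succ j ih =>
    obtain ⟨τ, hR, ih⟩ := ih
    obtain ⟨ξ, hξ, hx⟩ := exists_query_eq hTS j
    have hK := isMarkovKernel_posteriorKernel (ν := P.map f) (j := j) hη
    set ρ := posteriorKernel η (P.map f) j
    have hE : ∀ i, IsProbabilityMeasure (P.map fun ω k => ε (i + k) ω) := fun i =>
      Measure.isProbabilityMeasure_map (hm i).aemeasurable
    have hsn : Measurable fun z : (Data d j × C(Cube d, ℝ)) × ℝ =>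
        (Fin.snoc z.1.1 (ξ z.1, z.2) : Data d (j + 1)) :=
      measurable_snoc.comp (measurable_fst.fst.prodMk
        ((hξ.comp measurable_fst).prodMk measurable_snd))
    -- The new reference measure draws a posterior sample given the old data, appends the query it
    -- determines, and lets the new observation range over Lebesgue measure. The unknown function
    -- does not enter, so all dependence on it stays in the likelihood.
    refine ⟨((τ ⊗ₘ ρ).prod volume).map fun z => Fin.snoc z.1.1 (ξ z.1, z.2), inferInstance,
      fun Φ hΦ => ?_⟩
    have hshift : Measurable fun e : ℕ → ℝ => fun k => e (k + 1) :=
      measurable_pi_iff.2 fun k => measurable_pi_apply _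
    have hΨ : Measurable fun z : (C(Cube d, ℝ) × Data d j × (ℕ → ℝ)) × C(Cube d, ℝ) =>
        Φ (z.1.1, (Fin.snoc z.1.2.1 (ξ (z.1.2.1, z.2), z.1.1 (ξ (z.1.2.1, z.2)) + z.1.2.2 0) :
          Data d (j + 1)), fun k => z.1.2.2 (k + 1)) := by
      have a1 : Measurable fun z : (C(Cube d, ℝ) × Data d j × (ℕ → ℝ)) × C(Cube d, ℝ) =>
          ξ (z.1.2.1, z.2) := hξ.comp (measurable_fst.snd.fst.prodMk measurable_snd)
      have a2 := ContinuousMap.measurable_uncurry_eval.comp (measurable_fst.fst.prodMk a1)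
      refine hΦ.comp (measurable_fst.fst.prodMk ((measurable_snoc.comp
        (measurable_fst.snd.fst.prodMk (a1.prodMk (a2.add ?_)))).prodMk
          (hshift.comp measurable_fst.snd.snd)))
      exact (measurable_pi_apply 0).comp measurable_fst.snd.snd
    have hW : Measurable[worldSigma f ε g x j]
        fun ω => (f ω, dataAt f ε x j ω, fun k => ε (j + k) ω) := by
      refine (measurable_worldSigma_prior f ε g x j).prodMk
        ((measurable_worldSigma_dataAt f ε g x j).prodMk ?_)
      exact @measurable_pi_lambda _ _ _ (worldSigma f ε g x j) _ _
        fun k => measurable_worldSigma_noise f ε g x j _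
    -- Replace `g j` by an independent draw from the posterior given the data; only then does the
    -- induction hypothesis apply.
    have step1 := lintegral_sample hη hf hε hTS j hW hΨ
    have hsnoc : ∀ ω, dataAt f ε x (j + 1) ω =
        Fin.snoc (dataAt f ε x j ω) (x j ω, f ω (x j ω) + ε j ω) := fun ω => by
      funext i
      refine Fin.lastCases ?_ (fun i => ?_) i <;> simp [dataAt, observation]
    have e1 : ∀ ω, Φ (f ω, dataAt f ε x (j + 1) ω, fun k => ε (j + 1 + k) ω) =
        Φ (f ω, (Fin.snoc (dataAt f ε x j ω) (ξ (dataAt f ε x j ω, g j ω),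
          f ω (ξ (dataAt f ε x j ω, g j ω)) + ε (j + 0) ω) : Data d (j + 1)),
          fun k => ε (j + (k + 1)) ω) := fun ω => by
      rw [hsnoc, hx]
      congr 3
      funext k
      rw [show j + (k + 1) = j + 1 + k by ring]
    rw [lintegral_congr e1]
    refine step1.trans ?_
    have hΦ' : Measurable fun w : C(Cube d, ℝ) × Data d j × (ℕ → ℝ) =>
        ∫⁻ h', Φ (w.1, (Fin.snoc w.2.1 (ξ (w.2.1, h'), w.1 (ξ (w.2.1, h')) + w.2.2 0) :
          Data d (j + 1)), fun k => w.2.2 (k + 1)) ∂(ρ w.2.1) :=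
      hΨ.lintegral_kernel_prod_right' (κ := ρ.comap (fun w : C(Cube d, ℝ) × Data d j × (ℕ → ℝ) =>
        w.2.1) measurable_snd.fst)
    refine (ih _ hΦ').trans ?_
    have hG : Measurable fun D' : Data d (j + 1) => ∫⁻ h, ∫⁻ e, Φ (h, D', e) * likelihood η h D'
        ∂(P.map fun ω k => ε (j + 1 + k) ω) ∂(P.map f) := by
      have b1 : Measurable fun w : (Data d (j + 1) × C(Cube d, ℝ)) × (ℕ → ℝ) =>
          Φ (w.1.2, w.1.1, w.2) * likelihood η w.1.2 w.1.1 :=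
        (hΦ.comp (measurable_fst.snd.prodMk (measurable_fst.fst.prodMk measurable_snd))).mul
          (measurable_likelihood.comp measurable_fst)
      exact b1.lintegral_prod_right'.lintegral_prod_right'
    have hGs : Measurable fun z : (Data d j × C(Cube d, ℝ)) × ℝ => ∫⁻ h, ∫⁻ e,
        Φ (h, (Fin.snoc z.1.1 (ξ z.1, z.2) : Data d (j + 1)), e) *
          likelihood η h (Fin.snoc z.1.1 (ξ z.1, z.2) : Data d (j + 1))
        ∂(P.map fun ω k => ε (j + 1 + k) ω) ∂(P.map f) := hG.comp hsn
    rw [lintegral_map hG hsn, lintegral_prod _ hGs.aemeasurable,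
      Measure.lintegral_compProd hGs.lintegral_prod_right']
    refine lintegral_congr fun D => ?_
    have hΦD : Measurable fun z : C(Cube d, ℝ) × Cube d × ℝ × (ℕ → ℝ) =>
        Φ (z.1, (Fin.snoc D (z.2.1, z.2.2.1) : Data d (j + 1)), z.2.2.2) :=
      hΦ.comp (measurable_fst.prodMk ((measurable_snoc.comp (measurable_const.prodMk
        (measurable_snd.fst.prodMk measurable_snd.snd.fst))).prodMk measurable_snd.snd.snd))
    have step2 := lintegral_sampling_step (ν := P.map f) (ρ := ρ D) (ξ := fun h' => ξ (D, h'))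
      (hξ.comp (measurable_const.prodMk measurable_id)) (ev := fun h p => h p)
      ContinuousMap.measurable_uncurry_eval (measurable_likelihood_left (η := η) D)
      (measurable_gaussianPDF 0 (Real.toNNReal (η ^ 2)))
      (lintegral_noise_succ hη hε j) hΦD
    refine step2.trans ?_
    simp_rw [likelihood_snoc]

/-- The conditional law of the unknown function given the data is the posterior. -/
theorem lintegral_prior_data (hη : 0 < η) (hf : IsCenteredGP P κ f) (hε : IsGaussianNoise P η f ε)
    (hTS : IsSeqThompsonSampling P κ η f ε g x) (j : ℕ) {Φ : C(Cube d, ℝ) × Data d j → ℝ≥0∞}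
    (hΦ : Measurable Φ) :
    ∫⁻ ω, Φ (f ω, dataAt f ε x j ω) ∂P =
      ∫⁻ ω, ∫⁻ h, Φ (h, dataAt f ε x j ω) ∂(posteriorKernel η (P.map f) j (dataAt f ε x j ω))
        ∂P := by
  have hP := Measure.isProbabilityMeasure_map (μ := P) hf.measurable.aemeasurable
  have hK := isMarkovKernel_posteriorKernel (ν := P.map f) (j := j) hη
  have hE : IsProbabilityMeasure (P.map fun ω k => ε (j + k) ω) :=
    Measure.isProbabilityMeasure_map (measurable_pi_iff.2 fun k => hε.measurable _).aemeasurable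
  obtain ⟨τ, -, hτ⟩ := exists_data_measure hη hf hε hTS j
  have hΦs : Measurable fun z : Data d j × C(Cube d, ℝ) => Φ (z.2, z.1) :=
    hΦ.comp measurable_swap
  have hI : Measurable fun D => ∫⁻ h, Φ (h, D) ∂(posteriorKernel η (P.map f) j D) :=
    hΦs.lintegral_kernel_prod_right'
  -- Both sides are written as integrals over `τ`. For each `D` they agree because the evidence
  -- cancels the normalisation of the posterior.
  have h1 := hτ (fun w => Φ (w.1, w.2.1)) (hΦ.comp (measurable_fst.prodMk measurable_snd.fst))
  have h2 := hτ (fun w => ∫⁻ h, Φ (h, w.2.1) ∂(posteriorKernel η (P.map f) j w.2.1))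
    (hI.comp measurable_snd.fst)
  refine h1.trans (Eq.trans (lintegral_congr fun D => ?_) h2.symm)
  simp only [lintegral_const, measure_univ, mul_one]
  have hD : Measurable fun h : C(Cube d, ℝ) => Φ (h, D) :=
    hΦ.comp (measurable_id.prodMk measurable_const)
  refine Eq.trans ?_ (lintegral_const_mul (∫⁻ h, Φ (h, D) ∂(posteriorKernel η (P.map f) j D))
    (measurable_likelihood_left D)).symm
  rw [lintegral_posteriorKernel D hD, mul_comm, ← evidence, ← mul_assoc,
    ENNReal.mul_inv_cancel (evidence_ne_zero hη D) (evidence_ne_top D), one_mul]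

/-- The posterior sample has, jointly with the data, the same law as the unknown function. -/
theorem lintegral_sample_data (hη : 0 < η) (hf : IsCenteredGP P κ f)
    (hε : IsGaussianNoise P η f ε) (hTS : IsSeqThompsonSampling P κ η f ε g x) (j : ℕ)
    {Φ : C(Cube d, ℝ) × Data d j → ℝ≥0∞} (hΦ : Measurable Φ) :
    ∫⁻ ω, Φ (g j ω, dataAt f ε x j ω) ∂P = ∫⁻ ω, Φ (f ω, dataAt f ε x j ω) ∂P := by
  rw [lintegral_prior_data hη hf hε hTS j hΦ]
  exact lintegral_sample hη hf hε hTS j (measurable_worldSigma_dataAt f ε g x j)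
    (hΦ.comp measurable_swap)

/-- Every posterior sample has the law of the unknown function. -/
theorem map_sample (hη : 0 < η) (hf : IsCenteredGP P κ f)
    (hε : IsGaussianNoise P η f ε) (hTS : IsSeqThompsonSampling P κ η f ε g x) (j : ℕ) :
    P.map (g j) = P.map f := by
  refine Measure.ext_of_lintegral _ fun φ hφ => ?_
  rw [lintegral_map hφ (measurable_sample hTS j), lintegral_map hφ hf.measurable]
  exact lintegral_sample_data hη hf hε hTS j (Φ := fun z => φ z.1) (hφ.comp measurable_fst)

/-- Conditionally on the data, the unknown function and the posterior sample are independent, both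
distributed according to the posterior. -/
theorem lintegral_prior_sample_data (hη : 0 < η) (hf : IsCenteredGP P κ f)
    (hε : IsGaussianNoise P η f ε) (hTS : IsSeqThompsonSampling P κ η f ε g x) (j : ℕ)
    {Φ : C(Cube d, ℝ) × Data d j × C(Cube d, ℝ) → ℝ≥0∞} (hΦ : Measurable Φ) :
    ∫⁻ ω, Φ (f ω, dataAt f ε x j ω, g j ω) ∂P =
      ∫⁻ ω, ∫⁻ h', ∫⁻ h, Φ (h, dataAt f ε x j ω, h')
        ∂(posteriorKernel η (P.map f) j (dataAt f ε x j ω))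
        ∂(posteriorKernel η (P.map f) j (dataAt f ε x j ω)) ∂P := by
  have hP := Measure.isProbabilityMeasure_map (μ := P) hf.measurable.aemeasurable
  have hK := isMarkovKernel_posteriorKernel (ν := P.map f) (j := j) hη
  have hΨ : Measurable fun z : (C(Cube d, ℝ) × Data d j) × C(Cube d, ℝ) =>
      Φ (z.1.1, z.1.2, z.2) :=
    hΦ.comp (measurable_fst.fst.prodMk (measurable_fst.snd.prodMk measurable_snd))
  have hW : Measurable[worldSigma f ε g x j] fun ω => (f ω, dataAt f ε x j ω) :=
    (measurable_worldSigma_prior f ε g x j).prodMk (measurable_worldSigma_dataAt f ε g x j)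
  refine (lintegral_sample hη hf hε hTS j hW hΨ).trans ?_
  have hI : Measurable fun w : C(Cube d, ℝ) × Data d j =>
      ∫⁻ h', Φ (w.1, w.2, h') ∂(posteriorKernel η (P.map f) j w.2) :=
    hΨ.lintegral_kernel_prod_right'
      (κ := (posteriorKernel η (P.map f) j).comap (fun w : C(Cube d, ℝ) × Data d j => w.2)
        measurable_snd)
  refine (lintegral_prior_data hη hf hε hTS j hI).trans (lintegral_congr fun ω => ?_)
  have hs : Measurable fun z : C(Cube d, ℝ) × C(Cube d, ℝ) => Φ (z.1, dataAt f ε x j ω, z.2) :=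
    hΦ.comp (measurable_fst.prodMk (measurable_const.prodMk measurable_snd))
  exact lintegral_lintegral_swap (μ := posteriorKernel η (P.map f) j (dataAt f ε x j ω))
    (ν := posteriorKernel η (P.map f) j (dataAt f ε x j ω))
    (f := fun h h' => Φ (h, dataAt f ε x j ω, h')) hs.aemeasurable

end Filtering

/-! ### Continuity of the covariance and of the posterior moments -/

section Continuity

variable {Ω : Type*} [MeasurableSpace Ω] {P : Measure Ω} [IsProbabilityMeasure P] {d : ℕ}
  {κ : Cube d → Cube d → ℝ} {η : ℝ} {f : Ω → C(Cube d, ℝ)} {ε : ℕ → Ω → ℝ}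

theorem integral_cos_of_hasGaussianLaw {X : Ω → ℝ} (hX : HasGaussianLaw X P)
    (h0 : ∫ ω, X ω ∂P = 0) : ∫ ω, Real.cos (X ω) ∂P = Real.exp (-Var[X; P] / 2) := by
  have hc : charFun (P.map X) 1 = Complex.exp (-Var[X; P] / 2 : ℝ) := by
    rw [hX.map_eq_gaussianReal, charFun_gaussianReal, h0,
      Real.coe_toNNReal _ (variance_nonneg _ _)]
    congr 1
    push_cast
    ring
  rw [charFun_apply_real, integral_map hX.aemeasurable
    (by fun_prop : Measurable fun u : ℝ => Complex.exp ((1 : ℝ) * u * Complex.I)).aestronglyMeasurable]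
    at hc
  have hi : Integrable (fun ω => Complex.exp ((1 : ℝ) * X ω * Complex.I)) P := by
    refine Integrable.mono' (integrable_const 1) ?_ (Filter.Eventually.of_forall fun ω => ?_)
    · have h2 : Measurable fun u : ℝ => Complex.exp ((1 : ℝ) * u * Complex.I) := by fun_prop
      exact (h2.comp_aemeasurable hX.aemeasurable).aestronglyMeasurable
    · rw [Complex.ofReal_one, one_mul, Complex.norm_exp_ofReal_mul_I]
  have h3 := congrArg Complex.re hc
  rw [← Complex.ofReal_exp, Complex.ofReal_re] at h3
  rw [← h3]
  refine Eq.trans ?_ (integral_re hi)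
  refine integral_congr_ae (Filter.Eventually.of_forall fun ω => ?_)
  simp [Complex.exp_ofReal_mul_I_re]

theorem IsCenteredGP.variance_add (hf : IsCenteredGP P κ f) (p q : Cube d) :
    Var[fun ω => f ω p + f ω q; P] = κ p p + 2 * κ p q + κ q q := by
  have := ProbabilityTheory.variance_add (hf.memLp_two p) (hf.memLp_two q)
  rw [← covariance_self (hf.memLp_two p).aemeasurable,
    ← covariance_self (hf.memLp_two q).aemeasurable, hf.cov_eq, hf.cov_eq, hf.cov_eq] at this
  exact this

/-- Continuity of the paths suffices: `E cos(f p + f q) = exp(-Var(f p + f q) / 2)` is continuous by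
bounded convergence, with no moment of `sup |f|` needed. Taking logarithms gives the variance, and
polarisation the covariance. -/
theorem IsCenteredGP.continuous_cov (hf : IsCenteredGP P κ f) :
    Continuous fun z : Cube d × Cube d => κ z.1 z.2 := by
  have h1 : ∀ z : Cube d × Cube d, ∫ ω, Real.cos (f ω z.1 + f ω z.2) ∂P =
      Real.exp (-(κ z.1 z.1 + 2 * κ z.1 z.2 + κ z.2 z.2) / 2) := fun z => by
    rw [← hf.variance_add]
    refine integral_cos_of_hasGaussianLaw ((hf.hasGaussianLaw_vector ![z.1, z.2]).prodMk 0 1).fun_add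
      ?_
    have := integral_add ((hf.memLp_two z.1).integrable one_le_two)
      ((hf.memLp_two z.2).integrable one_le_two)
    rw [hf.mean_zero, hf.mean_zero, add_zero] at this
    exact this
  have h2 : Continuous fun z : Cube d × Cube d => ∫ ω, Real.cos (f ω z.1 + f ω z.2) ∂P := by
    refine continuous_of_dominated (bound := fun _ => 1) (fun z => ?_) (fun z => ?_)
      (integrable_const 1) (Filter.Eventually.of_forall fun ω => by fun_prop)
    · exact (Real.measurable_cos.comp
        ((hf.measurable_eval z.1).add (hf.measurable_eval z.2))).aestronglyMeasurable
    · exact Filter.Eventually.of_forall fun ω => Real.abs_cos_le_one _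
  have h3 : Continuous fun z : Cube d × Cube d => κ z.1 z.1 + 2 * κ z.1 z.2 + κ z.2 z.2 := by
    have h4 : Continuous fun z : Cube d × Cube d =>
        -2 * Real.log (∫ ω, Real.cos (f ω z.1 + f ω z.2) ∂P) := by
      refine continuous_const.mul (h2.log fun z => ?_)
      rw [h1]
      exact (Real.exp_pos _).ne'
    refine h4.congr fun z => ?_
    rw [h1, Real.log_exp]
    ring
  -- On the diagonal the variance of the sum is `4 κ p p`.
  have h5 : Continuous fun p : Cube d => κ p p := by
    have := h3.comp (continuous_id.prodMk continuous_id : Continuous fun p : Cube d => (p, p))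
    refine (this.div_const 4).congr fun p => ?_
    simp only [Function.comp_apply, id]
    ring
  have h6 : Continuous fun z : Cube d × Cube d =>
      ((κ z.1 z.1 + 2 * κ z.1 z.2 + κ z.2 z.2) - κ z.1 z.1 - κ z.2 z.2) / 2 :=
    ((h3.sub (h5.comp continuous_fst)).sub (h5.comp continuous_snd)).div_const 2
  refine h6.congr fun z => ?_
  ring

theorem IsCenteredGP.continuous_cov_comp (hf : IsCenteredGP P κ f) {α : Type*} [TopologicalSpace α]
    {u v : α → Cube d} (hu : Continuous u) (hv : Continuous v) :
    Continuous fun z => κ (u z) (v z) :=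
  hf.continuous_cov.comp (hu.prodMk hv)

theorem continuous_noisyGram (hf : IsCenteredGP P κ f) {j : ℕ} :
    Continuous fun xs : Fin j → Cube d => noisyGram κ η xs := by
  refine continuous_matrix fun i k => ?_
  simp only [noisyGram, Matrix.add_apply, Matrix.of_apply]
  exact (hf.continuous_cov_comp (continuous_apply i) (continuous_apply k)).add continuous_const

theorem continuous_noisyGram_inv (hη : 0 < η) (hf : IsCenteredGP P κ f) {j : ℕ} :
    Continuous fun xs : Fin j → Cube d => (noisyGram κ η xs)⁻¹ := by
  have h := continuous_noisyGram (η := η) hf (j := j)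
  simp only [Matrix.inv_def, Ring.inverse_eq_inv']
  exact (h.matrix_det.inv₀ fun xs => (noisyGram_det_pos hη hf xs).ne').smul h.matrix_adjugate

theorem continuous_dataMean (hη : 0 < η) (hf : IsCenteredGP P κ f) {j : ℕ} :
    Continuous fun z : Data d j × Cube d => dataMean κ η z.1 z.2 := by
  have hx : Continuous fun z : Data d j × Cube d => fun i => (z.1 i).1 :=
    continuous_pi fun i => ((continuous_apply i).comp continuous_fst).fst
  have hy : Continuous fun z : Data d j × Cube d => fun i => (z.1 i).2 :=
    continuous_pi fun i => ((continuous_apply i).comp continuous_fst).snd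
  refine Continuous.dotProduct (continuous_pi fun i => ?_)
    (((continuous_noisyGram_inv hη hf).comp hx).matrix_mulVec hy)
  exact hf.continuous_cov_comp continuous_snd ((continuous_apply i).comp hx)

theorem continuous_dataCov_self (hη : 0 < η) (hf : IsCenteredGP P κ f) {j : ℕ} :
    Continuous fun z : Data d j × Cube d => dataCov κ η z.1 z.2 z.2 := by
  have hx : Continuous fun z : Data d j × Cube d => fun i => (z.1 i).1 :=
    continuous_pi fun i => ((continuous_apply i).comp continuous_fst).fst
  have hk : Continuous fun z : Data d j × Cube d => fun i => κ z.2 (z.1 i).1 :=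
    continuous_pi fun i => hf.continuous_cov_comp continuous_snd ((continuous_apply i).comp hx)
  refine (hf.continuous_cov_comp continuous_snd continuous_snd).sub ?_
  exact Continuous.dotProduct hk (((continuous_noisyGram_inv hη hf).comp hx).matrix_mulVec hk)

end Continuity

/-! ### Determinants of Gram matrices and log-densities -/

section Determinant

variable {Ω : Type*} [MeasurableSpace Ω] {P : Measure Ω} [IsProbabilityMeasure P] {d : ℕ}
  {κ : Cube d → Cube d → ℝ} {η : ℝ} {f : Ω → C(Cube d, ℝ)} {ε : ℕ → Ω → ℝ}

/-- Adding a query point multiplies the determinant by the predictive variance. -/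
theorem det_noisyGram_snoc (hη : 0 < η) (hf : IsCenteredGP P κ f) {j : ℕ} (xs : Fin j → Cube d)
    (p : Cube d) : (noisyGram κ η (Fin.snoc xs p : Fin (j + 1) → Cube d)).det =
      (noisyGram κ η xs).det * (η ^ 2 + posteriorCov κ η xs p p) := by
  have hdet := (noisyGram_det_pos hη hf xs).ne'
  have hinv := Matrix.invertibleOfIsUnitDet _ hdet.isUnit
  set e : Fin j ⊕ Fin 1 ≃ Fin (j + 1) := finSumFinEquiv with he
  have hl : ∀ i, e (Sum.inl i) = Fin.castSucc i := fun i => rfl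
  have hr : ∀ u, e (Sum.inr u) = Fin.last j := fun u => by
    ext
    simp [he]
  have hb : (noisyGram κ η (Fin.snoc xs p : Fin (j + 1) → Cube d)).submatrix e e =
      Matrix.fromBlocks (noisyGram κ η xs) (Matrix.of fun i _ => κ p (xs i))
        (Matrix.of fun _ i => κ p (xs i)) (Matrix.of fun _ _ => κ p p + η ^ 2) := by
    ext i k
    rcases i with i | i <;> rcases k with k | k <;>
      simp [hl, hr, noisyGram, Matrix.one_apply, hf.symm (xs _) p, Fin.ext_iff,
        (Fin.is_lt _).ne, (Fin.is_lt _).ne']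
  -- The Schur complement of the old Gram matrix is `κ p p + η²` minus the quadratic form in the
  -- posterior variance.
  rw [← Matrix.det_submatrix_equiv_self e, hb, Matrix.det_fromBlocks₁₁, Matrix.det_fin_one,
    Matrix.invOf_eq_nonsing_inv]
  congr 1
  rw [posteriorCov, Matrix.sub_apply, Matrix.mul_assoc, Matrix.mul_apply]
  simp only [Matrix.of_apply, Matrix.mul_apply, dotProduct, Matrix.mulVec]
  ring

end Determinant

open scoped MatrixOrder Matrix.Norms.L2Operator in
/-- A positive definite matrix is congruent to the identity. -/
theorem Matrix.PosDef.exists_mul_mul_transpose_eq_one {n : Type*} [Fintype n] [DecidableEq n]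
    {A : Matrix n n ℝ} (hA : A.PosDef) : ∃ C : Matrix n n ℝ, C * A * Cᵀ = 1 := by
  obtain ⟨B, hB, rfl⟩ := CStarAlgebra.isStrictlyPositive_iff_eq_star_mul_self.mp
    hA.isStrictlyPositive
  have hd : IsUnit B.det := (Matrix.isUnit_iff_isUnit_det _).1 hB
  have hd' : IsUnit Bᵀ.det := by rwa [Matrix.det_transpose]
  refine ⟨Bᵀ⁻¹, ?_⟩
  rw [Matrix.star_eq_conjTranspose, Matrix.conjTranspose_eq_transpose_of_trivial, ← Matrix.mul_assoc,
    Matrix.nonsing_inv_mul _ hd', Matrix.one_mul, Matrix.transpose_nonsing_inv,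
    Matrix.transpose_transpose, Matrix.mul_nonsing_inv _ hd]

theorem log_noiseDensity {η : ℝ} (hη : 0 < η) {j : ℕ} (u y : Fin j → ℝ) :
    Real.log (noiseDensity η u y) =
      -(j / 2 * Real.log (2 * Real.pi * η ^ 2)) - (∑ i, (y i - u i) ^ 2) / (2 * η ^ 2) := by
  have hpos : 0 < 2 * Real.pi * η ^ 2 := by positivity
  rw [noiseDensity, Real.log_prod fun i _ =>
    (gaussianPDFReal_pos _ _ _ (toNNReal_sq_ne_zero hη)).ne']
  have : ∀ i, Real.log (gaussianPDFReal 0 (Real.toNNReal (η ^ 2)) (y i - u i)) =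
      -(1 / 2 * Real.log (2 * Real.pi * η ^ 2)) - (y i - u i) ^ 2 / (2 * η ^ 2) := fun i => by
    rw [gaussianPDFReal_def]
    simp only [sub_zero, Real.coe_toNNReal _ (sq_nonneg η)]
    rw [Real.log_mul (by positivity) (Real.exp_pos _).ne', Real.log_exp, Real.log_inv,
      Real.log_sqrt hpos.le]
    ring
  simp_rw [this]
  rw [Finset.sum_sub_distrib, Finset.sum_div]
  simp
  ring

/-! ### Mutual information as a log-determinant -/

section InformationGain

variable {Ω : Type*} [MeasurableSpace Ω] {P : Measure Ω} [IsProbabilityMeasure P] {d : ℕ}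
  {κ : Cube d → Cube d → ℝ} {η : ℝ} {f : Ω → C(Cube d, ℝ)} {ε : ℕ → Ω → ℝ} {n : ℕ}

/-- The noisy observations at fixed points. -/
def noisyObs (f : Ω → C(Cube d, ℝ)) (ε : ℕ → Ω → ℝ) (xs : Fin n → Cube d) (ω : Ω) : Fin n → ℝ :=
  fun i => f ω (xs i) + ε i ω

theorem measurable_noisyObs (hf : IsCenteredGP P κ f) (hε : IsGaussianNoise P η f ε)
    (xs : Fin n → Cube d) : Measurable (noisyObs f ε xs) :=
  measurable_pi_iff.2 fun _ => (hf.measurable_eval _).add (hε.measurable _)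

theorem hasGaussianLaw_noisyObs (hf : IsCenteredGP P κ f) (hε : IsGaussianNoise P η f ε)
    (xs : Fin n → Cube d) : HasGaussianLaw (noisyObs f ε xs) P :=
  (hasGaussianLaw_residual_obs hf hε xs Fin.elim0).snd

/-- The whitened vector is Gaussian with covariance `C A Cᵀ = 1`, where `A` is the noisy Gram
matrix, so its coordinates are independent standard normals. -/
theorem map_whitened (hf : IsCenteredGP P κ f) (hε : IsGaussianNoise P η f ε)
    (xs : Fin n → Cube d) {C : Matrix (Fin n) (Fin n) ℝ} (hC : C * noisyGram κ η xs * Cᵀ = 1) :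
    P.map (fun ω => C *ᵥ noisyObs f ε xs ω) =
      volume.withDensity fun z => ENNReal.ofReal (noiseDensity 1 0 z) := by
  have hm : ∀ i a, MemLp (fun ω => C i a * noisyObs f ε xs ω a) 2 P := fun i a =>
    (memLp_two_noisy_eval hf hε (xs a) a).const_mul _
  have hZ : HasGaussianLaw (fun ω => C *ᵥ noisyObs f ε xs ω) P :=
    (hasGaussianLaw_noisyObs hf hε xs).map_fun (LinearMap.toContinuousLinearMap (Matrix.mulVecLin C))
  have hcov : ∀ i k, cov[fun ω => (C *ᵥ noisyObs f ε xs ω) i, fun ω => (C *ᵥ noisyObs f ε xs ω) k; P]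
      = (1 : Matrix (Fin n) (Fin n) ℝ) i k := fun i k => by
    simp only [Matrix.mulVec, dotProduct]
    rw [covariance_fun_sum_fun_sum (hm i) (hm k), ← hC, Matrix.mul_apply, Finset.sum_comm]
    simp_rw [Matrix.mul_apply, Finset.sum_mul, covariance_const_mul_left,
      covariance_const_mul_right, noisyObs, cov_noisy_eval hf hε, Matrix.transpose_apply]
    refine Finset.sum_congr rfl fun a _ => Finset.sum_congr rfl fun b _ => by ring
  have hmean : ∀ i, ∫ ω, (C *ᵥ noisyObs f ε xs ω) i ∂P = 0 := fun i => by
    simp only [Matrix.mulVec, dotProduct]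
    rw [integral_finsetSum _ fun a _ => (hm i a).integrable one_le_two]
    refine Finset.sum_eq_zero fun a _ => ?_
    rw [integral_const_mul]
    simp only [noisyObs]
    rw [integral_add ((hf.memLp_two _).integrable one_le_two)
      ((hε.memLp_two _).integrable one_le_two), hf.mean_zero, hε.integral_eq_zero]
    simp
  have hind := HasGaussianLaw.iIndepFun_of_covariance_eq_zero
    (X := fun i ω => (C *ᵥ noisyObs f ε xs ω) i) hZ fun _ _ hik => by
      rw [hcov, Matrix.one_apply_ne hik]
  have hmap := (iIndepFun_iff_map_fun_eq_pi_map fun i => (hZ.eval i).aemeasurable).1 hind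
  have h1 := pi_gaussianReal_eq_withDensity (j := n) one_pos
  refine hmap.trans (Eq.trans ?_ h1)
  congr 1
  funext i
  rw [(hZ.eval i).map_eq_gaussianReal, hmean,
    ← covariance_self (hZ.eval i).aemeasurable, hcov]
  simp

theorem lintegral_comp_mulVec {C : Matrix (Fin n) (Fin n) ℝ} (hC : C.det ≠ 0)
    {G : (Fin n → ℝ) → ℝ≥0∞} (hG : Measurable G) :
    ENNReal.ofReal |C.det| * ∫⁻ y, G (C *ᵥ y) = ∫⁻ z, G z := by
  have h := Real.map_matrix_volume_pi_eq_smul_volume_pi hC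
  have hm : Measurable fun y : Fin n → ℝ => Matrix.toLin' C y := by
    have : Continuous (Matrix.toLin' C) := LinearMap.continuous_of_finiteDimensional _
    exact this.measurable
  have h2 : ∫⁻ y, G (C *ᵥ y) = ENNReal.ofReal |C.det⁻¹| * ∫⁻ z, G z := by
    rw [← smul_eq_mul, ← lintegral_smul_measure, ← h, lintegral_map hG hm]
    rfl
  rw [h2, ← mul_assoc, ← ENNReal.ofReal_mul (abs_nonneg _), ← abs_mul, mul_inv_cancel₀ hC]
  simp

theorem measurable_mulVec (C : Matrix (Fin n) (Fin n) ℝ) :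
    Measurable fun y : Fin n → ℝ => C *ᵥ y :=
  (continuous_const.matrix_mulVec continuous_id).measurable

/-- The noisy observations have a Gaussian density. -/
theorem map_noisyObs (hf : IsCenteredGP P κ f) (hε : IsGaussianNoise P η f ε)
    (xs : Fin n → Cube d) {C : Matrix (Fin n) (Fin n) ℝ} (hC : C * noisyGram κ η xs * Cᵀ = 1) :
    P.map (noisyObs f ε xs) =
      volume.withDensity fun y => ENNReal.ofReal (|C.det| * noiseDensity 1 0 (C *ᵥ y)) := by
  have hCu : IsUnit C.det := by
    rw [Matrix.mul_assoc] at hC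
    have := congrArg Matrix.det hC
    rw [Matrix.det_mul, Matrix.det_one] at this
    exact IsUnit.of_mul_eq_one _ this
  have hY := measurable_noisyObs hf hε xs
  have hCm := measurable_mulVec C
  have hdm : Measurable fun z : Fin n → ℝ => ENNReal.ofReal (noiseDensity 1 0 z) :=
    (measurable_noiseDensity.comp (measurable_const.prodMk measurable_id)).ennreal_ofReal
  refine Measure.ext_of_lintegral _ fun φ hφ => ?_
  have hG : Measurable fun z => φ (C⁻¹ *ᵥ z) := hφ.comp (measurable_mulVec _)
  have hinv : ∀ y, C⁻¹ *ᵥ (C *ᵥ y) = y := fun y => by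
    rw [Matrix.mulVec_mulVec, Matrix.nonsing_inv_mul _ hCu, Matrix.one_mulVec]
  have e1 : ∫⁻ y, φ y ∂(P.map (noisyObs f ε xs)) =
      ∫⁻ z, φ (C⁻¹ *ᵥ z) ∂(P.map fun ω => C *ᵥ noisyObs f ε xs ω) := by
    rw [lintegral_map hφ hY,
      lintegral_map hG (by exact hCm.comp hY : Measurable fun ω => C *ᵥ noisyObs f ε xs ω)]
    simp_rw [hinv]
  have hq : Measurable fun y : Fin n → ℝ =>
      ENNReal.ofReal (|C.det| * noiseDensity 1 0 (C *ᵥ y)) :=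
    ((measurable_noiseDensity.comp (measurable_const.prodMk hCm)).const_mul _).ennreal_ofReal
  rw [e1, map_whitened hf hε xs hC, lintegral_withDensity_eq_lintegral_mul _ hdm hG,
    lintegral_withDensity_eq_lintegral_mul _ hq hφ,
    ← lintegral_comp_mulVec hCu.ne_zero (hdm.mul hG)]
  have hm2 : Measurable fun y => ENNReal.ofReal (noiseDensity 1 0 (C *ᵥ y)) * φ y :=
    (hdm.comp hCm).mul hφ
  simp_rw [Pi.mul_apply, hinv, ENNReal.ofReal_mul (abs_nonneg C.det), mul_assoc]
  exact (lintegral_const_mul (ENNReal.ofReal |C.det|) hm2).symm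

theorem integrable_sq_and_integral_of_map {Z : Ω → Fin n → ℝ} {s : ℝ} (hs : 0 < s)
    (hZm : Measurable Z)
    (hZ : P.map Z = volume.withDensity fun z => ENNReal.ofReal (noiseDensity s 0 z)) (i : Fin n) :
    Integrable (fun ω => (Z ω i) ^ 2) P ∧ ∫ ω, (Z ω i) ^ 2 ∂P = s ^ 2 := by
  rw [← pi_gaussianReal_eq_withDensity hs] at hZ
  have hi : P.map (fun ω => Z ω i) = gaussianReal 0 (Real.toNNReal (s ^ 2)) := by
    have := (measurePreserving_eval (fun _ : Fin n => gaussianReal 0 (Real.toNNReal (s ^ 2)))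
      i).map_eq
    rw [← hZ, Measure.map_map (measurable_pi_apply i) hZm] at this
    exact this
  have hm : Measurable fun ω => Z ω i := (measurable_pi_apply i).comp hZm
  have hL : HasGaussianLaw (fun ω => Z ω i) P := ⟨by rw [hi]; infer_instance⟩
  have h0 : ∫ ω, Z ω i ∂P = 0 := by
    have := integral_map (μ := P) hm.aemeasurable (f := fun x : ℝ => x) aestronglyMeasurable_id
    rw [← this, hi, integral_id_gaussianReal]
  refine ⟨hL.memLp_two.integrable_sq, ?_⟩
  rw [← variance_of_integral_eq_zero hm.aemeasurable h0, ← variance_id_map hm.aemeasurable, hi,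
    variance_id_gaussianReal, Real.coe_toNNReal _ (sq_nonneg s)]

/-- The negative entropy of an isotropic Gaussian, used once for the noise and once for the whitened
observations. -/
theorem integrable_log_noiseDensity {Z : Ω → Fin n → ℝ} {s : ℝ} (hs : 0 < s) (hZm : Measurable Z)
    (hZ : P.map Z = volume.withDensity fun z => ENNReal.ofReal (noiseDensity s 0 z)) :
    Integrable (fun ω => Real.log (noiseDensity s 0 (Z ω))) P ∧
      ∫ ω, Real.log (noiseDensity s 0 (Z ω)) ∂P =
        -(n / 2 * Real.log (2 * Real.pi * s ^ 2)) - n / 2 := by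
  have h := integrable_sq_and_integral_of_map hs hZm hZ
  have hi : Integrable (fun ω => (∑ i, (Z ω i) ^ 2) / (2 * s ^ 2)) P :=
    (integrable_finsetSum _ fun i _ => (h i).1).div_const _
  simp_rw [log_noiseDensity hs, Pi.zero_apply, sub_zero]
  refine ⟨(integrable_const _).sub hi, ?_⟩
  rw [integral_sub (integrable_const _) hi, integral_div, integral_finsetSum _ fun i _ => (h i).1]
  simp_rw [fun i => (h i).2]
  simp
  field_simp

/-- The mutual information of the function values at fixed points and their noisy observations. -/
theorem mutualInfo_noisyObs (hη : 0 < η) (hf : IsCenteredGP P κ f) (hε : IsGaussianNoise P η f ε)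
    (xs : Fin n → Cube d) :
    mutualInfo P (fun ω (i : Fin n) => f ω (xs i)) (fun ω (i : Fin n) => f ω (xs i) + ε i ω) =
      ENNReal.ofReal (1 / 2 * Real.log ((noisyGram κ η xs).det / (η ^ 2) ^ n)) := by
  obtain ⟨C, hC⟩ := (noisyGram_posDef hη hf xs).exists_mul_mul_transpose_eq_one
  have hdet : C.det ^ 2 * (noisyGram κ η xs).det = 1 := by
    have := congrArg Matrix.det hC
    rw [Matrix.det_mul, Matrix.det_mul, Matrix.det_transpose, Matrix.det_one] at this
    linarith
  have hC0 : C.det ≠ 0 := fun h => by simp [h] at hdet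
  set F : Ω → Fin n → ℝ := fun ω i => f ω (xs i)
  set Y : Ω → Fin n → ℝ := noisyObs f ε xs
  have hF : Measurable F := measurable_pi_iff.2 fun i => hf.measurable_eval _
  have hY : Measurable Y := measurable_noisyObs hf hε xs
  have hCm := measurable_mulVec C
  have hem : Measurable fun ω (i : Fin n) => ε i ω := measurable_pi_iff.2 fun i => hε.measurable i
  have := Measure.isProbabilityMeasure_map (μ := P) hF.aemeasurable
  have := Measure.isProbabilityMeasure_map (μ := P) hY.aemeasurable
  have := Measure.isProbabilityMeasure_map (μ := P) (hF.prodMk hY).aemeasurable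
  set q : (Fin n → ℝ) → ℝ := fun y => |C.det| * noiseDensity 1 0 (C *ᵥ y) with hq
  have hqpos : ∀ y, 0 < q y := fun y =>
    mul_pos (abs_pos.2 hC0) (noiseDensity_pos one_pos _ _)
  have hqm : Measurable q :=
    (measurable_noiseDensity.comp (measurable_const.prodMk hCm)).const_mul _
  -- The density of the joint law with respect to the product of its marginals: conditional density
  -- of `Y` given `F` over the marginal density `q` of `Y`.
  set r : (Fin n → ℝ) × (Fin n → ℝ) → ℝ≥0∞ := fun z =>
    ENNReal.ofReal (noiseDensity η z.1 z.2 / q z.2) with hr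
  have hrm : Measurable r :=
    (measurable_noiseDensity.div (hqm.comp measurable_snd)).ennreal_ofReal
  have hμ : P.map (fun ω => (F ω, Y ω)) = ((P.map F).prod (P.map Y)).withDensity r := by
    refine Measure.ext_of_lintegral _ fun φ hφ => ?_
    have hev : Measurable fun (h : C(Cube d, ℝ)) (i : Fin n) => h (xs i) :=
      measurable_pi_iff.2 fun i => ContinuousMap.measurable_eval_const _
    have hΦ : Measurable fun z : C(Cube d, ℝ) × (Fin n → ℝ) => φ (fun i => z.1 (xs i), z.2) :=
      hφ.comp ((hev.comp measurable_fst).prodMk measurable_snd)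
    have hrφ : Measurable (r * φ) := hrm.mul hφ
    rw [lintegral_map hφ (hF.prodMk hY), lintegral_withDensity_eq_lintegral_mul _ hrm hφ,
      lintegral_prod_symm _ hrφ.aemeasurable, map_noisyObs hf hε xs hC,
      lintegral_withDensity_eq_lintegral_mul _ hqm.ennreal_ofReal
        (by exact hrφ.lintegral_prod_left')]
    refine (lintegral_noisy_eval hη hf hε xs hΦ).trans (lintegral_congr fun y => ?_)
    have hy : Measurable fun u => (r * φ) (u, y) :=
      hrφ.comp (measurable_id.prodMk measurable_const)
    rw [Pi.mul_apply, lintegral_map hy hF]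
    refine Eq.trans (lintegral_congr fun ω => ?_)
      (lintegral_const_mul (ENNReal.ofReal (q y)) (hy.comp hF))
    simp only [hr]
    rw [Pi.mul_apply, ← mul_assoc, ← ENNReal.ofReal_mul (hqpos y).le,
      mul_div_cancel₀ _ (hqpos y).ne', mul_comm]
  have hac : P.map (fun ω => (F ω, Y ω)) ≪ (P.map F).prod (P.map Y) := by
    rw [hμ]
    exact withDensity_absolutelyContinuous _ _
  set G : (Fin n → ℝ) × (Fin n → ℝ) → ℝ := fun z =>
    Real.log (noiseDensity η z.1 z.2) - Real.log (q z.2) with hG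
  have hGm : Measurable G :=
    (Real.measurable_log.comp measurable_noiseDensity).sub
      (Real.measurable_log.comp (hqm.comp measurable_snd))
  have hllr : llr (P.map fun ω => (F ω, Y ω)) ((P.map F).prod (P.map Y)) =ᵐ[P.map fun ω =>
      (F ω, Y ω)] G := by
    have h1 := Measure.rnDeriv_withDensity ((P.map F).prod (P.map Y)) hrm
    rw [← hμ] at h1
    filter_upwards [hac.ae_le h1] with z hz
    rw [llr, hz, ENNReal.toReal_ofReal (div_nonneg (noiseDensity_nonneg _ _) (hqpos _).le),
      Real.log_div (noiseDensity_pos hη _ _).ne' (hqpos _).ne']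
  have h1 := integrable_log_noiseDensity hη hem (hε.map_vector hη n)
  have h2 : Integrable (fun ω => Real.log (noiseDensity 1 0 (C *ᵥ Y ω))) P ∧
      ∫ ω, Real.log (noiseDensity 1 0 (C *ᵥ Y ω)) ∂P =
        -(n / 2 * Real.log (2 * Real.pi * 1 ^ 2)) - n / 2 :=
    integrable_log_noiseDensity one_pos (by exact hCm.comp hY) (map_whitened hf hε xs hC)
  have h2' : Integrable (fun ω => Real.log |C.det| + Real.log (noiseDensity 1 0 (C *ᵥ Y ω))) P :=
    (integrable_const _).add h2.1
  -- Since `Y - F` is the noise, the log-likelihood ratio splits into two Gaussian log-densities.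
  -- Their terms `-n / 2` cancel in the mean, leaving `log |det C|` and the noise variance.
  have hGω : ∀ ω, G (F ω, Y ω) = Real.log (noiseDensity η 0 fun i : Fin n => ε i ω) -
      (Real.log |C.det| + Real.log (noiseDensity 1 0 (C *ᵥ Y ω))) := fun ω => by
    simp only [hG, hq]
    rw [Real.log_mul (abs_pos.2 hC0).ne' (noiseDensity_pos one_pos _ _).ne']
    congr 2
    simp [noiseDensity, F, Y, noisyObs]
  have hGi : Integrable (fun ω => G (F ω, Y ω)) P := by
    simp_rw [hGω]
    exact h1.1.sub h2'
  have hGint : ∫ ω, G (F ω, Y ω) ∂P =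
      1 / 2 * Real.log ((noisyGram κ η xs).det / (η ^ 2) ^ n) := by
    simp_rw [hGω]
    have hd : 0 < (noisyGram κ η xs).det := noisyGram_det_pos hη hf xs
    have h3 := congrArg Real.log hdet
    rw [Real.log_mul (pow_ne_zero _ hC0) hd.ne', Real.log_pow, Real.log_one] at h3
    rw [integral_sub h1.1 h2', integral_add (integrable_const _) h2.1,
      h1.2, h2.2, Real.log_div hd.ne' (by positivity), Real.log_pow, Real.log_abs,
      Real.log_mul (by positivity) (by positivity), integral_const, one_pow, mul_one]
    simp only [probReal_univ, one_smul]
    push_cast at h3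
    linarith
  have hGi' : Integrable (llr (P.map fun ω => (F ω, Y ω)) ((P.map F).prod (P.map Y)))
      (P.map fun ω => (F ω, Y ω)) :=
    ((integrable_map_measure hGm.aestronglyMeasurable (hF.prodMk hY).aemeasurable).2 hGi).congr
      hllr.symm
  have := InformationTheory.klDiv_of_ac_of_integrable hac hGi'
  refine this.trans ?_
  rw [integral_congr_ae hllr, integral_map (hF.prodMk hY).aemeasurable hGm.aestronglyMeasurable,
    hGint]
  simp

end InformationGain

/-! ### Approximating repeated design points by distinct ones -/

/-- Injectivity is an intersection of finitely many open conditions `xs i ≠ xs k`, each dense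
because one coordinate can be moved slightly. The queries may repeat whereas `γ_n` ranges over
distinct points; density closes that gap. -/
theorem dense_setOf_injective {X : Type*} [TopologicalSpace X] [T2Space X] [CompactSpace X]
    (hX : ∀ p : X, (nhdsWithin p {p}ᶜ).NeBot) (n : ℕ) :
    Dense {xs : Fin n → X | Function.Injective xs} := by
  have h : {xs : Fin n → X | Function.Injective xs} =
      ⋂ k : {z : Fin n × Fin n // z.1 ≠ z.2}, {xs | xs k.1.1 ≠ xs k.1.2} := by
    ext xs
    simp only [mem_ofPred_eq, mem_iInter, Subtype.forall, Prod.forall]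
    exact ⟨fun h i k hik he => hik (h he), fun h i k he => by_contra fun hik => h i k hik he⟩
  rw [h]
  refine dense_iInter_of_isOpen (fun k => isOpen_ne_fun (continuous_apply _) (continuous_apply _))
    fun k xs => ?_
  by_cases hxs : xs k.1.1 ≠ xs k.1.2
  · exact subset_closure hxs
  · rw [ne_eq, not_not] at hxs
    have := hX (xs k.1.1)
    have ht : Filter.Tendsto (fun p => Function.update xs k.1.1 p)
        (nhdsWithin (xs k.1.1) {xs k.1.1}ᶜ) (nhds xs) := by
      have hc : Continuous fun p => Function.update xs k.1.1 p :=
        continuous_const.update _ continuous_id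
      have := (hc.tendsto (xs k.1.1)).mono_left
        (nhdsWithin_le_nhds (s := {xs k.1.1}ᶜ))
      rwa [Function.update_eq_self] at this
    refine mem_closure_of_tendsto ht ?_
    filter_upwards [self_mem_nhdsWithin] with p hp
    simp only [Function.update_self, Function.update_of_ne k.2.symm]
    rw [← hxs]
    exact hp

theorem neBot_nhdsNE_cube {d : ℕ} (hd : 1 ≤ d) (p : Cube d) : (nhdsWithin p {p}ᶜ).NeBot := by
  have : Nonempty (Fin d) := ⟨⟨0, hd⟩⟩
  exact ConnectedSpace.neBot_nhdsWithin_compl_of_nontrivial_of_t1space p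

/-- Bernoulli's inequality `(1 + c) ^ s ≤ 1 + s c` for exponents in `[0, 1]`. -/
theorem mul_log_one_add_le {s c : ℝ} (hs : 0 ≤ s) (hs1 : s ≤ 1) (hc : 0 ≤ c) :
    s * Real.log (1 + c) ≤ Real.log (1 + s * c) := by
  rw [← Real.log_rpow (by linarith)]
  exact Real.log_le_log (Real.rpow_pos_of_pos (by linarith) _)
    (rpow_one_add_le_one_add_mul_self (by linarith) hs hs1)

/-! ### The maximum information gain bounds the sum of posterior deviations -/

section InformationGain

variable {Ω : Type*} [MeasurableSpace Ω] {P : Measure Ω} [IsProbabilityMeasure P] {d : ℕ}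
  {κ : Cube d → Cube d → ℝ} {η : ℝ} {f : Ω → C(Cube d, ℝ)} {ε : ℕ → Ω → ℝ} {n : ℕ}

/-- The determinant is the product of the predictive variances. -/
theorem log_det_noisyGram (hη : 0 < η) (hf : IsCenteredGP P κ f) (hε : IsGaussianNoise P η f ε)
    (X : ℕ → Cube d) (n : ℕ) :
    Real.log ((noisyGram κ η fun i : Fin n => X i).det / (η ^ 2) ^ n) =
      ∑ j ∈ Finset.range n,
        Real.log (1 + posteriorCov κ η (fun i : Fin j => X i) (X j) (X j) * (η ^ 2)⁻¹) := by
  induction n with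
  | zero => simp
  | succ n ih =>
    have hs : (fun i : Fin (n + 1) => X i) = Fin.snoc (fun i : Fin n => X i) (X n) := by
      funext i
      refine Fin.lastCases ?_ (fun i => ?_) i <;> simp
    have h0 := posteriorCov_self_nonneg hη hf hε (fun i : Fin n => X i) (X n)
    have hd := noisyGram_det_pos hη hf fun i : Fin n => X i
    rw [Finset.sum_range_succ, ← ih, hs, det_noisyGram_snoc hη hf, ← Real.log_mul
      (by positivity) (by positivity)]
    congr 1
    field_simp
    ring

theorem log_det_noisyGram_le (hη : 0 < η) (hκ : ∀ p q, κ p q ≤ 1) (hf : IsCenteredGP P κ f)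
    (hε : IsGaussianNoise P η f ε) (xs : Fin n → Cube d) :
    Real.log ((noisyGram κ η xs).det / (η ^ 2) ^ n) ≤ n * Real.log (1 + (η ^ 2)⁻¹) := by
  -- An arbitrary extension to a sequence, so that the product formula over successive queries
  -- applies.
  set X : ℕ → Cube d := fun i => if h : i < n then xs ⟨i, h⟩ else fun _ => 0
  have hX : xs = fun i : Fin n => X i := by
    funext i
    simp [X]
  rw [hX, log_det_noisyGram hη hf hε]
  refine (Finset.sum_le_card_nsmul _ _ (Real.log (1 + (η ^ 2)⁻¹)) fun j _ => ?_).trans (by simp)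
  have h0 := posteriorCov_self_nonneg hη hf hε (fun i : Fin j => X i) (X j)
  have h1 := (posteriorCov_self_le hη hf (fun i : Fin j => X i) (X j)).trans (hκ _ _)
  refine Real.log_le_log (by positivity) ?_
  have : 0 ≤ (η ^ 2)⁻¹ := by positivity
  nlinarith

theorem maxInfoGain_ne_top (hη : 0 < η) (hκ : ∀ p q, κ p q ≤ 1) (hf : IsCenteredGP P κ f)
    (hε : IsGaussianNoise P η f ε) (n : ℕ) : maxInfoGain P f ε n ≠ ∞ := by
  refine ne_top_of_le_ne_top (b := ENNReal.ofReal (1 / 2 * (n * Real.log (1 + (η ^ 2)⁻¹))))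
    ENNReal.ofReal_ne_top (iSup_le fun A => ?_)
  rw [mutualInfo_noisyObs hη hf hε]
  exact ENNReal.ofReal_le_ofReal (mul_le_mul_of_nonneg_left
    (log_det_noisyGram_le hη hκ hf hε _) (by norm_num))

/-- The maximum information gain also bounds the information gain of designs with repetitions. -/
theorem log_det_noisyGram_le_maxInfoGain (hd : 1 ≤ d) (hη : 0 < η) (hκ : ∀ p q, κ p q ≤ 1)
    (hf : IsCenteredGP P κ f) (hε : IsGaussianNoise P η f ε) (xs : Fin n → Cube d) :
    1 / 2 * Real.log ((noisyGram κ η xs).det / (η ^ 2) ^ n) ≤ (maxInfoGain P f ε n).toReal := by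
  have htop := maxInfoGain_ne_top hη hκ hf hε n
  have hc : Continuous fun xs : Fin n → Cube d =>
      1 / 2 * Real.log ((noisyGram κ η xs).det / (η ^ 2) ^ n) := by
    refine continuous_const.mul (Continuous.log
      ((continuous_noisyGram hf).matrix_det.div_const _) fun xs => ?_)
    have := noisyGram_det_pos hη hf xs
    positivity
  have hcl : IsClosed {xs : Fin n → Cube d | 1 / 2 * Real.log ((noisyGram κ η xs).det /
      (η ^ 2) ^ n) ≤ (maxInfoGain P f ε n).toReal} := isClosed_le hc continuous_const
  -- The bound is a closed condition on the design and holds for distinct points by definition of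
  -- the supremum.
  have hsub : closure {xs : Fin n → Cube d | Function.Injective xs} ⊆ _ :=
    hcl.closure_subset_iff.2 fun xs hxs => by
      have h := le_iSup (fun A : Fin n ↪ Cube d => mutualInfo P (fun ω (i : Fin n) => f ω (A i))
        fun ω (i : Fin n) => f ω (A i) + ε i ω) ⟨xs, hxs⟩
      rw [mutualInfo_noisyObs hη hf hε] at h
      exact (ENNReal.ofReal_le_iff_le_toReal htop).1 h
  rw [(dense_setOf_injective (neBot_nhdsNE_cube hd) n).closure_eq] at hsub
  exact hsub (mem_univ xs)

/-- Cauchy–Schwarz reduces to the sum of the variances. Each lies in `[0, 1]`, so `σ² log(1 + η⁻²) ≤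
log(1 + σ² η⁻²)`, and these logarithms add up to the log-determinant. The design is arbitrary, so
the bound applies pathwise to the random queries. -/
theorem sum_sqrt_posteriorCov_le (hd : 1 ≤ d) (hη : 0 < η) (hκ : ∀ p q, κ p q ≤ 1)
    (hf : IsCenteredGP P κ f) (hε : IsGaussianNoise P η f ε) (X : ℕ → Cube d) (n : ℕ) :
    ∑ j ∈ Finset.range n, √(posteriorCov κ η (fun i : Fin j => X i) (X j) (X j)) ≤
      √(n * (2 / Real.log (1 + (η ^ 2)⁻¹) * (maxInfoGain P f ε n).toReal)) := by
  have hl : 0 < Real.log (1 + (η ^ 2)⁻¹) := Real.log_pos (by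
    have : 0 < (η ^ 2)⁻¹ := by positivity
    linarith)
  have h0 := fun j : ℕ => posteriorCov_self_nonneg hη hf hε (fun i : Fin j => X i) (X j)
  refine Real.le_sqrt_of_sq_le ?_
  refine (sq_sum_le_card_mul_sum_sq).trans ?_
  rw [Finset.card_range]
  refine mul_le_mul_of_nonneg_left ?_ (Nat.cast_nonneg n)
  have h1 := log_det_noisyGram_le_maxInfoGain hd hη hκ hf hε fun i : Fin n => X i
  rw [log_det_noisyGram hη hf hε] at h1
  rw [div_mul_eq_mul_div, le_div_iff₀ hl, Finset.sum_mul]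
  refine le_trans (Finset.sum_le_sum fun j _ => ?_) (by linarith : ∑ j ∈ Finset.range n,
    Real.log (1 + posteriorCov κ η (fun i : Fin j => X i) (X j) (X j) * (η ^ 2)⁻¹) ≤ _)
  rw [Real.sq_sqrt (h0 j)]
  exact mul_log_one_add_le (h0 j)
    ((posteriorCov_self_le hη hf (fun i : Fin j => X i) (X j)).trans (hκ _ _)) (by positivity)

end InformationGain

/-! ### Lipschitz constants along coordinate lines -/

section Lipschitz

variable {d : ℕ}

/-- The best Lipschitz constant of `h` along the lines in the `i`-th coordinate direction. -/
noncomputable def coordLipschitz (i : Fin d) (h : C(Cube d, ℝ)) : ℝ≥0∞ :=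
  ⨆ z : Cube d × unitInterval × unitInterval, ENNReal.ofReal
    (|h (Function.update z.1 i z.2.1) - h (Function.update z.1 i z.2.2)| / |(z.2.1 - z.2.2 : ℝ)|)

/-- An uncountable supremum, but of functionals continuous in `h`, hence lower semicontinuous.
Difference quotients thus avoid the question of measurability for the derivative. -/
theorem measurable_coordLipschitz (i : Fin d) : Measurable (coordLipschitz i) := by
  refine LowerSemicontinuous.measurable (lowerSemicontinuous_iSup fun z => ?_)
  refine Continuous.lowerSemicontinuous (ENNReal.continuous_ofReal.comp ?_)
  exact (((ContinuousEvalConst.continuous_eval_const _).sub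
    (ContinuousEvalConst.continuous_eval_const _)).abs).div_const _

theorem abs_sub_update_le_coordLipschitz (i : Fin d) (h : C(Cube d, ℝ)) (p : Cube d)
    (s t : unitInterval) :
    ENNReal.ofReal |h (Function.update p i s) - h (Function.update p i t)| ≤
      coordLipschitz i h * ENNReal.ofReal |(s - t : ℝ)| := by
  by_cases hst : s = t
  · simp [hst]
  have hst' : 0 < |(s - t : ℝ)| := abs_pos.2 (sub_ne_zero.2 fun h => hst (Subtype.ext h))
  calc ENNReal.ofReal |h (Function.update p i s) - h (Function.update p i t)|
      = ENNReal.ofReal (|h (Function.update p i s) - h (Function.update p i t)| / |(s - t : ℝ)|) *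
          ENNReal.ofReal |(s - t : ℝ)| := by
        rw [← ENNReal.ofReal_mul (by positivity), div_mul_cancel₀ _ hst'.ne']
    _ ≤ _ := mul_le_mul_left (le_iSup (fun z : Cube d × unitInterval × unitInterval =>
        ENNReal.ofReal (|h (Function.update z.1 i z.2.1) - h (Function.update z.1 i z.2.2)| /
          |(z.2.1 - z.2.2 : ℝ)|)) (p, s, t)) _

/-- The sum of the Lipschitz constants in the coordinate directions. -/
noncomputable def totalLipschitz (h : C(Cube d, ℝ)) : ℝ≥0∞ := ∑ i, coordLipschitz i h

theorem measurable_totalLipschitz : Measurable (totalLipschitz (d := d)) := by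
  unfold totalLipschitz
  exact Finset.measurable_fun_sum _ fun i _ => measurable_coordLipschitz i

/-- Coordinates are changed from `q` to `p` one at a time; `S.piecewise p q` is the point reached
after those in `S`. -/
theorem abs_sub_le_sum_coordLipschitz (h : C(Cube d, ℝ)) (p q : Cube d) :
    ENNReal.ofReal |h p - h q| ≤ ∑ i, coordLipschitz i h * ENNReal.ofReal |(p i - q i : ℝ)| := by
  classical
  suffices H : ∀ S : Finset (Fin d), ENNReal.ofReal |h (S.piecewise p q) - h q| ≤
      ∑ i ∈ S, coordLipschitz i h * ENNReal.ofReal |(p i - q i : ℝ)| by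
    simpa using H Finset.univ
  intro S
  induction S using Finset.induction_on with
  | empty => simp
  | insert i S hi ih =>
    rw [Finset.sum_insert hi, Finset.piecewise_insert]
    have h1 := abs_sub_update_le_coordLipschitz i h (S.piecewise p q) (p i) (q i)
    have h2 : Function.update (S.piecewise p q) i (q i) = S.piecewise p q := by
      rw [← Finset.piecewise_eq_of_notMem S p q hi, Function.update_eq_self]
    rw [h2] at h1
    refine le_trans ?_ (add_le_add h1 ih)
    rw [← ENNReal.ofReal_add (abs_nonneg _) (abs_nonneg _)]
    exact ENNReal.ofReal_le_ofReal (abs_sub_le _ _ _)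

theorem abs_sub_le_totalLipschitz (h : C(Cube d, ℝ)) {p q : Cube d} {δ : ℝ}
    (hpq : ∀ i, |(p i - q i : ℝ)| ≤ δ) :
    ENNReal.ofReal |h p - h q| ≤ totalLipschitz h * ENNReal.ofReal δ := by
  refine (abs_sub_le_sum_coordLipschitz h p q).trans ?_
  rw [totalLipschitz, Finset.sum_mul]
  gcongr with i
  exact hpq i

/-- The mean value inequality on `[0, 1]`: all points of a coordinate line share the same
`coordLine`, whose derivatives there are the partial derivatives. -/
theorem coordLipschitz_le_of_partialDeriv_le {i : Fin d} {h : C(Cube d, ℝ)} {J : ℝ}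
    (hh : HasPartialDerivs (h : Cube d → ℝ)) (hJ : ∀ p, |partialDeriv (h : Cube d → ℝ) i p| ≤ J) :
    coordLipschitz i h ≤ ENNReal.ofReal J := by
  refine iSup_le fun ⟨p, s, t⟩ => ENNReal.ofReal_le_ofReal ?_
  have hJ0 : 0 ≤ J := (abs_nonneg _).trans (hJ p)
  have hline : ∀ u : unitInterval, coordLine h i (Function.update p i u) = coordLine h i p := by
    intro u
    simp [coordLine]
  have hval : ∀ u : unitInterval, coordLine h i p u = h (Function.update p i u) := fun u => by
    simp [coordLine]
  refine div_le_of_le_mul₀ (abs_nonneg _) hJ0 ?_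
  have key := (convex_Icc (0 : ℝ) 1).norm_image_sub_le_of_norm_derivWithin_le
    (f := coordLine h i p) (C := J) (x := (t : ℝ)) (y := (s : ℝ)) (fun u hu => ?_) (fun u hu => ?_)
    t.2 s.2
  · rwa [hval, hval, Real.norm_eq_abs, Real.norm_eq_abs] at key
  · have := hh i (Function.update p i ⟨u, hu⟩)
    rwa [hline, Function.update_self] at this
  · have := hJ (Function.update p i ⟨u, hu⟩)
    rwa [partialDeriv, hline, Function.update_self] at this

end Lipschitz

/-! ### Expected Lipschitz constants from the gradient tail -/

section Tail

variable {Ω : Type*} [MeasurableSpace Ω] {P : Measure Ω} {d : ℕ} {f : Ω → C(Cube d, ℝ)} {a b : ℝ}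

theorem GradientTail.measure_coordLipschitz_lt (hg : GradientTail P f a b) (i : Fin d) {J : ℝ}
    (hJ : 0 < J) : P {ω | ENNReal.ofReal J < coordLipschitz i (f ω)} ≤
      ENNReal.ofReal (a * Real.exp (-(J / b) ^ 2)) := by
  refine (measure_mono_ae ?_).trans (hg.tail i J hJ)
  filter_upwards [hg.exists_partial] with ω hω h
  by_contra hc
  exact absurd h (not_lt.2 (coordLipschitz_le_of_partialDeriv_le hω fun p =>
    not_lt.1 fun hp => hc ⟨p, hp⟩))

theorem GradientTail.ae_coordLipschitz_lt_top (hg : GradientTail P f a b) (hb : 0 < b)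
    (i : Fin d) : ∀ᵐ ω ∂P, coordLipschitz i (f ω) ≠ ∞ := by
  have ht : Filter.Tendsto (fun J : ℝ => ENNReal.ofReal (a * Real.exp (-(J / b) ^ 2)))
      Filter.atTop (nhds 0) := by
    have h1 : Filter.Tendsto (fun J : ℝ => (J / b) ^ 2) Filter.atTop Filter.atTop :=
      (Filter.tendsto_pow_atTop two_ne_zero).comp (Filter.tendsto_id.atTop_div_const hb)
    have h2 := ((Real.tendsto_exp_neg_atTop_nhds_zero.comp h1).const_mul a)
    rw [mul_zero] at h2
    have h3 := (ENNReal.continuous_ofReal.tendsto 0).comp h2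
    rwa [ENNReal.ofReal_zero] at h3
  refine le_antisymm (ge_of_tendsto ht ?_) zero_le
  filter_upwards [Filter.eventually_gt_atTop 0] with J hJ
  refine (measure_mono fun ω hω => ?_).trans (hg.measure_coordLipschitz_lt i hJ)
  simp only [ne_eq, mem_compl_iff, mem_ofPred_eq, not_not] at hω
  simp only [mem_ofPred_eq, hω]
  exact ENNReal.ofReal_lt_top

/-- Layer-cake formula: the tail bound integrates to `a ∫₀^∞ exp(-(t/b)²) dt = a b √π / 2`. -/
theorem GradientTail.lintegral_coordLipschitz_le (hg : GradientTail P f a b) (ha : 0 < a)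
    (hb : 0 < b) (hf : Measurable f) (i : Fin d) :
    ∫⁻ ω, coordLipschitz i (f ω) ∂P ≤ ENNReal.ofReal (a * b * √Real.pi / 2) := by
  have hm : Measurable fun ω => coordLipschitz i (f ω) := (measurable_coordLipschitz i).comp hf
  have h1 : ∫⁻ ω, coordLipschitz i (f ω) ∂P =
      ∫⁻ ω, ENNReal.ofReal (coordLipschitz i (f ω)).toReal ∂P := by
    refine lintegral_congr_ae ?_
    filter_upwards [hg.ae_coordLipschitz_lt_top hb i] with ω hω
    rw [ENNReal.ofReal_toReal hω]
  have hi : IntegrableOn (fun t : ℝ => a * Real.exp (-(b ^ 2)⁻¹ * t ^ 2)) (Ioi 0) :=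
    ((integrable_exp_neg_mul_sq (by positivity)).const_mul a).integrableOn
  have h2 : ∫ t in Ioi (0 : ℝ), a * Real.exp (-(b ^ 2)⁻¹ * t ^ 2) = a * b * √Real.pi / 2 := by
    rw [integral_const_mul, integral_gaussian_Ioi, div_inv_eq_mul,
      Real.sqrt_mul Real.pi_pos.le, Real.sqrt_sq hb.le]
    ring
  rw [h1, lintegral_eq_lintegral_meas_lt P (Filter.Eventually.of_forall fun ω =>
    ENNReal.toReal_nonneg) hm.ennreal_toReal.aemeasurable, ← h2,
    ofReal_integral_eq_lintegral_ofReal hi (Filter.Eventually.of_forall fun t => by positivity)]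
  refine setLIntegral_mono' measurableSet_Ioi fun t ht => ?_
  refine (measure_mono fun ω hω => ?_).trans ((hg.measure_coordLipschitz_lt i ht).trans (le_of_eq ?_))
  · by_cases htop : coordLipschitz i (f ω) = ∞
    · simp only [mem_ofPred_eq, htop]
      exact ENNReal.ofReal_lt_top
    · exact (ENNReal.ofReal_lt_iff_lt_toReal (mem_Ioi.1 ht).le htop).2 hω
  · congr 3
    field_simp

theorem GradientTail.lintegral_totalLipschitz_le (hg : GradientTail P f a b) (ha : 0 < a)
    (hb : 0 < b) (hf : Measurable f) :
    ∫⁻ ω, totalLipschitz (f ω) ∂P ≤ ENNReal.ofReal (d * a * b * √Real.pi / 2) := by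
  unfold totalLipschitz
  have hm : ∀ i, Measurable fun ω => coordLipschitz i (f ω) := fun i =>
    (measurable_coordLipschitz i).comp hf
  rw [lintegral_finsetSum _ fun i _ => hm i]
  refine (Finset.sum_le_card_nsmul _ _ _ fun i _ =>
    hg.lintegral_coordLipschitz_le ha hb hf i).trans (le_of_eq ?_)
  rw [nsmul_eq_mul, Finset.card_univ, Fintype.card_fin, ← ENNReal.ofReal_natCast,
    ← ENNReal.ofReal_mul (Nat.cast_nonneg _)]
  congr 1
  ring

end Tail

/-! ### The upper tail of a Gaussian variable -/

theorem integral_Ioi_mul_exp_neg_sq_div_two (s : ℝ) :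
    IntegrableOn (fun z : ℝ => z * Real.exp (-z ^ 2 / 2)) (Ioi s) ∧
      ∫ z in Ioi s, z * Real.exp (-z ^ 2 / 2) = Real.exp (-s ^ 2 / 2) := by
  have hi : Integrable fun z : ℝ => z * Real.exp (-z ^ 2 / 2) := by
    have := integrable_mul_exp_neg_mul_sq (b := 1 / 2) (by norm_num)
    refine this.congr (Filter.Eventually.of_forall fun z => ?_)
    simp only
    congr 2
    ring
  refine ⟨hi.integrableOn, ?_⟩
  have ht : Filter.Tendsto (fun z : ℝ => -Real.exp (-z ^ 2 / 2)) Filter.atTop (nhds 0) := by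
    have h1 : Filter.Tendsto (fun z : ℝ => z ^ 2 / 2) Filter.atTop Filter.atTop :=
      (Filter.tendsto_pow_atTop two_ne_zero).atTop_div_const two_pos
    have h2 := (Real.tendsto_exp_neg_atTop_nhds_zero.comp h1).neg
    rw [neg_zero] at h2
    refine h2.congr fun z => ?_
    simp only [Function.comp_apply, neg_div]
  rw [integral_Ioi_of_hasDerivAt_of_tendsto' (f := fun z : ℝ => -Real.exp (-z ^ 2 / 2))
    (fun z _ => ?_) hi.integrableOn ht]
  · ring
  · have h1 : HasDerivAt (fun z : ℝ => -z ^ 2 / 2) (-z) z := by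
      have := ((hasDerivAt_pow 2 z).neg).div_const 2
      refine this.congr_deriv ?_
      norm_num
      ring
    refine h1.exp.neg.congr_deriv ?_
    ring

/-- For `s ≥ 0` the excess `z - s` is at most `z` on `z > s`, and `z exp(-z² / 2)` has an explicit
primitive. -/
theorem lintegral_gaussianReal_zero_one_sub_le {s : ℝ} (hs : 0 ≤ s) :
    ∫⁻ z, ENNReal.ofReal (z - s) ∂(gaussianReal 0 1) ≤
      ENNReal.ofReal ((√(2 * Real.pi))⁻¹ * Real.exp (-s ^ 2 / 2)) := by
  have h := integral_Ioi_mul_exp_neg_sq_div_two s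
  rw [gaussianReal_of_var_ne_zero _ one_ne_zero, lintegral_withDensity_eq_lintegral_mul _
    (measurable_gaussianPDF _ _) (by fun_prop), ← h.2, ← integral_const_mul,
    ofReal_integral_eq_lintegral_ofReal (h.1.const_mul _)
      ((ae_restrict_iff' measurableSet_Ioi).2 (Filter.Eventually.of_forall fun z hz => by
        have : 0 ≤ z := hs.trans (mem_Ioi.1 hz).le
        simp only [Pi.zero_apply]
        positivity)),
    ← lintegral_indicator measurableSet_Ioi]
  refine lintegral_mono fun z => ?_
  by_cases hz : z ∈ Ioi s
  · rw [indicator_of_mem hz, Pi.mul_apply, gaussianPDF, ← ENNReal.ofReal_mul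
      (gaussianPDFReal_nonneg _ _ _), gaussianPDFReal_def]
    refine ENNReal.ofReal_le_ofReal ?_
    simp only [NNReal.coe_one, mul_one, sub_zero]
    have : 0 ≤ (√(2 * Real.pi))⁻¹ * Real.exp (-z ^ 2 / 2) := by positivity
    nlinarith
  · rw [indicator_of_notMem hz, Pi.mul_apply,
      ENNReal.ofReal_of_nonpos (by simp only [mem_Ioi, not_lt] at hz; linarith), mul_zero]

/-- The mean excess of a Gaussian variable over the mean plus `s` standard deviations. -/
theorem lintegral_gaussianReal_sub_le (m : ℝ) {v s : ℝ} (hv : 0 ≤ v) (hs : 0 ≤ s) :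
    ∫⁻ y, ENNReal.ofReal (y - m - s * √v) ∂(gaussianReal m (Real.toNNReal v)) ≤
      ENNReal.ofReal (√v * ((√(2 * Real.pi))⁻¹ * Real.exp (-s ^ 2 / 2))) := by
  have h1 : gaussianReal m (Real.toNNReal v) =
      (gaussianReal 0 1).map fun z => m + √v * z := by
    have h2 := gaussianReal_map_const_mul (μ := 0) (v := 1) (√v)
    have h3 := gaussianReal_map_const_add (μ := √v * 0) (v := NNReal.mk (√v ^ 2) (sq_nonneg _) * 1) m
    rw [← h2, Measure.map_map (by fun_prop) (by fun_prop)] at h3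
    rw [show (fun z : ℝ => m + √v * z) = (fun x => m + x) ∘ fun z => √v * z from rfl, h3]
    congr 1
    · ring
    · ext
      simp [Real.sq_sqrt hv, hv]
  rw [h1, lintegral_map (by fun_prop) (by fun_prop)]
  have h4 : ∀ z : ℝ, ENNReal.ofReal (m + √v * z - m - s * √v) =
      ENNReal.ofReal √v * ENNReal.ofReal (z - s) := fun z => by
    rw [← ENNReal.ofReal_mul (Real.sqrt_nonneg _)]
    congr 1
    ring
  simp_rw [h4]
  rw [lintegral_const_mul _ (by fun_prop), ENNReal.ofReal_mul (Real.sqrt_nonneg _)]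
  gcongr
  exact lintegral_gaussianReal_zero_one_sub_le hs

/-- The cube is covered by `N ^ d` closed cells of side `1 / N`; in every cell we may choose a
minimiser of a given continuous function. -/
theorem exists_cell_minimiser {d N : ℕ} (hN : 0 < N) {F : Cube d → ℝ} (hF : Continuous F) :
    ∃ z : (Fin d → Fin N) → Cube d, ∀ p, ∃ c,
      (∀ i, |(p i - z c i : ℝ)| ≤ 1 / N) ∧ F (z c) ≤ F p := by
  have hN' : (0 : ℝ) < N := Nat.cast_pos.2 hN
  set cell : (Fin d → Fin N) → Set (Cube d) := fun c =>
    {p | ∀ i, (c i : ℝ) / N ≤ p i ∧ (p i : ℝ) ≤ (c i + 1) / N} with hcell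
  have hcl : ∀ c, IsClosed (cell c) := fun c => by
    have : cell c = ⋂ i, {p : Cube d | (c i : ℝ) / N ≤ p i ∧ (p i : ℝ) ≤ (c i + 1) / N} := by
      ext p
      simp [hcell]
    rw [this]
    refine isClosed_iInter fun i => ?_
    have hc : Continuous fun p : Cube d => (p i : ℝ) := continuous_subtype_val.comp (continuous_apply i)
    exact (isClosed_le continuous_const hc).inter (isClosed_le hc continuous_const)
  have hz : ∀ c, ∃ z, ∀ p ∈ cell c, z ∈ cell c ∧ F z ≤ F p := fun c => by
    rcases (cell c).eq_empty_or_nonempty with h | h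
    · exact ⟨fun _ => 0, by simp [h]⟩
    · obtain ⟨z, hz, hmin⟩ := (hcl c).isCompact.exists_isMinOn h hF.continuousOn
      exact ⟨z, fun p hp => ⟨hz, hmin hp⟩⟩
  choose z hz using hz
  refine ⟨z, fun p => ?_⟩
  -- The minimum with `N - 1` puts the boundary value `p i = 1` into the last closed cell.
  set c : Fin d → Fin N := fun i => ⟨min ⌊(p i : ℝ) * N⌋₊ (N - 1), by omega⟩ with hc
  have hp : p ∈ cell c := fun i => by
    have h0 : (0 : ℝ) ≤ (p i : ℝ) * N := mul_nonneg (p i).2.1 hN'.le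
    have hfl := Nat.floor_le h0
    have hlt := Nat.lt_floor_add_one ((p i : ℝ) * N)
    rw [div_le_iff₀ hN', le_div_iff₀ hN']
    rcases le_total ⌊(p i : ℝ) * N⌋₊ (N - 1) with h | h
    · simp only [hc, min_eq_left h]
      exact ⟨hfl, hlt.le⟩
    · have h' : ((N - 1 : ℕ) : ℝ) ≤ ⌊(p i : ℝ) * N⌋₊ := Nat.cast_le.2 h
      simp only [hc, min_eq_right h]
      refine ⟨h'.trans hfl, ?_⟩
      rw [Nat.cast_sub hN]
      have := mul_le_mul_of_nonneg_right (p i).2.2 hN'.le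
      push_cast
      linarith
  obtain ⟨h1, h2⟩ := hz c p hp
  refine ⟨c, fun i => ?_, h2⟩
  have hpi := hp i
  have hzi := h1 i
  have e : ((c i : ℝ) + 1) / N = (c i : ℝ) / N + 1 / N := add_div _ _ _
  rw [abs_le]
  constructor <;> linarith [hpi.1, hpi.2, hzi.1, hzi.2]

/-! ### Mean excess over the upper confidence bound -/

section Excess

variable {Ω : Type*} [MeasurableSpace Ω] {P : Measure Ω} [IsProbabilityMeasure P] {d : ℕ}
  {κ : Cube d → Cube d → ℝ} {η : ℝ} {f : Ω → C(Cube d, ℝ)} {ε : ℕ → Ω → ℝ}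

theorem integrable_eval_posteriorKernel (hη : 0 < η) (hf : IsCenteredGP P κ f)
    (hε : IsGaussianNoise P η f ε) {j : ℕ} (D : Data d j) (p : Cube d) :
    Integrable (fun h : C(Cube d, ℝ) => h p) (posteriorKernel η (P.map f) j D) ∧
      ∫ h, h p ∂(posteriorKernel η (P.map f) j D) = dataMean κ η D p := by
  have hm := ContinuousMap.measurable_eval_const (X := Cube d) p
  have h := map_posteriorKernel_eval hη hf hε D p
  constructor
  · have : Integrable (fun y : ℝ => y) ((posteriorKernel η (P.map f) j D).map fun h => h p) := by
      rw [h]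
      exact (memLp_id_gaussianReal 1).integrable le_rfl
    exact this.comp_measurable hm
  · have := integral_map (μ := posteriorKernel η (P.map f) j D) hm.aemeasurable
      (f := fun y : ℝ => y) aestronglyMeasurable_id
    rw [← this, h, integral_id_gaussianReal]

/-- The posterior mean is the average of posterior functions, so their average Lipschitz constant is
one for it. -/
theorem abs_dataMean_sub_le (hη : 0 < η) (hf : IsCenteredGP P κ f) (hε : IsGaussianNoise P η f ε)
    {j : ℕ} (D : Data d j) {p q : Cube d} {δ : ℝ} (hpq : ∀ i, |(p i - q i : ℝ)| ≤ δ) :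
    ENNReal.ofReal |dataMean κ η D p - dataMean κ η D q| ≤
      (∫⁻ h, totalLipschitz h ∂(posteriorKernel η (P.map f) j D)) * ENNReal.ofReal δ := by
  have hp := integrable_eval_posteriorKernel hη hf hε D p
  have hq := integrable_eval_posteriorKernel hη hf hε D q
  rw [← hp.2, ← hq.2, ← integral_sub hp.1 hq.1, ← Real.enorm_eq_ofReal_abs]
  refine (enorm_integral_le_lintegral_enorm _).trans ?_
  rw [← lintegral_mul_const _ measurable_totalLipschitz]
  refine lintegral_mono fun h => ?_
  rw [Real.enorm_eq_ofReal_abs]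
  exact abs_sub_le_totalLipschitz h hpq

/-- Under the posterior, a function exceeds the upper confidence bound only slightly in mean, even
at a point depending on the function. -/
theorem lintegral_excess_le (hη : 0 < η) (hκ : ∀ p q, κ p q ≤ 1) (hf : IsCenteredGP P κ f)
    (hε : IsGaussianNoise P η f ε) {j : ℕ} (D : Data d j) {N : ℕ} (hN : 0 < N) {s : ℝ} (hs : 0 ≤ s)
    (ξ : C(Cube d, ℝ) → Cube d) :
    ∫⁻ h, ENNReal.ofReal (h (ξ h) - dataMean κ η D (ξ h) - s * √(dataCov κ η D (ξ h) (ξ h)))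
        ∂(posteriorKernel η (P.map f) j D) ≤
      2 * ENNReal.ofReal (1 / N) * ∫⁻ h, totalLipschitz h ∂(posteriorKernel η (P.map f) j D) +
        ENNReal.ofReal (N ^ d * ((√(2 * Real.pi))⁻¹ * Real.exp (-s ^ 2 / 2))) := by
  have hP := Measure.isProbabilityMeasure_map (μ := P) hf.measurable.aemeasurable
  have hK := isMarkovKernel_posteriorKernel (ν := P.map f) (j := j) hη
  set ρ := posteriorKernel η (P.map f) j D with hρ
  set L := ∫⁻ h, totalLipschitz h ∂ρ
  -- Representatives of least variance make `σ(z c) ≤ σ(ξ h)`, so no modulus of continuity of the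
  -- posterior deviation is needed.
  obtain ⟨z, hz⟩ := exists_cell_minimiser (d := d) hN ((continuous_dataCov_self hη hf (j := j)).comp
    (continuous_const.prodMk continuous_id : Continuous fun p : Cube d => (D, p)))
  simp only [Function.comp_apply] at hz
  have hexc : ∀ c : Fin d → Fin N, Measurable fun h : C(Cube d, ℝ) => ENNReal.ofReal
      (h (z c) - dataMean κ η D (z c) - s * √(dataCov κ η D (z c) (z c))) := fun c =>
    (((ContinuousMap.measurable_eval_const _).sub_const _).sub_const _).ennreal_ofReal
  have hpt : ∀ h : C(Cube d, ℝ),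
      ENNReal.ofReal (h (ξ h) - dataMean κ η D (ξ h) - s * √(dataCov κ η D (ξ h) (ξ h))) ≤
        (totalLipschitz h * ENNReal.ofReal (1 / N) + L * ENNReal.ofReal (1 / N)) +
        ∑ c : Fin d → Fin N, ENNReal.ofReal
          (h (z c) - dataMean κ η D (z c) - s * √(dataCov κ η D (z c) (z c))) := fun h => by
    obtain ⟨c, hc, hle⟩ := hz (ξ h)
    have h1 := abs_sub_le_totalLipschitz h hc
    have h2 := abs_dataMean_sub_le hη hf hε D hc
    -- The cell depends on `h`; summing over all cells removes this dependence at the price of the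
    -- factor `N ^ d`.
    have h3 : ENNReal.ofReal (h (z c) - dataMean κ η D (z c) - s * √(dataCov κ η D (z c) (z c))) ≤
        ∑ c : Fin d → Fin N, ENNReal.ofReal
          (h (z c) - dataMean κ η D (z c) - s * √(dataCov κ η D (z c) (z c))) :=
      Finset.single_le_sum (f := fun c : Fin d → Fin N => ENNReal.ofReal
          (h (z c) - dataMean κ η D (z c) - s * √(dataCov κ η D (z c) (z c))))
        (fun _ _ => zero_le) (Finset.mem_univ c)
    refine le_trans ?_ (add_le_add (add_le_add h1 h2) h3)
    rw [← ENNReal.ofReal_add (abs_nonneg _) (abs_nonneg _)]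
    refine le_trans (ENNReal.ofReal_le_ofReal ?_) ENNReal.ofReal_add_le
    have h4 := mul_le_mul_of_nonneg_left (Real.sqrt_le_sqrt hle) hs
    have h5 := le_abs_self (h (ξ h) - h (z c))
    have h6 := neg_abs_le (dataMean κ η D (ξ h) - dataMean κ η D (z c))
    linarith
  have hcell : ∀ c : Fin d → Fin N, ∫⁻ h : C(Cube d, ℝ), ENNReal.ofReal
      (h (z c) - dataMean κ η D (z c) - s * √(dataCov κ η D (z c) (z c))) ∂ρ ≤
        ENNReal.ofReal ((√(2 * Real.pi))⁻¹ * Real.exp (-s ^ 2 / 2)) := fun c => by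
    have hv0 := posteriorCov_self_nonneg hη hf hε (fun i => (D i).1) (z c)
    have hv1 := (posteriorCov_self_le hη hf (fun i => (D i).1) (z c)).trans (hκ _ _)
    have hG : Measurable fun y : ℝ => ENNReal.ofReal
        (y - dataMean κ η D (z c) - s * √(dataCov κ η D (z c) (z c))) := by fun_prop
    rw [← lintegral_map hG (ContinuousMap.measurable_eval_const (z c)), hρ,
      map_posteriorKernel_eval hη hf hε]
    refine (lintegral_gaussianReal_sub_le _ hv0 hs).trans (ENNReal.ofReal_le_ofReal ?_)
    refine mul_le_of_le_one_left (by positivity) (Real.sqrt_le_one.2 hv1)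
  refine (lintegral_mono hpt).trans ?_
  have hLm : Measurable fun h : C(Cube d, ℝ) => totalLipschitz h * ENNReal.ofReal (1 / N) :=
    measurable_totalLipschitz.mul_const _
  rw [lintegral_add_left (hLm.add_const _), lintegral_add_left hLm, lintegral_const, measure_univ,
    mul_one, lintegral_mul_const _ measurable_totalLipschitz,
    lintegral_finsetSum _ fun c _ => hexc c]
  refine add_le_add (le_of_eq (by ring)) ((Finset.sum_le_card_nsmul _ _ _ fun c _ =>
    hcell c).trans (le_of_eq ?_))
  rw [nsmul_eq_mul, Finset.card_univ, Fintype.card_pi_const, Fintype.card_fin,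
    ← ENNReal.ofReal_natCast, ← ENNReal.ofReal_mul (Nat.cast_nonneg _)]
  push_cast
  rfl

end Excess

/-! ### Maxima and sup norms of continuous functions on the cube -/

section Supremum

variable {d : ℕ}

theorem bddAbove_range_cube (h : C(Cube d, ℝ)) : BddAbove (range fun p => h p) :=
  (isCompact_range h.continuous).bddAbove

theorem exists_eq_iSup_cube (h : C(Cube d, ℝ)) : ∃ p, h p = ⨆ q, h q := by
  obtain ⟨p, -, hp⟩ := isCompact_univ.exists_isMaxOn (univ_nonempty (α := Cube d))
    h.continuous.continuousOn
  exact ⟨p, le_antisymm (le_ciSup (bddAbove_range_cube h) p) (ciSup_le fun q => hp (mem_univ q))⟩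

theorem measurable_iSup_cube : Measurable fun h : C(Cube d, ℝ) => ⨆ p, h p := by
  refine LowerSemicontinuous.measurable (lowerSemicontinuous_ciSup bddAbove_range_cube fun p => ?_)
  exact (ContinuousEvalConst.continuous_eval_const p).lowerSemicontinuous

theorem abs_iSup_cube_le (h : C(Cube d, ℝ)) : |⨆ p, h p| ≤ ‖h‖ := by
  obtain ⟨p, hp⟩ := exists_eq_iSup_cube h
  rw [← hp]
  exact h.norm_coe_le_norm p

theorem ofReal_norm_le (h : C(Cube d, ℝ)) :
    ENNReal.ofReal ‖h‖ ≤ ENNReal.ofReal |h 0| + totalLipschitz h := by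
  obtain ⟨p, -, hp⟩ := isCompact_univ.exists_isMaxOn (univ_nonempty (α := Cube d))
    h.continuous.abs.continuousOn
  have h1 : ‖h‖ ≤ |h p| := (ContinuousMap.norm_le _ (abs_nonneg _)).2 fun q => hp (mem_univ q)
  have h2 := abs_sub_le_totalLipschitz h (p := p) (q := 0) (δ := 1) fun i => by
    have h3 := (p i).2
    simp only [Pi.zero_apply, Set.Icc.coe_zero, sub_zero]
    rw [abs_of_nonneg h3.1]
    exact h3.2
  rw [ENNReal.ofReal_one, mul_one] at h2
  refine le_trans ?_ (add_le_add_right h2 _)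
  rw [← ENNReal.ofReal_add (abs_nonneg _) (abs_nonneg _)]
  refine ENNReal.ofReal_le_ofReal (h1.trans ?_)
  have := abs_add_le (h 0) (h p - h 0)
  rwa [add_sub_cancel] at this

end Supremum

/-! ### Expected regret of a single step -/

section Regret

variable {Ω : Type*} [mΩ : MeasurableSpace Ω] {P : Measure Ω} [IsProbabilityMeasure P] {d : ℕ}
  {κ : Cube d → Cube d → ℝ} {η : ℝ} {f : Ω → C(Cube d, ℝ)} {ε : ℕ → Ω → ℝ}
  {g : ℕ → Ω → C(Cube d, ℝ)} {x : ℕ → Ω → Cube d} {a b : ℝ}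

/-- The sup norm is at most `|f 0|` plus the total Lipschitz constant, and both have finite mean. -/
theorem integrable_norm_prior (hf : IsCenteredGP P κ f) (hg : GradientTail P f a b) (ha : 0 < a)
    (hb : 0 < b) : Integrable (fun ω => ‖f ω‖) P := by
  have hm : Measurable fun ω => ‖f ω‖ := continuous_norm.measurable.comp hf.measurable
  refine ⟨hm.aestronglyMeasurable, ?_⟩
  have h1 : ∫⁻ ω, ENNReal.ofReal |f ω 0| ∂P < ∞ := by
    have := ((hf.memLp_two 0).integrable one_le_two).2
    rw [hasFiniteIntegral_iff_norm] at this
    exact this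
  have h2 := (hg.lintegral_totalLipschitz_le ha hb hf.measurable).trans_lt ENNReal.ofReal_lt_top
  have h0 : Measurable fun ω => ENNReal.ofReal |f ω 0| :=
    (continuous_abs.measurable.comp (hf.measurable_eval 0)).ennreal_ofReal
  rw [hasFiniteIntegral_iff_norm]
  calc ∫⁻ ω, ENNReal.ofReal ‖‖f ω‖‖ ∂P ≤ ∫⁻ ω, (ENNReal.ofReal |f ω 0| + totalLipschitz (f ω)) ∂P :=
        lintegral_mono fun ω => by
          rw [norm_norm]
          exact ofReal_norm_le (f ω)
    _ = ∫⁻ ω, ENNReal.ofReal |f ω 0| ∂P + ∫⁻ ω, totalLipschitz (f ω) ∂P :=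
        lintegral_add_left h0 _
    _ < ∞ := ENNReal.add_lt_top.2 ⟨h1, h2⟩

theorem integrable_norm_sample (hη : 0 < η) (hf : IsCenteredGP P κ f)
    (hε : IsGaussianNoise P η f ε) (hTS : IsSeqThompsonSampling P κ η f ε g x)
    (hi : Integrable (fun ω => ‖f ω‖) P) (j : ℕ) : Integrable (fun ω => ‖g j ω‖) P := by
  have hn : Measurable fun h : C(Cube d, ℝ) => ‖h‖ := continuous_norm.measurable
  have h1 := (integrable_map_measure hn.aestronglyMeasurable hf.measurable.aemeasurable).2 hi
  rw [← map_sample hη hf hε hTS j] at h1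
  exact (integrable_map_measure hn.aestronglyMeasurable
    (measurable_sample hTS j).aemeasurable).1 h1

theorem integrable_apply_of_norm {F : Ω → C(Cube d, ℝ)} (hF : Measurable F)
    (hi : Integrable (fun ω => ‖F ω‖) P) {p : Ω → Cube d} (hp : Measurable p) :
    Integrable (fun ω => F ω (p ω)) P :=
  hi.mono' (measurable_apply_random hF hp).aestronglyMeasurable
    (Filter.Eventually.of_forall fun ω => (F ω).norm_coe_le_norm (p ω))

theorem integrable_iSup_of_norm {F : Ω → C(Cube d, ℝ)} (hF : Measurable F)
    (hi : Integrable (fun ω => ‖F ω‖) P) : Integrable (fun ω => ⨆ p, F ω p) P :=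
  hi.mono' (measurable_iSup_cube.comp hF).aestronglyMeasurable
    (Filter.Eventually.of_forall fun ω => abs_iSup_cube_le (F ω))

/-- The expected maximum is the expected value of the posterior sample at the query point. -/
theorem integral_iSup_prior (hη : 0 < η) (hf : IsCenteredGP P κ f)
    (hε : IsGaussianNoise P η f ε) (hTS : IsSeqThompsonSampling P κ η f ε g x) (j : ℕ) :
    ∫ ω, ⨆ p, f ω p ∂P = ∫ ω, g j ω (x j ω) ∂P := by
  have hm := measurable_iSup_cube (d := d)
  have h1 := integral_map hf.measurable.aemeasurable (μ := P) hm.aestronglyMeasurable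
  have h2 := integral_map (measurable_sample hTS j).aemeasurable (μ := P) hm.aestronglyMeasurable
  rw [map_sample hη hf hε hTS j, h1] at h2
  rw [h2]
  refine integral_congr_ae (Filter.Eventually.of_forall fun ω => ?_)
  exact le_antisymm (ciSup_le fun p => hTS.query_argmax j ω p)
    (le_ciSup (bddAbove_range_cube (g j ω)) (x j ω))

/-- The function value at the query point has the same mean as the posterior mean there. -/
theorem integral_prior_query (hη : 0 < η) (hf : IsCenteredGP P κ f)
    (hε : IsGaussianNoise P η f ε) (hTS : IsSeqThompsonSampling P κ η f ε g x)
    (hi : Integrable (fun ω => ‖f ω‖) P) (j : ℕ) :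
    Integrable (fun ω => dataMean κ η (dataAt f ε x j ω) (x j ω)) P ∧
      ∫ ω, f ω (x j ω) ∂P = ∫ ω, dataMean κ η (dataAt f ε x j ω) (x j ω) ∂P := by
  have hP := Measure.isProbabilityMeasure_map (μ := P) hf.measurable.aemeasurable
  have hK := isMarkovKernel_posteriorKernel (ν := P.map f) (j := j) hη
  obtain ⟨ξ, hξ, hx⟩ := exists_query_eq hTS j
  have hD := measurable_dataAt hf hε hTS j
  have hg := measurable_sample hTS j
  have hDg := hD.prodMk hg
  have := Measure.isProbabilityMeasure_map (μ := P) hDg.aemeasurable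
  set K : Kernel (Data d j × C(Cube d, ℝ)) C(Cube d, ℝ) :=
    (posteriorKernel η (P.map f) j).comap Prod.fst measurable_fst
  -- Given data and sample, `f` still follows the posterior given the data alone, since the sample
  -- uses fresh randomness. As the query is a function of data and sample, integrating `f` out there
  -- gives the posterior mean.
  have key : P.map (fun ω => ((dataAt f ε x j ω, g j ω), f ω)) =
      (P.map fun ω => (dataAt f ε x j ω, g j ω)) ⊗ₘ K := by
    refine Measure.ext_of_lintegral _ fun φ hφ => ?_
    rw [lintegral_map hφ (hDg.prodMk hf.measurable), Measure.lintegral_compProd hφ,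
      lintegral_map hφ.lintegral_kernel_prod_right' hDg]
    have hΦ : Measurable fun z : C(Cube d, ℝ) × Data d j × C(Cube d, ℝ) =>
        φ ((z.2.1, z.2.2), z.1) := hφ.comp (measurable_snd.prodMk measurable_fst)
    refine (lintegral_prior_sample_data hη hf hε hTS j hΦ).trans ?_
    have hΨ : Measurable fun z : Data d j × C(Cube d, ℝ) => ∫⁻ h, φ (z, h) ∂(K z) :=
      hφ.lintegral_kernel_prod_right'
    exact (lintegral_sample hη hf hε hTS j (measurable_worldSigma_dataAt f ε g x j) hΨ).symm
  have hF : Measurable fun z : (Data d j × C(Cube d, ℝ)) × C(Cube d, ℝ) => z.2 (ξ z.1) :=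
    ContinuousMap.measurable_uncurry_eval.comp (measurable_snd.prodMk (hξ.comp measurable_fst))
  have hFi : Integrable (fun z : (Data d j × C(Cube d, ℝ)) × C(Cube d, ℝ) => z.2 (ξ z.1))
      ((P.map fun ω => (dataAt f ε x j ω, g j ω)) ⊗ₘ K) := by
    rw [← key, integrable_map_measure hF.aestronglyMeasurable
      (hDg.prodMk hf.measurable).aemeasurable]
    exact integrable_apply_of_norm hf.measurable hi (hξ.comp hDg)
  have hmean : ∀ z : Data d j × C(Cube d, ℝ), ∫ h, h (ξ z) ∂(K z) = dataMean κ η z.1 (ξ z) :=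
    fun z => (integrable_eval_posteriorKernel hη hf hε z.1 (ξ z)).2
  have hMm : Measurable fun z : Data d j × C(Cube d, ℝ) => dataMean κ η z.1 (ξ z) :=
    (continuous_dataMean hη hf).measurable.comp (measurable_fst.prodMk hξ)
  have hMi : Integrable (fun z : Data d j × C(Cube d, ℝ) => dataMean κ η z.1 (ξ z))
      (P.map fun ω => (dataAt f ε x j ω, g j ω)) := by
    refine ((Measure.integrable_compProd_iff hF.aestronglyMeasurable).1 hFi).2.mono'
      hMm.aestronglyMeasurable (Filter.Eventually.of_forall fun z => ?_)
    rw [← hmean]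
    exact norm_integral_le_integral_norm _
  simp_rw [hx]
  refine ⟨(integrable_map_measure hMm.aestronglyMeasurable hDg.aemeasurable).1 hMi, ?_⟩
  have h1 := Measure.integral_compProd hFi
  rw [← key, integral_map (hDg.prodMk hf.measurable).aemeasurable hF.aestronglyMeasurable] at h1
  simp_rw [hmean] at h1
  rw [integral_map hDg.aemeasurable hMm.aestronglyMeasurable] at h1
  exact h1

/-- The posterior standard deviation at the query point of step `j`. -/
noncomputable def queryStd (κ : Cube d → Cube d → ℝ) (η : ℝ) (x : ℕ → Ω → Cube d) (j : ℕ) (ω : Ω) :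
    ℝ :=
  √(posteriorCov κ η (fun i : Fin j => x i ω) (x j ω) (x j ω))

theorem integrable_queryStd (hη : 0 < η) (hκ : ∀ p q, κ p q ≤ 1) (hf : IsCenteredGP P κ f)
    (hε : IsGaussianNoise P η f ε) (hTS : IsSeqThompsonSampling P κ η f ε g x) (j : ℕ) :
    Integrable (queryStd κ η x j) P := by
  have hm : Measurable (queryStd κ η x j) := by
    have h1 : Measurable fun ω => dataCov κ η (dataAt f ε x j ω) (x j ω) (x j ω) :=
      (continuous_dataCov_self hη hf).measurable.comp
        ((measurable_dataAt hf hε hTS j).prodMk (measurable_query hf hε hTS j))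
    exact h1.sqrt
  refine (integrable_const (1 : ℝ)).mono' hm.aestronglyMeasurable
    (Filter.Eventually.of_forall fun ω => ?_)
  rw [queryStd, Real.norm_of_nonneg (Real.sqrt_nonneg _)]
  exact Real.sqrt_le_one.2 ((posteriorCov_self_le hη hf _ _).trans (hκ _ _))

/-- The expected regret of one step. -/
theorem integral_step_regret_le (hη : 0 < η) (hκ : ∀ p q, κ p q ≤ 1) (hf : IsCenteredGP P κ f)
    (hε : IsGaussianNoise P η f ε) (hTS : IsSeqThompsonSampling P κ η f ε g x)
    (hg : GradientTail P f a b) (ha : 0 < a) (hb : 0 < b) {N : ℕ} (hN : 0 < N) {s : ℝ}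
    (hs : 0 ≤ s) (j : ℕ) :
    ∫ ω, ((⨆ p, f ω p) - f ω (x j ω)) ∂P ≤
      d * a * b * √Real.pi / N + N ^ d * ((√(2 * Real.pi))⁻¹ * Real.exp (-s ^ 2 / 2)) +
        s * ∫ ω, queryStd κ η x j ω ∂P := by
  have hi := integrable_norm_prior hf hg ha hb
  have hxm := measurable_query hf hε hTS j
  have hgm := measurable_sample hTS j
  have hDm := measurable_dataAt hf hε hTS j
  obtain ⟨hMi, hM⟩ := integral_prior_query hη hf hε hTS hi j
  have hgi := integrable_apply_of_norm hgm (integrable_norm_sample hη hf hε hTS hi j) hxm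
  have hσ := integrable_queryStd hη hκ hf hε hTS j
  have hTi : Integrable (fun ω => g j ω (x j ω) - dataMean κ η (dataAt f ε x j ω) (x j ω) -
      s * queryStd κ η x j ω) P := (hgi.sub hMi).sub (hσ.const_mul s)
  have hT : ∫⁻ ω, ENNReal.ofReal (g j ω (x j ω) - dataMean κ η (dataAt f ε x j ω) (x j ω) -
      s * queryStd κ η x j ω) ∂P ≤ ENNReal.ofReal (d * a * b * √Real.pi / N +
        N ^ d * ((√(2 * Real.pi))⁻¹ * Real.exp (-s ^ 2 / 2))) := by
    obtain ⟨ξ, hξ, hx⟩ := exists_query_eq hTS j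
    have hΦ : Measurable fun z : Data d j × C(Cube d, ℝ) => ENNReal.ofReal (z.2 (ξ z) -
        dataMean κ η z.1 (ξ z) - s * √(dataCov κ η z.1 (ξ z) (ξ z))) := by
      have h1 : Measurable fun z : Data d j × C(Cube d, ℝ) => z.2 (ξ z) :=
        ContinuousMap.measurable_uncurry_eval.comp (measurable_snd.prodMk hξ)
      have h2 : Measurable fun z : Data d j × C(Cube d, ℝ) => dataMean κ η z.1 (ξ z) :=
        (continuous_dataMean hη hf).measurable.comp (measurable_fst.prodMk hξ)
      have h3 : Measurable fun z : Data d j × C(Cube d, ℝ) => dataCov κ η z.1 (ξ z) (ξ z) :=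
        (continuous_dataCov_self hη hf).measurable.comp (measurable_fst.prodMk hξ)
      exact ((h1.sub h2).sub (h3.sqrt.const_mul s)).ennreal_ofReal
    have h1 := lintegral_sample hη hf hε hTS j (measurable_worldSigma_dataAt f ε g x j) hΦ
    have h2 := lintegral_prior_data hη hf hε hTS j (Φ := fun z => totalLipschitz z.1)
      (measurable_totalLipschitz.comp measurable_fst)
    have hN' : (0 : ℝ) < N := Nat.cast_pos.2 hN
    calc ∫⁻ ω, ENNReal.ofReal (g j ω (x j ω) - dataMean κ η (dataAt f ε x j ω) (x j ω) -
          s * queryStd κ η x j ω) ∂P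
        = ∫⁻ ω, ∫⁻ h, ENNReal.ofReal (h (ξ (dataAt f ε x j ω, h)) -
            dataMean κ η (dataAt f ε x j ω) (ξ (dataAt f ε x j ω, h)) -
            s * √(dataCov κ η (dataAt f ε x j ω) (ξ (dataAt f ε x j ω, h))
              (ξ (dataAt f ε x j ω, h))))
            ∂(posteriorKernel η (P.map f) j (dataAt f ε x j ω)) ∂P := by
          rw [← h1]
          refine lintegral_congr fun ω => ?_
          rw [← hx]
          rfl
      _ ≤ ∫⁻ ω, (2 * ENNReal.ofReal (1 / N) *
            ∫⁻ h, totalLipschitz h ∂(posteriorKernel η (P.map f) j (dataAt f ε x j ω)) +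
          ENNReal.ofReal (N ^ d * ((√(2 * Real.pi))⁻¹ * Real.exp (-s ^ 2 / 2)))) ∂P :=
          lintegral_mono fun ω => lintegral_excess_le hη hκ hf hε _ hN hs _
      _ = 2 * ENNReal.ofReal (1 / N) * ∫⁻ ω, totalLipschitz (f ω) ∂P +
          ENNReal.ofReal (N ^ d * ((√(2 * Real.pi))⁻¹ * Real.exp (-s ^ 2 / 2))) := by
          have hK := (measurable_totalLipschitz (d := d)).lintegral_kernel
            (κ := posteriorKernel η (P.map f) j)
          have hK' := hK.comp hDm
          rw [lintegral_add_right _ measurable_const, lintegral_const, measure_univ, mul_one, h2]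
          congr 1
          exact lintegral_const_mul _ hK'
      _ ≤ 2 * ENNReal.ofReal (1 / N) * ENNReal.ofReal (d * a * b * √Real.pi / 2) +
          ENNReal.ofReal (N ^ d * ((√(2 * Real.pi))⁻¹ * Real.exp (-s ^ 2 / 2))) := by
          gcongr
          exact hg.lintegral_totalLipschitz_le ha hb hf.measurable
      _ = _ := by
          rw [← ENNReal.ofReal_ofNat 2, ← ENNReal.ofReal_mul (by norm_num),
            ← ENNReal.ofReal_mul (by positivity), ← ENNReal.ofReal_add (by positivity)
            (by positivity)]
          congr 2
          field_simp
  have hTle : ∫ ω, (g j ω (x j ω) - dataMean κ η (dataAt f ε x j ω) (x j ω) -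
      s * queryStd κ η x j ω) ∂P ≤ d * a * b * √Real.pi / N +
        N ^ d * ((√(2 * Real.pi))⁻¹ * Real.exp (-s ^ 2 / 2)) := by
    -- The integral is at most that of the positive part, which `hT` bounds.
    rw [integral_eq_lintegral_pos_part_sub_lintegral_neg_part hTi]
    have := ENNReal.toReal_le_of_le_ofReal (by positivity) hT
    exact (sub_le_self _ ENNReal.toReal_nonneg).trans this
  have hgM : Integrable (fun ω => g j ω (x j ω) - dataMean κ η (dataAt f ε x j ω) (x j ω)) P :=
    hgi.sub hMi
  -- The Thompson sampling identity: `E g_j(x_j)` becomes `E max f`, and `E μ_j(x_j)` becomes `E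
  -- f(x_j)`.
  rw [integral_sub hgM (hσ.const_mul s), integral_sub hgi hMi,
    ← integral_iSup_prior hη hf hε hTS j, ← hM, integral_const_mul] at hTle
  rw [integral_sub (integrable_iSup_of_norm hf.measurable hi)
    (integrable_apply_of_norm hf.measurable hi hxm)]
  linarith

end Regret

/-! ### From step regrets to the simple regret -/

section SimpleRegret

variable {Ω : Type*} [mΩ : MeasurableSpace Ω] {P : Measure Ω} [IsProbabilityMeasure P] {d : ℕ}
  {κ : Cube d → Cube d → ℝ} {η : ℝ} {f : Ω → C(Cube d, ℝ)} {ε : ℕ → Ω → ℝ}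
  {g : ℕ → Ω → C(Cube d, ℝ)} {x : ℕ → Ω → Cube d} {a b : ℝ} {n : ℕ}

theorem simpleRegret_le (j : Fin n) (ω : Ω) :
    simpleRegret f x n ω ≤ (⨆ p, f ω p) - f ω (x j ω) :=
  sub_le_sub_left (le_ciSup (f := fun j : Fin n => f ω (x j ω)) (finite_range _).bddAbove j) _

theorem simpleRegret_nonneg (hn : 1 ≤ n) (ω : Ω) : 0 ≤ simpleRegret f x n ω := by
  have : Nonempty (Fin n) := ⟨⟨0, hn⟩⟩
  exact sub_nonneg.2 (ciSup_le fun j => le_ciSup (bddAbove_range_cube (f ω)) (x j ω))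

theorem mul_simpleRegret_le (ω : Ω) : n * simpleRegret f x n ω ≤
    ∑ j ∈ Finset.range n, ((⨆ p, f ω p) - f ω (x j ω)) := by
  rw [Finset.sum_range fun j => (⨆ p, f ω p) - f ω (x j ω)]
  refine le_trans (le_of_eq ?_)
    (Finset.card_nsmul_le_sum Finset.univ _ _ fun j _ => simpleRegret_le (f := f) (x := x) j ω)
  simp

theorem integrable_simpleRegret (hn : 1 ≤ n) (hf : Measurable f)
    (hx : ∀ j, Measurable (x j)) (hi : Integrable (fun ω => ‖f ω‖) P) :
    Integrable (simpleRegret f x n) P := by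
  have h1 := (integrable_iSup_of_norm hf hi).sub (integrable_apply_of_norm hf hi (hx 0))
  have hm : Measurable (simpleRegret f x n) :=
    (measurable_iSup_cube.comp hf).sub (Measurable.iSup fun j : Fin n =>
      measurable_apply_random hf (hx j))
  refine h1.mono' hm.aestronglyMeasurable (Filter.Eventually.of_forall fun ω => ?_)
  rw [Real.norm_of_nonneg (simpleRegret_nonneg hn ω)]
  exact simpleRegret_le (⟨0, hn⟩ : Fin n) ω

/-- The regret is at most the total Lipschitz constant. -/
theorem integral_simpleRegret_le_lipschitz (hn : 1 ≤ n) (hf : Measurable f)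
    (hx : ∀ j, Measurable (x j)) (hi : Integrable (fun ω => ‖f ω‖) P) (hg : GradientTail P f a b)
    (ha : 0 < a) (hb : 0 < b) :
    ∫ ω, simpleRegret f x n ω ∂P ≤ d * a * b * √Real.pi / 2 := by
  rw [integral_eq_lintegral_of_nonneg_ae
    (Filter.Eventually.of_forall fun ω => simpleRegret_nonneg hn ω)
    (integrable_simpleRegret hn hf hx hi).aestronglyMeasurable]
  refine ENNReal.toReal_le_of_le_ofReal (by positivity)
    (le_trans (lintegral_mono fun ω => ?_) (hg.lintegral_totalLipschitz_le ha hb hf))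
  obtain ⟨p, hp⟩ := exists_eq_iSup_cube (f ω)
  have h2 := abs_sub_le_totalLipschitz (f ω) (p := p) (q := x 0 ω) (δ := 1) fun i => by
    have h3 := (p i).2
    have h4 := (x 0 ω i).2
    rw [abs_le]
    constructor <;> linarith [h3.1, h3.2, h4.1, h4.2]
  rw [ENNReal.ofReal_one, mul_one] at h2
  refine le_trans (ENNReal.ofReal_le_ofReal ?_) h2
  have := simpleRegret_le (f := f) (x := x) (⟨0, hn⟩ : Fin n) ω
  rw [← hp] at this
  exact this.trans (le_abs_self _)

theorem sum_integral_queryStd_le (hd : 1 ≤ d) (hη : 0 < η) (hκ : ∀ p q, κ p q ≤ 1)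
    (hf : IsCenteredGP P κ f) (hε : IsGaussianNoise P η f ε)
    (hTS : IsSeqThompsonSampling P κ η f ε g x) (n : ℕ) :
    ∑ j ∈ Finset.range n, ∫ ω, queryStd κ η x j ω ∂P ≤
      √(n * (2 / Real.log (1 + (η ^ 2)⁻¹) * (maxInfoGain P f ε n).toReal)) := by
  have hσ := integrable_queryStd hη hκ hf hε hTS
  rw [← integral_finsetSum _ fun j _ => hσ j]
  refine (integral_mono (integrable_finsetSum _ fun j _ => hσ j) (integrable_const _)
    fun ω => sum_sqrt_posteriorCov_le hd hη hκ hf hε (fun j => x j ω) n).trans (le_of_eq ?_)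
  simp

theorem mul_integral_simpleRegret_le (hd : 1 ≤ d) (hn : 1 ≤ n) (hη : 0 < η)
    (hκ : ∀ p q, κ p q ≤ 1) (hf : IsCenteredGP P κ f)
    (hε : IsGaussianNoise P η f ε) (hTS : IsSeqThompsonSampling P κ η f ε g x)
    (hg : GradientTail P f a b) (ha : 0 < a) (hb : 0 < b) {N : ℕ} (hN : 0 < N) {s : ℝ}
    (hs : 0 ≤ s) :
    n * ∫ ω, simpleRegret f x n ω ∂P ≤
      n * (d * a * b * √Real.pi / N + N ^ d * ((√(2 * Real.pi))⁻¹ * Real.exp (-s ^ 2 / 2))) +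
        s * √(n * (2 / Real.log (1 + (η ^ 2)⁻¹) * (maxInfoGain P f ε n).toReal)) := by
  have hi := integrable_norm_prior hf hg ha hb
  have hx := measurable_query hf hε hTS
  have hr : ∀ j, Integrable (fun ω => (⨆ p, f ω p) - f ω (x j ω)) P := fun j =>
    (integrable_iSup_of_norm hf.measurable hi).sub
      (integrable_apply_of_norm hf.measurable hi (hx j))
  rw [← integral_const_mul]
  calc ∫ ω, n * simpleRegret f x n ω ∂P
      ≤ ∫ ω, ∑ j ∈ Finset.range n, ((⨆ p, f ω p) - f ω (x j ω)) ∂P :=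
        integral_mono ((integrable_simpleRegret hn hf.measurable hx hi).const_mul _)
          (integrable_finsetSum _ fun j _ => hr j) fun ω => mul_simpleRegret_le ω
    _ = ∑ j ∈ Finset.range n, ∫ ω, ((⨆ p, f ω p) - f ω (x j ω)) ∂P :=
        integral_finsetSum _ fun j _ => hr j
    _ ≤ ∑ j ∈ Finset.range n, (d * a * b * √Real.pi / N +
          N ^ d * ((√(2 * Real.pi))⁻¹ * Real.exp (-s ^ 2 / 2)) +
            s * ∫ ω, queryStd κ η x j ω ∂P) :=
        Finset.sum_le_sum fun j _ => integral_step_regret_le hη hκ hf hε hTS hg ha hb hN hs j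
    _ ≤ _ := by
        rw [Finset.sum_add_distrib, ← Finset.mul_sum]
        refine add_le_add (by rw [Finset.sum_const, Finset.card_range, nsmul_eq_mul])
          (mul_le_mul_of_nonneg_left (sum_integral_queryStd_le hd hη hκ hf hε hTS n) hs)

end SimpleRegret

/-! ### Numerical estimates -/

theorem le_regret_constant :
    (9 / 5 : ℝ) ≤ Real.pi ^ 2 / 6 + √(2 * Real.pi) / 12 := by
  have h1 := Real.pi_gt_d2
  have h2 : (12 / 5 : ℝ) ≤ √(2 * Real.pi) := Real.le_sqrt_of_sq_le (by norm_num; linarith)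
  nlinarith

theorem inv_sqrt_two_pi_le : (√(2 * Real.pi))⁻¹ ≤ 5 / 12 := by
  have h1 := Real.pi_gt_d2
  have h2 : (12 / 5 : ℝ) ≤ √(2 * Real.pi) := Real.le_sqrt_of_sq_le (by norm_num; linarith)
  calc (√(2 * Real.pi))⁻¹ ≤ (12 / 5 : ℝ)⁻¹ := inv_anti₀ (by norm_num) h2
    _ = 5 / 12 := by norm_num

/-- In this form `exp(-β_n / 2)` visibly cancels the number of cells, at most `(n² M) ^ d`, and
leaves `n⁻²`. -/
theorem betaCoeff_eq (d : ℕ) {a b : ℝ} {n : ℕ} (hn : 1 ≤ n)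
    (hM : 0 < d * a * b * √Real.pi) :
    betaCoeff d a b n =
      2 * Real.log ((n : ℝ) ^ 2 * ((n : ℝ) ^ 2 * (d * a * b * √Real.pi)) ^ d) := by
  have hn' : (0 : ℝ) < n := by exact_mod_cast hn
  rw [Real.log_mul (by positivity) (by positivity), Real.log_pow, Real.log_pow,
    Real.log_mul (by positivity) hM.ne', Real.log_pow, betaCoeff]
  push_cast
  ring

/-- The discretisation errors are of order `n⁻²`. -/
theorem discretisation_error_le {d n : ℕ} {M : ℝ} (hn : 1 ≤ n) (hM : 3 ≤ (n : ℝ) ^ 2 * M) {s : ℝ}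
    (hs : s ^ 2 = 2 * Real.log ((n : ℝ) ^ 2 * ((n : ℝ) ^ 2 * M) ^ d)) :
    M / ⌊(n : ℝ) ^ 2 * M⌋₊ + (⌊(n : ℝ) ^ 2 * M⌋₊ : ℝ) ^ d *
      ((√(2 * Real.pi))⁻¹ * Real.exp (-s ^ 2 / 2)) ≤ 7 / 4 / (n : ℝ) ^ 2 := by
  have hn' : (0 : ℝ) < n := by exact_mod_cast hn
  have hQ : 0 < (n : ℝ) ^ 2 * M := by linarith
  set N := ⌊(n : ℝ) ^ 2 * M⌋₊
  have hN1 : (N : ℝ) ≤ (n : ℝ) ^ 2 * M := Nat.floor_le hQ.le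
  have hN2 : (n : ℝ) ^ 2 * M < N + 1 := Nat.lt_floor_add_one _
  have hN3 : (3 : ℝ) ≤ N := by
    have : 3 ≤ N := Nat.le_floor (by exact_mod_cast hM)
    exact_mod_cast this
  have he : Real.exp (-s ^ 2 / 2) = ((n : ℝ) ^ 2 * ((n : ℝ) ^ 2 * M) ^ d)⁻¹ := by
    rw [hs, show -(2 * Real.log ((n : ℝ) ^ 2 * ((n : ℝ) ^ 2 * M) ^ d)) / 2 =
      -Real.log ((n : ℝ) ^ 2 * ((n : ℝ) ^ 2 * M) ^ d) by ring, Real.exp_neg,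
      Real.exp_log (by positivity)]
  -- Since `N ≥ 3`, rounding down loses at most the factor `4 / 3`: `n² M < N + 1 ≤ 4 N / 3`.
  have h1 : M / N ≤ 4 / 3 / (n : ℝ) ^ 2 := by
    rw [div_le_div_iff₀ (by linarith) (by positivity)]
    nlinarith
  have h2 : (N : ℝ) ^ d * ((√(2 * Real.pi))⁻¹ * Real.exp (-s ^ 2 / 2)) ≤
      5 / 12 / (n : ℝ) ^ 2 := by
    rw [he]
    have h3 : (N : ℝ) ^ d ≤ ((n : ℝ) ^ 2 * M) ^ d := pow_le_pow_left₀ (by linarith) hN1 d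
    calc (N : ℝ) ^ d * ((√(2 * Real.pi))⁻¹ * ((n : ℝ) ^ 2 * ((n : ℝ) ^ 2 * M) ^ d)⁻¹)
        ≤ ((n : ℝ) ^ 2 * M) ^ d * (5 / 12 * ((n : ℝ) ^ 2 * ((n : ℝ) ^ 2 * M) ^ d)⁻¹) := by
          gcongr
          exact inv_sqrt_two_pi_le
      _ = 5 / 12 / (n : ℝ) ^ 2 := by
          have : ((n : ℝ) ^ 2 * M) ^ d ≠ 0 := by positivity
          field_simp
  calc _ ≤ 4 / 3 / (n : ℝ) ^ 2 + 5 / 12 / (n : ℝ) ^ 2 := add_le_add h1 h2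
    _ = 7 / 4 / (n : ℝ) ^ 2 := by ring

/-! ### The Bayes simple regret bound -/

theorem mainTheorem2 {Ω : Type*} [MeasurableSpace Ω] (P : Measure Ω) [IsProbabilityMeasure P]
    (d : ℕ) (hd : 1 ≤ d) (κ : Cube d → Cube d → ℝ) (hκ : ∀ p q, κ p q ≤ 1)
    (η : ℝ) (hη : 0 < η) (a b : ℝ) (ha : 0 < a) (hb : 0 < b)
    (f : Ω → C(Cube d, ℝ)) (hf : IsCenteredGP P κ f) (hgrad : GradientTail P f a b)
    (ε : ℕ → Ω → ℝ) (hε : IsGaussianNoise P η f ε)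
    (g : ℕ → Ω → C(Cube d, ℝ)) (x : ℕ → Ω → Cube d)
    (hTS : IsSeqThompsonSampling P κ η f ε g x)
    (n : ℕ) (hn : 1 ≤ n) :
    maxInfoGain P f ε n ≠ ∞ ∧
    Integrable (simpleRegret f x n) P ∧
    ∫ ω, simpleRegret f x n ω ∂P ≤
      (Real.pi ^ 2 / 6 + √(2 * Real.pi) / 12) / n +
        √(2 / Real.log (1 + (η ^ 2)⁻¹) * betaCoeff d a b n * (maxInfoGain P f ε n).toReal / n) := by
  have hi := integrable_norm_prior hf hgrad ha hb
  have hx := measurable_query hf hε hTS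
  refine ⟨maxInfoGain_ne_top hη hκ hf hε n, integrable_simpleRegret hn hf.measurable hx hi, ?_⟩
  have hn1 : (1 : ℝ) ≤ n := by exact_mod_cast hn
  have hn0 : (0 : ℝ) < n := by linarith
  have hd0 : (0 : ℝ) < d := by exact_mod_cast hd
  have hC := le_regret_constant
  set C := Real.pi ^ 2 / 6 + √(2 * Real.pi) / 12
  set M := d * a * b * √Real.pi with hM
  have hM0 : 0 < M := by positivity
  have hsq : 7 / 4 / (n : ℝ) ^ 2 ≤ C / n := by
    rw [div_le_div_iff₀ (by positivity) hn0]
    nlinarith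
  -- For small `n² M` the grid could be too coarse or empty and `β_n` negative. There the trivial
  -- bound `M / 2 < 3 / (2 n²)` by the expected Lipschitz constant already fits under `C / n`.
  rcases lt_or_ge ((n : ℝ) ^ 2 * M) 3 with h3 | h3
  · have h1 := integral_simpleRegret_le_lipschitz hn hf.measurable hx hi hgrad ha hb
    have h2 : M / 2 ≤ 7 / 4 / (n : ℝ) ^ 2 := by
      rw [div_le_div_iff₀ two_pos (by positivity)]
      linarith
    linarith [Real.sqrt_nonneg (2 / Real.log (1 + (η ^ 2)⁻¹) * betaCoeff d a b n *
      (maxInfoGain P f ε n).toReal / n)]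
  · have hβ := betaCoeff_eq d hn hM0
    have hβ0 : 0 ≤ betaCoeff d a b n := by
      rw [hβ]
      refine mul_nonneg two_pos.le (Real.log_nonneg ?_)
      exact one_le_mul_of_one_le_of_one_le (one_le_pow₀ hn1) (one_le_pow₀ (by linarith))
    have hs := Real.sq_sqrt hβ0
    -- The grid resolution `N = ⌊n² M⌋` and the confidence width `s = √β_n` balance the Lipschitz
    -- error against the union bound.
    have hN : 0 < ⌊(n : ℝ) ^ 2 * M⌋₊ := Nat.floor_pos.2 (by linarith)
    have key := mul_integral_simpleRegret_le hd hn hη hκ hf hε hTS hgrad ha hb hN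
      (Real.sqrt_nonneg (betaCoeff d a b n))
    have herr := discretisation_error_le hn h3 (hs.trans hβ)
    set γ := (maxInfoGain P f ε n).toReal
    set L := 2 / Real.log (1 + (η ^ 2)⁻¹)
    have hroot : √(betaCoeff d a b n) * √(n * (L * γ)) = n * √(L * betaCoeff d a b n * γ / n) := by
      have : n * √(L * betaCoeff d a b n * γ / n) =
          √((n : ℝ) ^ 2 * (L * betaCoeff d a b n * γ / n)) := by
        rw [Real.sqrt_mul (sq_nonneg _), Real.sqrt_sq hn0.le]
      rw [this, ← Real.sqrt_mul hβ0]
      congr 1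
      field_simp
    rw [hroot, ← mul_add] at key
    have key2 := le_of_mul_le_mul_left key hn0
    linarith
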